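/- **Conventions.** Let $\mathbb F$ be a field. A symmetric sequence $\mathcal M=(\mathcal M(n))_{n\ge 0}$ is a sequence of $\mathbb F$-linear (left) representations of the symmetric groups $\mathfrak S_n$; it is reduced if $\mathcal M(0)=0$. With $\mathcal N^{\otimes k}$ the $k$-fold tensor power of symmetric sequences (Day convolution), put $$\mathcal M\circ\mathcal N=\bigoplus_{k}(\mathcal M(k)\otimes\mathcal N^{\otimes k})_{\mathfrak S_k},\qquad \mathcal M\tilde\circ\mathcal N=\bigoplus_{k}(\mathcal M(k)\otimes\mathcal N^{\otimes k})^{\mathfrak S_k},$$ and write $(x;z_1,\dots,z_n)\in\mathcal M\circ\mathcal N$ for the class of $x\otimes z_1\otimes\dots\otimes z_n$. The trace map $Tr_{\mathcal M,\mathcal N}:\mathcal M\circ\mathcal N\to\mathcal M\tilde\circ\mathcal N$ sends the class of $t\in\mathcal M(k)\otimes\mathcal N^{\otimes k}$ to $\sum_{\tau\in\mathfrak S_k}\tau\cdot t$; it is an isomorphism if $\mathcal N$ is reduced. For a vector space $V$ (seen in arity $0$), $\mathcal M\tilde\circ V=\bigoplus_n(\mathcal M(n)\otimes V^{\otimes n})^{\mathfrak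 S_n}$. Let $\mathfrak a_{\mathcal M,\mathcal N,V}:\mathcal M\tilde\circ(\mathcal N\tilde\circ V)\to(\mathcal M\tilde\circ\mathcal N)\tilde\circ V$ be the associator, that is, the canonical isomorphism given by the identification of both sides with the same subspace of $\prod_{n,k}\prod_{f:[n]\to[k]}\mathcal M(k)\otimes\bigotimes_{j\in[k]}\big(\mathcal N(f^{-1}(j))\otimes V^{\otimes f^{-1}(j)}\big)$. *Partitions.* An ordered partition $R$ of $[n]$ into (possibly empty) blocks indexed by a finite set $J$ is identified with the map $R:[n]\to J$ whose fibres are the blocks, and $\mathfrak S_R\subset\mathfrak S_n$ is the group of the permutations that preserve each block. A tuple $r=(r_1,\dots,r_p)$ of non-negative integers with sum $n$ is identified with the partition of $[n]$ into successive intervals of lengths $r_1,\dots,r_p$. If $x\in\mathcal M(n)$ is fixed by $\mathfrak S_R$ and $(a_i)_{i\in J}$ are vectors of $V$, put $$\beta_{x,R}\big((a_i)_{i\in J}\big)=\sum_{\sigma\in\mathfrak S_n/\mathfrak S_R}\sigma\cdot\big(x\otimes a_{R(1)}\otimes\dots\otimes a_{R(n)}\big)\in\mathcal M\tilde\circ V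 .$$ Given $r=(r_1,\dots,r_p)$ and, for each $i$, a tuple $q_i=(q_{i,1},\dots,q_{i,s_i})$ of non-negative integers with sum $m_i$, cut $[r_1m_1+\dots+r_pm_p]$ into successive intervals: $r_1$ intervals of length $m_1$, then $r_2$ of length $m_2$, …, then $r_p$ of length $m_p$. The partition $r\diamond(q_1,\dots,q_p)$ has blocks indexed by the pairs $(i,l)$ with $1\le l\le s_i$ (in lexicographic order), the block $(i,l)$ being the union, over the $r_i$ intervals of length $m_i$, of the $l$-th blocks of the copies of $q_i$ in them. The group $\prod_i\mathfrak S_{r_i}\wr\mathfrak S_{q_i}$ acts on $[\sum_i r_im_i]$ by permuting, for each $i$, the $r_i$ intervals of length $m_i$ among themselves, and by elements of $\mathfrak S_{q_i}$ within these intervals; its image is a subgroup of $\mathfrak S_{r\diamond(q_1,\dots,q_p)}$. **The distributive law $\tilde\Lambda$.** Let $\mathcal P,\mathcal Q$ be reduced operads over $\mathbb F$ (monoids for $\circ$), with multiplications $\mu_{\mathcal P},\mu_{\mathcal Q}$ and units $\eta_{\mathcal P},\eta_{\mathcal Q}$, and let $\Lambda:\mathcal Q\circ\mathcal P\to\mathcal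 P\circ\mathcal Q$ be an operadic distributive law (a morphism of symmetric sequences compatible with the multiplications and units of $\mathcal P$ and $\mathcal Q$ through the usual four diagrams). Then $\mathcal P\circ\mathcal Q$ is an operad with multiplication $\mu_{\mathcal P\circ\mathcal Q}=(\mu_{\mathcal P}\circ\mu_{\mathcal Q})(\mathcal P\circ\Lambda\circ\mathcal Q)$. For a vector space $V$, let $\tilde\Lambda:\mathcal Q\tilde\circ(\mathcal P\tilde\circ V)\to\mathcal P\tilde\circ(\mathcal Q\tilde\circ V)$ be the composite $$\mathcal Q\tilde\circ(\mathcal P\tilde\circ V)\xrightarrow{\delta_1}\mathcal P\tilde\circ(\mathcal Q\tilde\circ(\mathcal P\tilde\circ(\mathcal Q\tilde\circ V)))\xrightarrow{\delta_2}((\mathcal P\tilde\circ\mathcal Q)\tilde\circ(\mathcal P\tilde\circ\mathcal Q))\tilde\circ V\xrightarrow{\delta_3}((\mathcal P\circ\mathcal Q)\tilde\circ(\mathcal P\circ\mathcal Q))\tilde\circ V\xrightarrow{\delta_4}(\mathcal P\circ\mathcal Q)\tilde\circ V\xrightarrow{\delta_5}(\mathcal P\tilde\circ\mathcal Q)\tilde\circ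 V\xrightarrow{\delta_6}\mathcal P\tilde\circ(\mathcal Q\tilde\circ V),$$ where $\delta_1=\eta_{\mathcal P}\tilde\circ(\mathcal Q\tilde\circ(\mathcal P\tilde\circ(\eta_{\mathcal Q}\tilde\circ V)))$, $\delta_2$ is the composite of the three associators $\mathfrak a_{\mathcal P,\mathcal Q,\mathcal P\tilde\circ(\mathcal Q\tilde\circ V)}$, $(\mathcal P\tilde\circ\mathcal Q)\tilde\circ\mathfrak a_{\mathcal P,\mathcal Q,V}$ and $\mathfrak a_{\mathcal P\tilde\circ\mathcal Q,\mathcal P\tilde\circ\mathcal Q,V}$, $\delta_3=(Tr_{\mathcal P,\mathcal Q}^{-1}\tilde\circ Tr_{\mathcal P,\mathcal Q}^{-1})\tilde\circ V$, $\delta_4=(\mu_{\mathcal P\circ\mathcal Q}\tilde\circ V)(Tr^{-1}_{\mathcal P\circ\mathcal Q,\mathcal P\circ\mathcal Q}\tilde\circ V)$, $\delta_5=Tr_{\mathcal P,\mathcal Q}\tilde\circ V$ and $\delta_6=\mathfrak a_{\mathcal P,\mathcal Q,V}^{-1}$. **Lemma 6.2.** Let $r=(r_1,\dots,r_p)$ be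 a tuple of non-negative integers with sum $n$, and let $x\in\mathcal Q(n)$ be fixed by $\mathfrak S_r$. For each $i\in\{1,\dots,p\}$ let $q_i=(q_{i,1},\dots,q_{i,s_i})$ be a tuple of non-negative integers with sum $m_i$, let $y_i\in\mathcal P(m_i)$ be fixed by $\mathfrak S_{q_i}$, and let $a_{i,1},\dots,a_{i,s_i}\in V$. Put $$\mathfrak s=\beta_{x,r}\big(\beta_{y_1,q_1}(a_{1,1},\dots,a_{1,s_1}),\dots,\beta_{y_p,q_p}(a_{p,1},\dots,a_{p,s_p})\big)\in\mathcal Q\tilde\circ(\mathcal P\tilde\circ V),$$ $$w=\Lambda\big(x;\underbrace{y_1,\dots,y_1}_{r_1},\dots,\underbrace{y_p,\dots,y_p}_{r_p}\big)\in(\mathcal P\circ\mathcal Q)(r_1m_1+\dots+r_pm_p).$$ Then $w$ is fixed by $\prod_i\mathfrak S_{r_i}\wr\mathfrak S_{q_i}$, so that the element $$W=\sum_{\sigma\in\mathfrak S_{r\diamond(q_1,\dots,q_p)}/\prod_i\mathfrak S_{r_i}\wr\mathfrak S_{q_i}}\sigma\cdot w\ \in(\mathcal P\circ\mathcal Q)(r_1m_1+\dots+r_pm_p)$$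 (sum over representatives of left cosets) does not depend on the representatives; $W$ is fixed by $\mathfrak S_{r\diamond(q_1,\dots,q_p)}$; and $$\tilde\Lambda(\mathfrak s)=\mathfrak a_{\mathcal P,\mathcal Q,V}^{-1}\Big((Tr_{\mathcal P,\mathcal Q}\tilde\circ V)\big(\beta_{W,\ r\diamond(q_1,\dots,q_p)}\big((a_{i,l})_{1\le i\le p,\ 1\le l\le s_i}\big)\big)\Big).$$ -/

import Mathlib

universe u

set_option linter.unusedSectionVars false

namespace DivPow

noncomputable section

open scoped TensorProduct Classical DirectSum


/-- A symmetric sequence of `F`-vector spaces, as a functor from finite sets and bijections to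
vector spaces: the representation `M(n)` of the symmetric group `Sₙ` is `M.obj (Fin n)`, on which
`σ` acts by `M.map σ`, and `M.obj S` is the same space with inputs labelled by the finite set `S`. -/
structure SymSeq (F : Type u) [Field F] where
  obj : (S : Type) → [Finite S] → Type u
  [acg : ∀ (S : Type) [Finite S], AddCommGroup (obj S)]
  [mod : ∀ (S : Type) [Finite S], Module F (obj S)]
  map : ∀ {S T : Type} [Finite S] [Finite T], (S ≃ T) → obj S →ₗ[F] obj T
  map_refl : ∀ {S : Type} [Finite S] (x : obj S), map (Equiv.refl S) x = x
  map_trans : ∀ {S T U : Type} [Finite S] [Finite T] [Finite U] (e : S ≃ T) (e' : T ≃ U)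
    (x : obj S), map (e.trans e') x = map e' (map e x)

attribute [instance] SymSeq.acg SymSeq.mod

variable {F : Type u} [Field F]

namespace SymSeq

/-- A symmetric sequence is reduced if `M(0) = 0`. -/
def Reduced (M : SymSeq F) : Prop := Subsingleton (M.obj (Fin 0))

/-- A morphism of symmetric sequences. -/
@[ext]
structure Hom (M N : SymSeq F) where
  app : ∀ (S : Type) [Finite S], M.obj S →ₗ[F] N.obj S
  naturality : ∀ {S T : Type} [Finite S] [Finite T] (e : S ≃ T) (x : M.obj S),
    app T (M.map e x) = N.map e (app S x)

/-- The identity morphism. -/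
def Hom.id (M : SymSeq F) : Hom M M := ⟨fun _ _ => LinearMap.id, fun _ _ => rfl⟩

/-- The composite of two morphisms. -/
def Hom.comp {M N L : SymSeq F} (ψ : Hom N L) (φ : Hom M N) : Hom M L :=
  ⟨fun S _ => (ψ.app S).comp (φ.app S), fun e x => by
    simp [φ.naturality, ψ.naturality]⟩

/-- The inverse of a bijective morphism. -/
def Hom.inv {M N : SymSeq F} (φ : Hom M N)
    (h : ∀ (S : Type) [Finite S], Function.Bijective (φ.app S)) : Hom N M where
  app S _ := (LinearEquiv.ofBijective (φ.app S) (h S)).symm.toLinearMap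
  naturality {S T} _ _ e x := by
    obtain ⟨y, rfl⟩ := (h S).2 x
    apply (h T).1
    rw [φ.naturality]
    simp only [LinearEquiv.coe_coe]
    have h1 := LinearEquiv.ofBijective_symm_apply_apply (φ.app S) (h := h S) y
    rw [h1]
    exact (LinearEquiv.ofBijective (φ.app T) (h T)).apply_symm_apply _

end SymSeq

/-- The fibre of `f` over `k`. -/
abbrev Fib {S K : Type} (f : S → K) (k : K) : Type := {s : S // f s = k}

/-- The bijection between two fibres induced by a compatible bijection. -/
abbrev Fib.congr {S S' K K' : Type} {f : S → K} {f' : S' → K'} {k : K} {k' : K'} (e : S ≃ S')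
    (h : ∀ s, f s = k ↔ f' (e s) = k') : Fib f k ≃ Fib f' k' :=
  e.subtypeEquiv h

section Summand

variable {M N M' N' : SymSeq F}
variable {S S' S'' K K' K'' : Type} [Finite S] [Finite S'] [Finite S'']
  [Finite K] [Finite K'] [Finite K'']

variable (M N) in
/-- The summand `M(K) ⊗ ⨂ₖ N(f⁻¹ k)` of `(M(K) ⊗ N^{⊗ K})(S)` given by a map `f : S → K`, that is,
by a decomposition of `S` into parts indexed by `K`. -/
abbrev Summand (f : S → K) : Type u := M.obj K ⊗[F] (⨂[F] k : K, N.obj (Fib f k))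

variable (M N) in
/-- A pure tensor in a summand. -/
def pureT (f : S → K) (x : M.obj K) (y : ∀ k, N.obj (Fib f k)) : Summand M N f :=
  x ⊗ₜ[F] PiTensorProduct.tprod F y

/-- Relabelling of a family `(yₖ)` along compatible bijections `e : S ≃ S'` and `τ : K ≃ K'`. -/
def push {f : S → K} {f' : S' → K'} (e : S ≃ S') (τ : K ≃ K') (h : ∀ s, f' (e s) = τ (f s))
    (y : ∀ k, N.obj (Fib f k)) (k' : K') : N.obj (Fib f' k') :=
  N.map (Fib.congr e (fun s => by rw [h, Equiv.eq_symm_apply])) (y (τ.symm k'))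

theorem push_apply {f : S → K} {f' : S' → K'} (e : S ≃ S') (τ : K ≃ K')
    (h : ∀ s, f' (e s) = τ (f s)) (y : ∀ k, N.obj (Fib f k)) (k : K) :
    push e τ h y (τ k) = N.map (Fib.congr e (fun s => by simp [h])) (y k) := by
  have key : ∀ (k₁ : K) (hk : k₁ = k) (h1 : ∀ s, f s = k₁ ↔ f' (e s) = τ k)
      (h2 : ∀ s, f s = k ↔ f' (e s) = τ k),
      N.map (Fib.congr e h1) (y k₁) = N.map (Fib.congr e h2) (y k) := by
    rintro _ rfl _ _; rfl
  exact key _ (by simp) _ _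

/-- Relabelling of a summand along compatible bijections `e : S ≃ S'` and `τ : K ≃ K'`. -/
def Summand.map {f : S → K} {f' : S' → K'} (e : S ≃ S') (τ : K ≃ K')
    (h : ∀ s, f' (e s) = τ (f s)) : Summand M N f →ₗ[F] Summand M N f' :=
  TensorProduct.map (M.map τ)
    (PiTensorProduct.map (fun k' : K' => N.map (Fib.congr e (fun s => by
        rw [h, Equiv.eq_symm_apply]) : Fib f (τ.symm k') ≃ Fib f' k'))
      ∘ₗ (PiTensorProduct.reindex F (fun k => N.obj (Fib f k)) τ).toLinearMap)

theorem Summand.map_pureT {f : S → K} {f' : S' → K'} (e : S ≃ S') (τ : K ≃ K')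
    (h : ∀ s, f' (e s) = τ (f s)) (x : M.obj K) (y : ∀ k, N.obj (Fib f k)) :
    Summand.map e τ h (pureT M N f x y) = pureT M N f' (M.map τ x) (push e τ h y) := by
  simp only [Summand.map, pureT, TensorProduct.map_tmul, LinearMap.comp_apply,
    LinearEquiv.coe_coe, PiTensorProduct.reindex_tprod, PiTensorProduct.map_tprod]
  rfl

theorem Summand.hom_ext {f : S → K} {G : Type*} [AddCommGroup G] [Module F G]
    {φ ψ : Summand M N f →ₗ[F] G} (h : ∀ x y, φ (pureT M N f x y) = ψ (pureT M N f x y)) :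
    φ = ψ := by
  apply TensorProduct.ext
  ext x y
  exact h x y

theorem push_refl {f : S → K} (h) (y : ∀ k, N.obj (Fib f k)) :
    push (Equiv.refl S) (Equiv.refl K) h y = y := by
  funext k; exact N.map_refl (y k)

theorem push_trans {f : S → K} {f' : S' → K'} {f'' : S'' → K''} (e : S ≃ S') (τ : K ≃ K')
    (h : ∀ s, f' (e s) = τ (f s)) (e' : S' ≃ S'') (τ' : K' ≃ K'')
    (h' : ∀ s, f'' (e' s) = τ' (f' s)) (h₂) (y : ∀ k, N.obj (Fib f k)) :
    push (f' := f'') (e.trans e') (τ.trans τ') h₂ y = push e' τ' h' (push e τ h y) := by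
  funext k''
  obtain ⟨k, rfl⟩ := (τ.trans τ').surjective k''
  rw [push_apply]
  change _ = push e' τ' h' (push e τ h y) (τ' (τ k))
  rw [push_apply, push_apply, ← N.map_trans]
  rfl

theorem Summand.map_refl {f : S → K} (h) (t : Summand M N f) :
    Summand.map (Equiv.refl S) (Equiv.refl K) h t = t := by
  suffices H : Summand.map (M := M) (N := N) (Equiv.refl S) (Equiv.refl K) h = LinearMap.id from
    LinearMap.congr_fun H t
  apply Summand.hom_ext
  intro x y
  rw [Summand.map_pureT, M.map_refl, push_refl]; rfl

theorem Summand.map_trans {f : S → K} {f' : S' → K'} {f'' : S'' → K''} (e : S ≃ S') (τ : K ≃ K')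
    (h : ∀ s, f' (e s) = τ (f s)) (e' : S' ≃ S'') (τ' : K' ≃ K'')
    (h' : ∀ s, f'' (e' s) = τ' (f' s)) (e₂ : S ≃ S'') (τ₂ : K ≃ K'') (h₂)
    (he : e₂ = e.trans e') (hτ : τ₂ = τ.trans τ') (t : Summand M N f) :
    Summand.map e₂ τ₂ h₂ t = Summand.map e' τ' h' (Summand.map e τ h t) := by
  subst he hτ
  suffices H : Summand.map (M := M) (N := N) _ _ h₂ =
      Summand.map e' τ' h' ∘ₗ Summand.map e τ h from LinearMap.congr_fun H t
  apply Summand.hom_ext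
  intro x y
  rw [LinearMap.comp_apply, Summand.map_pureT, Summand.map_pureT, Summand.map_pureT,
    ← M.map_trans, push_trans]

/-- Functoriality of a summand in `M` and in `N`. -/
def Summand.hom (φ : SymSeq.Hom M M') (ψ : SymSeq.Hom N N') (f : S → K) :
    Summand M N f →ₗ[F] Summand M' N' f :=
  TensorProduct.map (φ.app K) (PiTensorProduct.map (fun k => ψ.app (Fib f k)))

theorem Summand.hom_pureT (φ : SymSeq.Hom M M') (ψ : SymSeq.Hom N N') (f : S → K) (x y) :
    Summand.hom φ ψ f (pureT M N f x y) =
      pureT M' N' f (φ.app K x) (fun k => ψ.app _ (y k)) := by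
  simp [Summand.hom, pureT]

theorem Summand.hom_map (φ : SymSeq.Hom M M') (ψ : SymSeq.Hom N N') {f : S → K} {f' : S' → K'}
    (e : S ≃ S') (τ : K ≃ K') (h : ∀ s, f' (e s) = τ (f s)) (t : Summand M N f) :
    Summand.hom φ ψ f' (Summand.map e τ h t) = Summand.map e τ h (Summand.hom φ ψ f t) := by
  suffices H : Summand.hom φ ψ f' ∘ₗ Summand.map e τ h = Summand.map e τ h ∘ₗ Summand.hom φ ψ f from
    LinearMap.congr_fun H t
  apply TensorProduct.ext
  ext x y
  simp only [LinearMap.compMultilinearMap_apply, LinearMap.comp_apply,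
    TensorProduct.mk_apply, Summand.hom, Summand.map, TensorProduct.map_tmul, LinearEquiv.coe_coe,
    PiTensorProduct.reindex_tprod, PiTensorProduct.map_tprod, φ.naturality, ψ.naturality,
    LinearMap.compr₂ₛₗ_apply]

/-- The diagonal action of a permutation of `K`. -/
def Summand.act {f f' : S → K} (τ : Equiv.Perm K) (h : ∀ s, f' s = τ (f s)) :
    Summand M N f →ₗ[F] Summand M N f' :=
  Summand.map (Equiv.refl S) τ h

/-- The action of a bijection of `S`. -/
def Summand.tr {f : S → K} {g : S' → K} (e : S ≃ S') (h : ∀ s, g (e s) = f s) :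
    Summand M N f →ₗ[F] Summand M N g :=
  Summand.map e (Equiv.refl K) h

theorem Summand.act_act {f f' f'' : S → K} (σ τ : Equiv.Perm K) (h : ∀ s, f' s = σ (f s))
    (h' : ∀ s, f'' s = τ (f' s)) (h'' : ∀ s, f'' s = (τ * σ) (f s)) (t : Summand M N f) :
    Summand.act τ h' (Summand.act σ h t) = Summand.act (τ * σ) h'' t :=
  (Summand.map_trans (Equiv.refl S) σ h (Equiv.refl S) τ h' (Equiv.refl S) (τ * σ) h'' rfl rfl t).symm

theorem Summand.tr_refl {f : S → K} (h : ∀ s, f (Equiv.refl S s) = f s) (t : Summand M N f) :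
    Summand.tr (Equiv.refl S) h t = t :=
  Summand.map_refl h t

theorem Summand.tr_tr {f : S → K} {f' : S' → K} {f'' : S'' → K} (e : S ≃ S')
    (h : ∀ s, f' (e s) = f s) (e' : S' ≃ S'') (h' : ∀ s, f'' (e' s) = f' s)
    (h'' : ∀ s, f'' (e.trans e' s) = f s) (t : Summand M N f) :
    Summand.tr (e.trans e') h'' t = Summand.tr e' h' (Summand.tr e h t) :=
  Summand.map_trans e (Equiv.refl K) h e' (Equiv.refl K) h' (e.trans e') (Equiv.refl K) h'' rfl rfl t

theorem Summand.act_tr {f f' : S → K} {g g' : S' → K} (e : S ≃ S')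
    (h₁ : ∀ s, g (e s) = f s) (σ : Equiv.Perm K) (h₂ : ∀ s, g' s = σ (g s))
    (h₃ : ∀ s, f' s = σ (f s)) (h₄ : ∀ s, g' (e s) = f' s) (t : Summand M N f) :
    Summand.act σ h₂ (Summand.tr e h₁ t) = Summand.tr e h₄ (Summand.act σ h₃ t) :=
  (Summand.map_trans (f'' := g') e (Equiv.refl K) h₁ (Equiv.refl S') σ h₂ e σ
    (fun s => (h₄ s).trans (h₃ s)) rfl rfl t).symm.trans
  (Summand.map_trans (Equiv.refl S) σ h₃ e (Equiv.refl K) h₄ e σ _ rfl rfl t)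

theorem Summand.hom_act (φ : SymSeq.Hom M M') (ψ : SymSeq.Hom N N') {f f' : S → K}
    (τ : Equiv.Perm K) (h : ∀ s, f' s = τ (f s)) (t : Summand M N f) :
    Summand.hom φ ψ f' (Summand.act τ h t) = Summand.act τ h (Summand.hom φ ψ f t) :=
  Summand.hom_map φ ψ (Equiv.refl S) τ h t

theorem Summand.hom_tr (φ : SymSeq.Hom M M') (ψ : SymSeq.Hom N N') {f : S → K} {g : S' → K}
    (e : S ≃ S') (h : ∀ s, g (e s) = f s) (t : Summand M N f) :
    Summand.hom φ ψ g (Summand.tr e h t) = Summand.tr e h (Summand.hom φ ψ f t) :=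
  Summand.hom_map φ ψ e (Equiv.refl K) h t

end Summand

section Composition

variable (M N : SymSeq F)

/-- The direct sum `⨁ₖ (M(k) ⊗ N^{⊗ k})(S)`, where `N^{⊗ k}` is the tensor power of symmetric
sequences. A map `S → Fin k` is a decomposition of `S` into `k` possibly empty parts. -/
abbrev Raw (S : Type) [Finite S] : Type u :=
  ⨁ p : (Σ k : ℕ, S → Fin k), Summand M N p.2

variable {M N}
variable {M' N' : SymSeq F}
variable {S T U : Type} [Finite S] [Finite T] [Finite U]

/-- The inclusion of a summand. -/
def inc {k : ℕ} (f : S → Fin k) : Summand M N f →ₗ[F] Raw M N S :=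
  DirectSum.lof F (Σ k : ℕ, S → Fin k) (fun p => Summand M N p.2) ⟨k, f⟩

/-- The component in a summand. -/
def cpt {k : ℕ} (f : S → Fin k) : Raw M N S →ₗ[F] Summand M N f :=
  DirectSum.component F (Σ k : ℕ, S → Fin k) (fun p => Summand M N p.2) ⟨k, f⟩

theorem raw_hom_ext {G : Type*} [AddCommGroup G] [Module F G] {φ ψ : Raw M N S →ₗ[F] G}
    (h : ∀ (k : ℕ) (f : S → Fin k) (t : Summand M N f), φ (inc f t) = ψ (inc f t)) : φ = ψ := by
  apply DirectSum.linearMap_ext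
  rintro ⟨k, f⟩
  exact LinearMap.ext (h k f)

theorem raw_ext {t t' : Raw M N S} (h : ∀ (k : ℕ) (f : S → Fin k), cpt f t = cpt f t') : t = t' :=
  DFinsupp.ext fun ⟨k, f⟩ => h k f

theorem cpt_inc_same {k : ℕ} (f : S → Fin k) (t : Summand M N f) : cpt f (inc f t) = t :=
  DirectSum.of_eq_same _ _

theorem cpt_inc_ne {k k' : ℕ} (f : S → Fin k) (f' : S → Fin k') (t : Summand M N f)
    (h : (⟨k, f⟩ : Σ k : ℕ, S → Fin k) ≠ ⟨k', f'⟩) : cpt f' (inc f t) = 0 :=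
  DirectSum.of_eq_of_ne _ _ _ h.symm

theorem cpt_inc_ne' {k : ℕ} (f f' : S → Fin k) (t : Summand M N f)
    (h : f ≠ f') : cpt f' (inc f t) = 0 :=
  cpt_inc_ne _ _ _ fun h' => h (eq_of_heq (Sigma.mk.inj_iff.1 h').2)

/-- The linear map given by linear maps on the summands. -/
def rawLift {G : Type*} [AddCommGroup G] [Module F G]
    (φ : ∀ (k : ℕ) (f : S → Fin k), Summand M N f →ₗ[F] G) : Raw M N S →ₗ[F] G :=
  DirectSum.toModule F _ _ fun p => φ p.1 p.2

theorem rawLift_inc {G : Type*} [AddCommGroup G] [Module F G]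
    (φ : ∀ (k : ℕ) (f : S → Fin k), Summand M N f →ₗ[F] G) {k : ℕ} (f : S → Fin k) (t) :
    rawLift φ (inc f t) = φ k f t :=
  DirectSum.toModule_lof _ _ _

/-- The action of bijections of `S` on `⨁ₖ (M(k) ⊗ N^{⊗ k})(S)`. -/
def rawMap (e : S ≃ T) : Raw M N S →ₗ[F] Raw M N T :=
  rawLift fun _ f =>
    (inc (f ∘ e.symm)).comp (Summand.tr e (fun s => by simp))

theorem rawMap_inc (e : S ≃ T) {k : ℕ} (f : S → Fin k) (g : T → Fin k) (h : ∀ s, g (e s) = f s)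
    (t : Summand M N f) :
    rawMap e (inc f t) = inc g (Summand.tr (M := M) (N := N) e h t) := by
  obtain rfl : g = f ∘ e.symm := by funext s; simp [← h]
  exact rawLift_inc _ _ _

theorem cpt_rawMap (e : S ≃ T) {k : ℕ} (f : S → Fin k) (g : T → Fin k)
    (h : ∀ s, g (e s) = f s) (t : Raw M N S) :
    cpt g (rawMap e t) = Summand.tr e h (cpt f t) := by
  suffices H : (cpt g).comp (rawMap (M := M) (N := N) e) =
      (Summand.tr e h).comp (cpt f) from
    LinearMap.congr_fun H t
  apply raw_hom_ext
  intro k' f' t'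
  rw [LinearMap.comp_apply, LinearMap.comp_apply, rawMap_inc e f' (f' ∘ e.symm) (by simp)]
  by_cases hk : (⟨k', f'⟩ : Σ k : ℕ, S → Fin k) = ⟨k, f⟩
  · cases hk
    obtain rfl : g = f ∘ e.symm := by funext s; simp [← h]
    rw [cpt_inc_same, cpt_inc_same]
  · rw [cpt_inc_ne f' f _ hk, cpt_inc_ne, map_zero]
    intro hk'
    apply hk
    obtain ⟨rfl, hk'⟩ := Sigma.mk.inj_iff.1 hk'
    obtain rfl : g = f' ∘ e.symm := (eq_of_heq hk').symm
    congr 1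
    funext s; rw [← h]; simp

theorem rawMap_refl (t : Raw M N S) : rawMap (Equiv.refl S) t = t := by
  refine raw_ext fun k f => ?_
  exact (cpt_rawMap (Equiv.refl S) f f (fun _ => rfl) t).trans (Summand.tr_refl _ _)

theorem rawMap_trans (e : S ≃ T) (e' : T ≃ U) (t : Raw M N S) :
    rawMap (e.trans e') t = rawMap e' (rawMap e t) := by
  refine raw_ext fun k f => ?_
  rw [cpt_rawMap (e.trans e') (f ∘ e' ∘ e) f (fun _ => rfl),
    cpt_rawMap e' (f ∘ e') f (fun _ => rfl), cpt_rawMap e (f ∘ e' ∘ e) (f ∘ e') (fun _ => rfl)]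
  exact Summand.tr_tr e (fun _ => rfl) e' (fun _ => rfl) (fun _ => rfl) _

/-- Functoriality of `⨁ₖ (M(k) ⊗ N^{⊗ k})(S)` in `M` and in `N`. -/
def rawHom (φ : SymSeq.Hom M M') (ψ : SymSeq.Hom N N') (S : Type) [Finite S] :
    Raw M N S →ₗ[F] Raw M' N' S :=
  rawLift fun _ f => (inc f).comp (Summand.hom φ ψ f)

theorem rawHom_inc (φ : SymSeq.Hom M M') (ψ : SymSeq.Hom N N') {k : ℕ} (f : S → Fin k)
    (t : Summand M N f) : rawHom φ ψ S (inc f t) = inc f (Summand.hom φ ψ f t) :=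
  rawLift_inc _ _ _

theorem cpt_rawHom (φ : SymSeq.Hom M M') (ψ : SymSeq.Hom N N') {k : ℕ} (f : S → Fin k)
    (t : Raw M N S) : cpt f (rawHom φ ψ S t) = Summand.hom φ ψ f (cpt f t) := by
  suffices H : (cpt f).comp (rawHom φ ψ S) = (Summand.hom φ ψ f).comp (cpt f) from
    LinearMap.congr_fun H t
  apply raw_hom_ext
  intro k' f' t'
  rw [LinearMap.comp_apply, LinearMap.comp_apply, rawHom_inc]
  by_cases hk : (⟨k', f'⟩ : Σ k : ℕ, S → Fin k) = ⟨k, f⟩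
  · cases hk
    rw [cpt_inc_same, cpt_inc_same]
  · rw [cpt_inc_ne _ _ _ hk, cpt_inc_ne _ _ _ hk, map_zero]

theorem rawHom_rawMap (φ : SymSeq.Hom M M') (ψ : SymSeq.Hom N N') (e : S ≃ T) (t : Raw M N S) :
    rawHom φ ψ T (rawMap e t) = rawMap e (rawHom φ ψ S t) := by
  refine raw_ext fun k f => ?_
  rw [cpt_rawHom, cpt_rawMap e (f ∘ e) f (fun _ => rfl), cpt_rawMap e (f ∘ e) f (fun _ => rfl),
    cpt_rawHom, Summand.hom_tr]

variable (M N)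

/-- The subspace spanned by the elements `τ · t - t` for `τ ∈ Sₖ` and `t ∈ (M(k) ⊗ N^{⊗ k})(S)`. -/
def relations (S : Type) [Finite S] : Submodule F (Raw M N S) :=
  Submodule.span F {d | ∃ (k : ℕ) (τ : Equiv.Perm (Fin k)) (f f' : S → Fin k)
    (h : ∀ s, f' s = τ (f s)) (t : Summand M N f), d = inc f' (Summand.act τ h t) - inc f t}

theorem relations_le {S : Type} [Finite S] {p : Submodule F (Raw M N S)}
    (H : ∀ (k : ℕ) (τ : Equiv.Perm (Fin k)) (f f' : S → Fin k)
    (h : ∀ s, f' s = τ (f s)) (t : Summand M N f), inc f' (Summand.act τ h t) - inc f t ∈ p) :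
    relations M N S ≤ p := by
  rw [relations, Submodule.span_le]
  rintro _ ⟨k, τ, f, f', h, t, rfl⟩
  exact H k τ f f' h t

/-- The composition product `M ∘ N = ⨁ₖ (M(k) ⊗ N^{⊗ k})_{Sₖ}` (coinvariants). -/
def comp : SymSeq F where
  obj S _ := Raw M N S ⧸ relations M N S
  map {S T} _ _ e := Submodule.mapQ (relations M N S) (relations M N T) (rawMap e) (by
    apply relations_le
    intro k τ f f' h t
    rw [Submodule.mem_comap, map_sub, rawMap_inc e f' (f' ∘ e.symm) (by simp),
      rawMap_inc e f (f ∘ e.symm) (by simp)]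
    refine Submodule.subset_span ⟨k, τ, f ∘ e.symm, f' ∘ e.symm, fun s => h _,
      Summand.tr e (by simp) t, ?_⟩
    rw [Summand.act_tr])
  map_refl {S} _ x := by
    obtain ⟨t, rfl⟩ := Submodule.mkQ_surjective _ x
    exact congrArg _ (rawMap_refl t)
  map_trans {S T U} _ _ _ e e' x := by
    obtain ⟨t, rfl⟩ := Submodule.mkQ_surjective _ x
    exact congrArg _ (rawMap_trans e e' t)

/-- The elements of `⨁ₖ (M(k) ⊗ N^{⊗ k})(S)` fixed by the diagonal actions of the groups `Sₖ`. -/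
def invariants (S : Type) [Finite S] : Submodule F (Raw M N S) where
  carrier := {t | ∀ (k : ℕ) (τ : Equiv.Perm (Fin k)) (f f' : S → Fin k) (h : ∀ s, f' s = τ (f s)),
    cpt f' t = Summand.act τ h (cpt f t)}
  add_mem' {a b} ha hb k τ f f' h := by
    rw [map_add, map_add, map_add, ha k τ f f' h, hb k τ f f' h]
  zero_mem' k τ f f' h := by simp only [map_zero]
  smul_mem' c a ha k τ f f' h := by
    rw [map_smul, map_smul, map_smul, ha k τ f f' h]

/-- The product `M ∘~ N = ⨁ₖ (M(k) ⊗ N^{⊗ k})^{Sₖ}` (invariants). -/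
def tcomp : SymSeq F where
  obj S _ := invariants M N S
  map {S T} _ _ e := LinearMap.restrict (p := invariants M N S) (q := invariants M N T) (rawMap e)
    (fun t ht k τ f f' h => by
      rw [cpt_rawMap e (f' ∘ e) f' (fun _ => rfl), cpt_rawMap e (f ∘ e) f (fun _ => rfl),
        ht k τ (f ∘ e) (f' ∘ e) (fun s => h _)]
      exact (Summand.act_tr _ _ _ _ _ _ _).symm)
  map_refl x := Subtype.ext (rawMap_refl x.1)
  map_trans e e' x := Subtype.ext (rawMap_trans e e' x.1)

variable {M N}

/-- Functoriality of `M ∘ N`. -/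
def comp.map (φ : SymSeq.Hom M M') (ψ : SymSeq.Hom N N') : SymSeq.Hom (comp M N) (comp M' N') where
  app S _ := Submodule.mapQ (relations M N S) (relations M' N' S) (rawHom φ ψ S) (by
    apply relations_le
    intro k τ f f' h t
    rw [Submodule.mem_comap, map_sub, rawHom_inc, rawHom_inc]
    exact Submodule.subset_span ⟨k, τ, f, f', h, Summand.hom φ ψ f t, by
      rw [← Summand.hom_act φ ψ τ h t]⟩)
  naturality {S T} _ _ e x := by
    obtain ⟨t, rfl⟩ := Submodule.mkQ_surjective _ x
    exact congrArg (Submodule.mkQ _) (rawHom_rawMap φ ψ e t)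

/-- Functoriality of `M ∘~ N`. -/
def tcomp.map (φ : SymSeq.Hom M M') (ψ : SymSeq.Hom N N') :
    SymSeq.Hom (tcomp M N) (tcomp M' N') where
  app S _ := LinearMap.restrict (p := invariants M N S) (q := invariants M' N' S) (rawHom φ ψ S)
    (fun t ht k τ f f' h => by
      rw [cpt_rawHom, cpt_rawHom, ht k τ f f' h]
      exact Summand.hom_act φ ψ τ h _)
  naturality e x := Subtype.ext (rawHom_rawMap φ ψ e x.1)

variable (M N) in
/-- The norm `t ↦ ∑_{τ ∈ Sₖ} τ · t`. -/
def rawTrace (S : Type) [Finite S] : Raw M N S →ₗ[F] Raw M N S :=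
  rawLift fun _ f => ∑ τ : Equiv.Perm (Fin _), (inc (τ ∘ f)).comp (Summand.act τ (fun _ => rfl))

theorem rawTrace_inc {k : ℕ} (f : S → Fin k) (t : Summand M N f) :
    rawTrace M N S (inc f t) = ∑ τ : Equiv.Perm (Fin k),
      inc (τ ∘ f) (Summand.act τ (fun _ => rfl) t) := by
  refine (rawLift_inc _ _ _).trans ?_
  simp only [LinearMap.sum_apply, LinearMap.comp_apply]

theorem cpt_congr {k : ℕ} {f g g' : S → Fin k} (hg : g = g') (τ : Equiv.Perm (Fin k))
    (h : ∀ s, f s = τ (g s)) (t : Raw M N S) :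
    Summand.act τ h (cpt g t) = Summand.act (f' := f) τ (by rw [← hg]; exact h) (cpt g' t) := by
  subst hg; rfl

theorem cpt_rawTrace (t : Raw M N S) {k : ℕ} (f : S → Fin k) :
    cpt f (rawTrace M N S t) = ∑ τ : Equiv.Perm (Fin k),
      Summand.act τ (fun _ => by simp) (cpt (τ.symm ∘ f) t) := by
  suffices H : (cpt f).comp (rawTrace M N S) =
      ∑ τ : Equiv.Perm (Fin k), (Summand.act (f := τ.symm ∘ f) (f' := f) τ
        (fun _ => by simp)).comp (cpt (τ.symm ∘ f)) by
    have := LinearMap.congr_fun H t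
    rw [LinearMap.sum_apply] at this
    exact this
  apply raw_hom_ext
  intro k' f' t'
  rw [LinearMap.sum_apply, LinearMap.comp_apply, rawTrace_inc, map_sum]
  simp only [LinearMap.comp_apply]
  by_cases hk : k' = k
  · subst hk
    refine Finset.sum_congr rfl fun τ _ => ?_
    by_cases hf : τ ∘ f' = f
    · subst hf
      rw [cpt_inc_same, cpt_congr (g' := f') (by funext s; simp), cpt_inc_same]
    · rw [cpt_inc_ne' _ _ _ hf, cpt_inc_ne', map_zero]
      intro h; apply hf
      rw [h]; funext s; simp
  · rw [Finset.sum_eq_zero, Finset.sum_eq_zero]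
    · intro τ _; rw [cpt_inc_ne, map_zero]; intro h; exact hk (Sigma.mk.inj_iff.1 h).1
    · intro τ _; rw [cpt_inc_ne]; intro h; exact hk (Sigma.mk.inj_iff.1 h).1

theorem rawTrace_mem (t : Raw M N S) : rawTrace M N S t ∈ invariants M N S := by
  intro k σ f f' h
  rw [cpt_rawTrace, cpt_rawTrace, map_sum]
  refine Fintype.sum_equiv (Equiv.mulLeft σ⁻¹) _ _ fun τ => ?_
  rw [cpt_congr (g' := (σ⁻¹ * τ).symm ∘ f) (by
    funext s; simp only [Function.comp_apply, h, Equiv.Perm.mul_def]; rfl)]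
  have key : ∀ (ρ : Equiv.Perm (Fin k)) (hρ : ρ = τ) (g : S → Fin k) (h1) (h2) (t : Summand M N g),
      Summand.act (f' := f') τ h1 t = Summand.act ρ h2 t := by
    rintro _ rfl g _ _ _; rfl
  refine Eq.trans ?_ (Summand.act_act (σ⁻¹ * τ) σ (fun s => by simp) h (fun s => by
    rw [h]; simp only [Function.comp_apply]; exact congrArg σ ((σ⁻¹ * τ).apply_symm_apply _).symm |>.trans rfl) _).symm
  exact key _ (by simp) _ _ _ _

theorem rawTrace_rel {k : ℕ} (σ : Equiv.Perm (Fin k)) (f f' : S → Fin k) (h : ∀ s, f' s = σ (f s))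
    (t : Summand M N f) :
    rawTrace M N S (inc f' (Summand.act σ h t)) = rawTrace M N S (inc f t) := by
  rw [rawTrace_inc, rawTrace_inc]
  refine Fintype.sum_equiv (Equiv.mulRight σ) _ _ fun τ => ?_
  obtain rfl : f' = σ ∘ f := funext h
  rw [Summand.act_act σ τ h (fun _ => rfl) (fun _ => rfl)]
  rfl

theorem rawTrace_rawMap (e : S ≃ T) (t : Raw M N S) :
    rawTrace M N T (rawMap e t) = rawMap e (rawTrace M N S t) := by
  refine raw_ext fun k f => ?_
  rw [cpt_rawMap e (f ∘ e) f (fun _ => rfl), cpt_rawTrace, cpt_rawTrace, map_sum]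
  refine Finset.sum_congr rfl fun τ _ => ?_
  rw [cpt_rawMap e (τ.symm ∘ f ∘ e) (τ.symm ∘ f) (fun _ => rfl)]
  exact Summand.act_tr _ _ _ _ _ _ _

theorem relations_le_ker : relations M N S ≤ LinearMap.ker (rawTrace M N S) := by
  apply relations_le
  intro k τ f f' h t
  rw [LinearMap.mem_ker, map_sub, sub_eq_zero]
  exact rawTrace_rel τ f f' h t

variable (M N) in
/-- The norm map from coinvariants to invariants. -/
def traceAux (S : Type) [Finite S] : (Raw M N S ⧸ relations M N S) →ₗ[F] invariants M N S :=
  LinearMap.codRestrict (invariants M N S) ((relations M N S).liftQ (rawTrace M N S) relations_le_ker)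
    (fun x => by
      obtain ⟨t, rfl⟩ := Submodule.mkQ_surjective _ x
      exact rawTrace_mem t)

variable (M N) in
/-- The trace map `M ∘ N → M ∘~ N`, sending the class of `t` to `∑_{τ ∈ Sₖ} τ · t`. -/
def trace : SymSeq.Hom (comp M N) (tcomp M N) where
  app S _ := traceAux M N S
  naturality {S T} _ _ e x := by
    obtain ⟨t, rfl⟩ := Submodule.mkQ_surjective _ x
    exact Subtype.ext (rawTrace_rawMap e t)

end Composition

section TraceInverse

variable {M N : SymSeq F} {S : Type} [Finite S]

theorem SymSeq.Reduced.subsingleton (h : N.Reduced) [IsEmpty S] : Subsingleton (N.obj S) := by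
  refine ⟨fun x y => ?_⟩
  have : Subsingleton (N.obj (Fin 0)) := h
  let e : S ≃ Fin 0 := Equiv.equivOfIsEmpty _ _
  have hx : ∀ z, N.map e.symm (N.map e z) = z := fun z => by
    rw [← N.map_trans, Equiv.self_trans_symm, N.map_refl]
  rw [← hx x, ← hx y, Subsingleton.elim (N.map e x) (N.map e y)]

theorem Summand.eq_zero (hN : N.Reduced) {k : ℕ} (f : S → Fin k) (hf : ¬ Function.Surjective f)
    (t : Summand M N f) : t = 0 := by
  suffices H : (LinearMap.id : Summand M N f →ₗ[F] Summand M N f) = 0 from LinearMap.congr_fun H t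
  apply Summand.hom_ext
  intro x y
  obtain ⟨j, hj⟩ := not_forall.1 hf
  have : IsEmpty (Fib f j) := ⟨fun s => hj ⟨s.1, s.2⟩⟩
  have := hN.subsingleton (S := Fib f j)
  have h0 : PiTensorProduct.tprod F y = 0 :=
    MultilinearMap.map_coord_zero _ j (Subsingleton.elim _ _)
  simp [pureT, h0]

/-- Two maps `S → Fin k` are equivalent if they differ by a permutation of `Fin k`. -/
def orbitSetoid (S : Type) (k : ℕ) : Setoid (S → Fin k) where
  r f f' := ∃ τ : Equiv.Perm (Fin k), f' = τ ∘ f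
  iseqv := ⟨fun f => ⟨1, rfl⟩, fun {f f'} ⟨τ, h⟩ => ⟨τ⁻¹, by subst h; funext s; simp⟩,
    fun {f f' f''} ⟨τ, h⟩ ⟨σ, h'⟩ => ⟨σ * τ, by subst h h'; rfl⟩⟩

/-- A chosen representative of the orbit of a map `S → Fin k`. -/
def orbitRep {k : ℕ} (f : S → Fin k) : S → Fin k :=
  (Quotient.mk (orbitSetoid S k) f).out

theorem orbitRep_spec {k : ℕ} (f : S → Fin k) : ∃ τ : Equiv.Perm (Fin k), orbitRep f = τ ∘ f :=
  (orbitSetoid S k).symm (Quotient.mk_out (s := orbitSetoid S k) f)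

theorem orbitRep_perm {k : ℕ} (f : S → Fin k) (τ : Equiv.Perm (Fin k)) :
    orbitRep (τ ∘ f) = orbitRep f := by
  unfold orbitRep
  congr 1
  exact Quotient.sound (s := orbitSetoid S k) ((orbitSetoid S k).symm ⟨τ, rfl⟩)

theorem perm_unique {k : ℕ} {f : S → Fin k} (hf : Function.Surjective f) {σ τ : Equiv.Perm (Fin k)}
    (h : σ ∘ f = τ ∘ f) : σ = τ := by
  ext j
  obtain ⟨s, rfl⟩ := hf j
  exact congrArg _ (congrFun h s)

variable (M N S) in
/-- The projection to the summands of the chosen representatives. On invariants, it gives the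
inverse of the trace map. -/
def rawSection : Raw M N S →ₗ[F] Raw M N S :=
  rawLift fun _ f => if f = orbitRep f then inc f else 0

theorem cpt_rawSection {k : ℕ} (f : S → Fin k) (t : Raw M N S) :
    cpt f (rawSection M N S t) = if f = orbitRep f then cpt f t else 0 := by
  suffices H : (cpt f).comp (rawSection M N S) = if f = orbitRep f then cpt f else 0 by
    have := LinearMap.congr_fun H t
    rw [LinearMap.comp_apply] at this
    rw [this]
    split_ifs <;> rfl
  apply raw_hom_ext
  intro k' f' t'
  rw [LinearMap.comp_apply, rawSection, rawLift_inc]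
  by_cases hk : (⟨k', f'⟩ : Σ k : ℕ, S → Fin k) = ⟨k, f⟩
  · cases hk
    split_ifs
    · rfl
    · simp
  · split_ifs
    · rfl
    · rw [cpt_inc_ne _ _ _ hk]; simp
    · rw [cpt_inc_ne _ _ _ hk]; simp
    · simp

theorem trace_injective (hN : N.Reduced) : Function.Injective ((trace M N).app S) := by
  have key : ∀ t : Raw M N S, (relations M N S).mkQ (rawSection M N S (rawTrace M N S t)) =
      (relations M N S).mkQ t := by
    intro t
    suffices H : (relations M N S).mkQ ∘ₗ rawSection M N S ∘ₗ rawTrace M N S =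
        (relations M N S).mkQ from LinearMap.congr_fun H t
    apply raw_hom_ext
    intro k f t
    by_cases hf : Function.Surjective f
    · obtain ⟨σ, hσ⟩ := orbitRep_spec f
      rw [LinearMap.comp_apply, LinearMap.comp_apply, rawTrace_inc, map_sum, map_sum,
        Finset.sum_eq_single σ]
      · rw [rawSection, rawLift_inc, if_pos (by rw [orbitRep_perm, hσ])]
        rw [← sub_eq_zero, ← map_sub, Submodule.mkQ_apply, Submodule.Quotient.mk_eq_zero]
        exact Submodule.subset_span ⟨k, σ, f, σ ∘ f, fun _ => rfl, t, rfl⟩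
      · intro τ _ hτ
        rw [rawSection, rawLift_inc, if_neg]
        · simp
        · rw [orbitRep_perm, hσ]
          exact fun h => hτ (perm_unique hf h)
      · simp
    · rw [Summand.eq_zero hN f hf t, map_zero, map_zero, map_zero]
  intro a b hab
  obtain ⟨a, rfl⟩ := Submodule.mkQ_surjective _ a
  obtain ⟨b, rfl⟩ := Submodule.mkQ_surjective _ b
  have : rawTrace M N S a = rawTrace M N S b := congrArg Subtype.val hab
  rw [← key a, ← key b, this]

theorem trace_surjective (hN : N.Reduced) : Function.Surjective ((trace M N).app S) := by
  rintro ⟨t, ht⟩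
  refine ⟨(relations M N S).mkQ (rawSection M N S t), Subtype.ext ?_⟩
  change rawTrace M N S (rawSection M N S t) = t
  refine raw_ext fun k f => ?_
  by_cases hf : Function.Surjective f
  · obtain ⟨σ, hσ⟩ := orbitRep_spec f
    rw [cpt_rawTrace, Finset.sum_eq_single σ⁻¹]
    · rw [cpt_rawSection, if_pos, ← ht]
      exact hσ.symm.trans ((orbitRep_perm f σ).symm.trans (congrArg orbitRep (by rfl)))
    · intro τ _ hτ
      rw [cpt_rawSection, if_neg, map_zero]
      rw [orbitRep_perm, hσ]
      intro h
      apply hτ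
      have := perm_unique hf h
      rw [← this]; ext; simp
    · simp
  · rw [Summand.eq_zero hN f hf (cpt f t)]
    exact Summand.eq_zero hN f hf _

variable (M) in
/-- The inverse of the trace map, for `N` reduced. -/
def traceInv (hN : N.Reduced) : SymSeq.Hom (tcomp M N) (comp M N) :=
  (trace M N).inv fun _ _ => ⟨trace_injective hN, trace_surjective hN⟩

theorem comp_reduced (hM : M.Reduced) (hN : N.Reduced) : (comp M N).Reduced := by
  refine ⟨fun a b => ?_⟩
  obtain ⟨a, rfl⟩ := Submodule.mkQ_surjective _ a
  obtain ⟨b, rfl⟩ := Submodule.mkQ_surjective _ b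
  congr 1
  refine raw_ext fun k f => ?_
  suffices ∀ t : Summand M N f, t = 0 by rw [this (cpt f a), this (cpt f b)]
  intro t
  by_cases hf : Function.Surjective f
  · have : IsEmpty (Fin k) := ⟨fun j => (hf j).choose.elim0⟩
    have := hM.subsingleton (S := Fin k)
    suffices H : (LinearMap.id : Summand M N f →ₗ[F] Summand M N f) = 0 from LinearMap.congr_fun H t
    apply Summand.hom_ext
    intro x y
    rw [Subsingleton.elim x 0]
    simp [pureT]
  · exact Summand.eq_zero hN f hf t

end TraceInverse

section Symbols

variable {M N A B C M' N' : SymSeq F}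
variable {S T K K' L L' : Type} [Finite S] [Finite T] [Finite K] [Finite K'] [Finite L] [Finite L']

/-- The projection of the summand of `f : S → K` to `(M ∘ N)(S)`, for any finite set `K`. -/
def mk (f : S → K) : Summand M N f →ₗ[F] (comp M N).obj S :=
  (relations M N S).mkQ ∘ₗ inc (Finite.equivFin K ∘ f) ∘ₗ
    Summand.map (Equiv.refl S) (Finite.equivFin K) (fun _ => rfl)

theorem mk_eq (f : S → K) {n : ℕ} (a : K ≃ Fin n) (g : S → Fin n) (h : ∀ s, g s = a (f s))
    (t : Summand M N f) :
    mk f t = (relations M N S).mkQ (inc g (Summand.map (Equiv.refl S) a h t)) := by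
  have hn : Nat.card K = n := by rw [Nat.card_congr a, Nat.card_eq_fintype_card, Fintype.card_fin]
  have key : ∀ (m : ℕ) (hm : m = n) (b : K ≃ Fin m) (g' : S → Fin m) (h' : ∀ s, g' s = b (f s)),
      (relations M N S).mkQ (inc g' (Summand.map (Equiv.refl S) b h' t)) =
      (relations M N S).mkQ (inc g (Summand.map (Equiv.refl S) a h t)) := by
    rintro _ rfl b g' h'
    rw [← sub_eq_zero, ← map_sub, Submodule.mkQ_apply, Submodule.Quotient.mk_eq_zero]
    refine Submodule.subset_span ⟨_, a.symm.trans b, g, g', fun s => by simp [h, h'],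
      Summand.map (Equiv.refl S) a h t, ?_⟩
    congr 2
    exact Summand.map_trans (Equiv.refl S) a h (Equiv.refl S) (a.symm.trans b) _ (Equiv.refl S) b h'
      rfl (by ext; simp) t
  exact key _ hn _ _ _

theorem mk_fin {k : ℕ} (f : S → Fin k) (t : Summand M N f) :
    mk f t = (relations M N S).mkQ (inc f t) := by
  rw [mk_eq f (Equiv.refl _) f (fun _ => rfl)]
  congr 2
  exact Summand.map_refl _ _

theorem mk_map {f : S → K} {f' : T → K'} (e : S ≃ T) (τ : K ≃ K') (h : ∀ s, f' (e s) = τ (f s))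
    (t : Summand M N f) : (comp M N).map e (mk f t) = mk f' (Summand.map e τ h t) := by
  rw [mk_eq f' (τ.symm.trans (Finite.equivFin K)) (fun t => Finite.equivFin K (τ.symm (f' t)))
    (fun _ => rfl)]
  refine (congrArg (relations M N T).mkQ (rawMap_inc e (Finite.equivFin K ∘ f)
    (fun t => Finite.equivFin K (τ.symm (f' t))) (fun s => by simp [h]) _)).trans ?_
  congr 2
  refine (Summand.map_trans (Equiv.refl S) (Finite.equivFin K) (fun _ => rfl) e (Equiv.refl _) _
    e (Finite.equivFin K) (fun s => by simp [h]) rfl rfl t).symm.trans ?_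
  exact Summand.map_trans e τ h (Equiv.refl T) (τ.symm.trans (Finite.equivFin K)) (fun _ => rfl)
    e (Finite.equivFin K) (fun s => by simp [h]) rfl (by ext; simp) t

/-- The element `(x; (yₖ)ₖ)` of `(M ∘ N)(S)`, for `x ∈ M(K)` and `yₖ ∈ N(f⁻¹ k)`, where `f : S → K`. -/
def sym (f : S → K) (x : M.obj K) (y : ∀ k, N.obj (Fib f k)) : (comp M N).obj S :=
  mk f (pureT M N f x y)

theorem sym_map {f : S → K} {f' : T → K'} (e : S ≃ T) (τ : K ≃ K') (h : ∀ s, f' (e s) = τ (f s))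
    {x : M.obj K} {y : ∀ k, N.obj (Fib f k)} {x' : M.obj K'} {y' : ∀ k, N.obj (Fib f' k)}
    (hx : x' = M.map τ x) (hy : ∀ k, y' (τ k) = N.map (Fib.congr e (fun s => by simp [h])) (y k)) :
    (comp M N).map e (sym f x y) = sym f' x' y' := by
  rw [sym, mk_map e τ h, Summand.map_pureT, ← hx]
  congr
  funext k'
  obtain ⟨k, rfl⟩ := τ.surjective k'
  rw [hy, push_apply]

theorem sym_eq {f f' : S → K} (h : f = f')
    {x : M.obj K} {y : ∀ k, N.obj (Fib f k)} {y' : ∀ k, N.obj (Fib f' k)}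
    (hy : ∀ k, y' k = N.map (Fib.congr (Equiv.refl S) (fun s => by simp [h])) (y k)) :
    sym f x y = sym f' x y' := by
  subst h
  congr
  funext k
  exact (N.map_refl _).symm.trans (hy k).symm

theorem sym_perm {f : S → K} {f' : S → K'} (τ : K ≃ K') (h : ∀ s, f' s = τ (f s))
    {x : M.obj K} {y : ∀ k, N.obj (Fib f k)} {x' : M.obj K'} {y' : ∀ k, N.obj (Fib f' k)}
    (hx : x' = M.map τ x)
    (hy : ∀ k, y' (τ k) = N.map (Fib.congr (Equiv.refl S) (fun s => by simp [h])) (y k)) :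
    sym f x y = sym f' x' y' :=
  ((comp M N).map_refl _).symm.trans (sym_map (Equiv.refl S) τ h hx hy)

theorem comp_hom_ext {G : Type*} [AddCommGroup G] [Module F G] {φ ψ : (comp M N).obj S →ₗ[F] G}
    (h : ∀ (k : ℕ) (f : S → Fin k) (x : M.obj (Fin k)) (y : ∀ j, N.obj (Fib f j)),
      φ (sym f x y) = ψ (sym f x y)) : φ = ψ := by
  apply Submodule.linearMap_qext
  apply raw_hom_ext
  intro k f t
  suffices H : φ ∘ₗ mk f = ψ ∘ₗ mk f by
    have := LinearMap.congr_fun H t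
    rw [LinearMap.comp_apply, LinearMap.comp_apply, mk_fin] at this
    exact this
  apply Summand.hom_ext
  intro x y
  exact h k f x y

/-- The linear map on `(M ∘ N)(S)` given by linear maps on the summands. -/
def comp.lift {G : Type*} [AddCommGroup G] [Module F G]
    (φ : ∀ (k : ℕ) (f : S → Fin k), Summand M N f →ₗ[F] G)
    (hφ : ∀ (k : ℕ) (τ : Equiv.Perm (Fin k)) (f f' : S → Fin k) (h : ∀ s, f' s = τ (f s))
      (t : Summand M N f), φ k f' (Summand.act τ h t) = φ k f t) :
    (comp M N).obj S →ₗ[F] G :=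
  (relations M N S).liftQ (rawLift φ) (by
    apply relations_le
    intro k τ f f' h t
    rw [LinearMap.mem_ker, map_sub, rawLift_inc, rawLift_inc, hφ, sub_self])

theorem comp.lift_mk {G : Type*} [AddCommGroup G] [Module F G]
    (φ : ∀ (k : ℕ) (f : S → Fin k), Summand M N f →ₗ[F] G) (hφ) {k : ℕ} (f : S → Fin k) (t) :
    comp.lift φ hφ (mk f t) = φ k f t := by
  rw [mk_fin]
  exact rawLift_inc _ _ _

theorem mk_perm {f : S → K} {f' : S → K'} (τ : K ≃ K') (h : ∀ s, f' s = τ (f s))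
    (t : Summand M N f) : mk f t = mk f' (Summand.map (Equiv.refl S) τ h t) :=
  ((comp M N).map_refl _).symm.trans (mk_map (Equiv.refl S) τ h t)

section LiftHom

variable {G : SymSeq F}
  (φ : ∀ {S K : Type} [Finite S] [Finite K] (f : S → K), Summand M N f →ₗ[F] G.obj S)
  (hφ : ∀ {S S' K K' : Type} [Finite S] [Finite S'] [Finite K] [Finite K'] (e : S ≃ S')
    (τ : K ≃ K') (f : S → K) (f' : S' → K') (h : ∀ s, f' (e s) = τ (f s)) (t : Summand M N f),
    G.map e (φ f t) = φ f' (Summand.map e τ h t))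

/-- The linear map on `(M ∘ N)(S)` given by compatible linear maps on the summands. -/
def comp.liftApp (S : Type) [Finite S] : (comp M N).obj S →ₗ[F] G.obj S :=
  comp.lift (fun _ f => φ f) fun _ τ f f' h t =>
    (hφ (Equiv.refl S) τ f f' h t).symm.trans (G.map_refl _)

theorem comp.liftApp_mk (f : S → K) (t : Summand M N f) :
    comp.liftApp φ hφ S (mk f t) = φ f t := by
  rw [mk_perm (f' := Finite.equivFin K ∘ f) (Finite.equivFin K) (fun _ => rfl)]
  exact (comp.lift_mk _ _ _ _).trans
    ((hφ (Equiv.refl S) (Finite.equivFin K) f _ (fun _ => rfl) t).symm.trans (G.map_refl _))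

/-- The morphism on `M ∘ N` given by compatible linear maps on the summands. -/
def comp.liftHom : SymSeq.Hom (comp M N) G where
  app S _ := comp.liftApp φ hφ S
  naturality {S T} _ _ e x := by
    suffices H : comp.liftApp φ hφ T ∘ₗ (comp M N).map e = G.map e ∘ₗ comp.liftApp φ hφ S from
      LinearMap.congr_fun H x
    apply comp_hom_ext
    intro k f x y
    rw [LinearMap.comp_apply, LinearMap.comp_apply, sym,
      mk_map e (Equiv.refl _) (f' := f ∘ e.symm) (fun k => by simp)]
    exact (comp.liftApp_mk φ hφ _ _).trans ((hφ _ _ _ _ _ _).symm.trans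
      (congrArg _ (comp.liftApp_mk φ hφ _ _).symm))

theorem comp.liftHom_mk (f : S → K) (t : Summand M N f) :
    (comp.liftHom φ hφ).app S (mk f t) = φ f t :=
  comp.liftApp_mk φ hφ f t

end LiftHom

theorem comp.map_sym (φ : SymSeq.Hom M M') (ψ : SymSeq.Hom N N') (f : S → K) (x y) :
    (comp.map φ ψ).app S (sym f x y) = sym f (φ.app K x) (fun k => ψ.app _ (y k)) := by
  rw [sym, mk]
  refine (congrArg (relations M' N' S).mkQ (rawHom_inc φ ψ _ _)).trans ?_
  refine (congrArg (fun t => (relations M' N' S).mkQ (inc (Finite.equivFin K ∘ f) t))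
    (Summand.hom_map φ ψ (Equiv.refl S) (Finite.equivFin K) (fun _ => rfl) _)).trans ?_
  rw [Summand.hom_pureT]
  rfl

end Symbols

section Distribute

variable {S K : Type} [Finite S] [Finite K]

theorem split_update (f : S → K) (W : S → Type u) [∀ s, AddCommGroup (W s)] [∀ s, Module F (W s)]
    (w : ∀ s, W s) (s : S) (c : W s) :
    (fun k => PiTensorProduct.tprod F fun t : Fib f k => Function.update w s c t.1) =
      Function.update (fun k => PiTensorProduct.tprod F fun t : Fib f k => w t.1) (f s)
        (PiTensorProduct.tprod F (Function.update (fun t : Fib f (f s) => w t.1) ⟨s, rfl⟩ c)) := by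
  funext k
  by_cases hk : k = f s
  · subst hk
    rw [Function.update_self]
    congr 1
    funext t
    by_cases ht : t = ⟨s, rfl⟩
    · subst ht; simp
    · rw [Function.update_of_ne ht, Function.update_of_ne (fun h => ht (Subtype.ext h))]
  · rw [Function.update_of_ne hk]
    congr 1
    funext t
    rw [Function.update_of_ne]
    intro h
    exact hk (t.2.symm.trans (congrArg f h))

/-- The canonical multilinear map to `⨂ₖ ⨂_{s ∈ f⁻¹ k} W s`. -/
def splitMulti (f : S → K) (W : S → Type u) [∀ s, AddCommGroup (W s)] [∀ s, Module F (W s)] :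
    MultilinearMap F W (⨂[F] k : K, ⨂[F] s : Fib f k, W s.1) where
  toFun w := PiTensorProduct.tprod F fun k => PiTensorProduct.tprod F fun s : Fib f k => w s.1
  map_update_add' {dec} w s a b := by
    obtain rfl : dec = fun a b => Classical.propDecidable (a = b) := Subsingleton.elim _ _
    rw [split_update, split_update, split_update, MultilinearMap.map_update_add,
      MultilinearMap.map_update_add]
  map_update_smul' {dec} w s c a := by
    obtain rfl : dec = fun a b => Classical.propDecidable (a = b) := Subsingleton.elim _ _
    rw [split_update, split_update, MultilinearMap.map_update_smul,
      MultilinearMap.map_update_smul]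

/-- The canonical map `X ⊗ (⨂ₖ Yₖ) ⊗ (⨂ₛ Wₛ) → X ⊗ ⨂ₖ (Yₖ ⊗ ⨂_{s ∈ f⁻¹ k} Wₛ)` for `f : S → K`. -/
def distribute (f : S → K) (X : Type u) [AddCommGroup X] [Module F X]
    (Y : K → Type u) [∀ k, AddCommGroup (Y k)] [∀ k, Module F (Y k)]
    (W : S → Type u) [∀ s, AddCommGroup (W s)] [∀ s, Module F (W s)] :
    (X ⊗[F] (⨂[F] k, Y k)) ⊗[F] (⨂[F] s, W s) →ₗ[F]
      X ⊗[F] (⨂[F] k, (Y k ⊗[F] (⨂[F] s : Fib f k, W s.1))) :=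
  (TensorProduct.lift (PiTensorProduct.map₂ fun k =>
      TensorProduct.mk F (Y k) (⨂[F] s : Fib f k, W s.1)) ∘ₗ
    (PiTensorProduct.lift (splitMulti f W)).lTensor (⨂[F] k, Y k)).lTensor X ∘ₗ
  (TensorProduct.assoc F X (⨂[F] k, Y k) (⨂[F] s, W s)).toLinearMap

theorem distribute_tmul (f : S → K) (X : Type u) [AddCommGroup X] [Module F X]
    (Y : K → Type u) [∀ k, AddCommGroup (Y k)] [∀ k, Module F (Y k)]
    (W : S → Type u) [∀ s, AddCommGroup (W s)] [∀ s, Module F (W s)] (x : X) (y : ∀ k, Y k)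
    (w : ∀ s, W s) :
    distribute f X Y W ((x ⊗ₜ PiTensorProduct.tprod F y) ⊗ₜ PiTensorProduct.tprod F w) =
      x ⊗ₜ PiTensorProduct.tprod F fun k =>
        y k ⊗ₜ PiTensorProduct.tprod F fun s : Fib f k => w s.1 := by
  simp only [distribute, LinearMap.comp_apply, LinearEquiv.coe_coe, TensorProduct.assoc_tmul,
    LinearMap.lTensor_tmul, PiTensorProduct.lift.tprod, TensorProduct.lift.tmul]
  exact congrArg _ (PiTensorProduct.map₂_tprod_tprod _ _ _)

end Distribute

section AssocInv

variable {A B C : SymSeq F}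
variable {S S' K K' L L' : Type} [Finite S] [Finite S'] [Finite K] [Finite K'] [Finite L] [Finite L']

/-- The restriction of `f` to the fibre of `h ∘ f` over `i`, with values in the fibre of `h`. -/
def Fib.res (f : S → K) (h : K → L) (i : L) : Fib (h ∘ f) i → Fib h i := fun s => ⟨f s.1, s.2⟩

/-- The fibres of the restriction are the fibres of `f`. -/
def Fib.resEquiv (f : S → K) (h : K → L) (i : L) (k : Fib h i) : Fib f k.1 ≃ Fib (Fib.res f h i) k where
  toFun s := ⟨⟨s.1, (congrArg h s.2).trans k.2⟩, Subtype.ext s.2⟩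
  invFun s := ⟨s.1.1, congrArg Subtype.val s.2⟩
  left_inv _ := rfl
  right_inv _ := rfl

/-- The inverse associator of the composition product on summands. -/
def assocInvSummand (f : S → K) (h : K → L) :
    Summand A B h ⊗[F] (⨂[F] k, C.obj (Fib f k)) →ₗ[F] (comp A (comp B C)).obj S :=
  mk (h ∘ f) ∘ₗ
    (PiTensorProduct.map fun i => mk (Fib.res f h i) ∘ₗ
      (PiTensorProduct.map fun k => C.map (Fib.resEquiv f h i k)).lTensor _).lTensor (A.obj L) ∘ₗ
    distribute h (A.obj L) (fun i => B.obj (Fib h i)) (fun k => C.obj (Fib f k))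

theorem assocInvSummand_pure (f : S → K) (h : K → L) (x : A.obj L) (y : ∀ i, B.obj (Fib h i))
    (z : ∀ k, C.obj (Fib f k)) :
    assocInvSummand f h (pureT A B h x y ⊗ₜ PiTensorProduct.tprod F z) =
      sym (M := A) (N := comp B C) (h ∘ f) x fun i => sym (Fib.res f h i) (y i) fun k =>
        C.map (Fib.resEquiv f h i k) (z k.1) := by
  rw [assocInvSummand, LinearMap.comp_apply, LinearMap.comp_apply, pureT, distribute_tmul,
    LinearMap.lTensor_tmul, PiTensorProduct.map_tprod]
  simp only [LinearMap.comp_apply, LinearMap.lTensor_tmul, PiTensorProduct.map_tprod]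
  rfl

theorem assocInvSummand_map (e : S ≃ S') (τ : K ≃ K') (ρ : L ≃ L') (f : S → K) (f' : S' → K')
    (h : K → L) (h' : K' → L') (hf : ∀ s, f' (e s) = τ (f s)) (hh : ∀ k, h' (τ k) = ρ (h k))
    (t : Summand A B h) (z : ∀ k, C.obj (Fib f k)) :
    (comp A (comp B C)).map e (assocInvSummand f h (t ⊗ₜ PiTensorProduct.tprod F z)) =
      assocInvSummand f' h' (Summand.map τ ρ hh t ⊗ₜ PiTensorProduct.tprod F (push e τ hf z)) := by
  suffices H : (comp A (comp B C)).map e ∘ₗ assocInvSummand f h ∘ₗ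
      (TensorProduct.mk F _ _).flip (PiTensorProduct.tprod F z) =
      assocInvSummand f' h' ∘ₗ (TensorProduct.mk F _ _).flip
        (PiTensorProduct.tprod F (push e τ hf z)) ∘ₗ Summand.map τ ρ hh from
    LinearMap.congr_fun H t
  apply Summand.hom_ext
  intro x y
  simp only [LinearMap.comp_apply, LinearMap.flip_apply, TensorProduct.mk_apply]
  rw [Summand.map_pureT, assocInvSummand_pure, assocInvSummand_pure]
  refine sym_map e ρ (fun s => by simp [hf, hh]) rfl fun i => ?_
  refine (sym_map _ (Fib.congr τ (fun k => by simp [hh])) ?_ (push_apply τ ρ hh y i) fun k => ?_).symm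
  · rintro ⟨s, hs⟩; exact Subtype.ext (hf s)
  · refine (congrArg (C.map (Fib.resEquiv f' h' (ρ i) (Fib.congr τ (fun k => by simp [hh]) k)))
      (push_apply e τ hf z k.1)).trans ?_
    exact (C.map_trans _ _ _).symm.trans (C.map_trans (Fib.resEquiv f h i k) (Fib.congr (Fib.congr e
      (fun s => by simp [hf, hh])) (fun s => by
        rw [Subtype.ext_iff, Subtype.ext_iff]; simp [Fib.res, hf])) _)

/-- The inverse associator, defined on the summands of `(A ∘ B) ∘ C`. -/
def assocInvPre (f : S → K) : Summand (comp A B) C f →ₗ[F] (comp A (comp B C)).obj S :=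
  TensorProduct.lift (comp.lift (fun _ h => TensorProduct.curry (assocInvSummand f h))
    (fun k τ h h' hh t => by
      apply PiTensorProduct.ext
      ext z
      exact (congrArg (fun z' => assocInvSummand f h' (Summand.act τ hh t ⊗ₜ
        PiTensorProduct.tprod F z')) (push_refl (f := f) (fun _ => rfl) z).symm).trans
        ((assocInvSummand_map (Equiv.refl S) (Equiv.refl K) τ f f h h' (fun _ => rfl) hh t
          z).symm.trans ((comp A (comp B C)).map_refl _))))

theorem assocInvPre_mk (f : S → K) (h : K → L) (t : Summand A B h) (z : ∀ k, C.obj (Fib f k)) :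
    assocInvPre f (mk h t ⊗ₜ PiTensorProduct.tprod F z) =
      assocInvSummand f h (t ⊗ₜ PiTensorProduct.tprod F z) := by
  rw [mk_perm (f' := Finite.equivFin L ∘ h) (Finite.equivFin L) (fun _ => rfl), assocInvPre,
    TensorProduct.lift.tmul]
  refine (LinearMap.congr_fun (comp.lift_mk _ _ _ _) _).trans ?_
  exact (congrArg (fun z' => assocInvSummand f (Finite.equivFin L ∘ h)
      (Summand.map (Equiv.refl K) (Finite.equivFin L) (fun _ => rfl) t ⊗ₜ
        PiTensorProduct.tprod F z')) (push_refl (f := f) (fun _ => rfl) z).symm).trans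
    ((assocInvSummand_map (Equiv.refl S) (Equiv.refl K) (Finite.equivFin L) f f h
      (Finite.equivFin L ∘ h) (fun _ => rfl) (fun _ => rfl) t z).symm.trans
        ((comp A (comp B C)).map_refl _))

theorem assocInvPre_map (e : S ≃ S') (τ : K ≃ K') (f : S → K) (f' : S' → K')
    (hf : ∀ s, f' (e s) = τ (f s)) (t : Summand (comp A B) C f) :
    (comp A (comp B C)).map e (assocInvPre f t) = assocInvPre f' (Summand.map e τ hf t) := by
  suffices H : (comp A (comp B C)).map e ∘ₗ assocInvPre f = assocInvPre f' ∘ₗ Summand.map e τ hf from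
    LinearMap.congr_fun H t
  apply Summand.hom_ext
  intro w z
  simp only [LinearMap.comp_apply]
  rw [Summand.map_pureT, pureT, pureT]
  suffices H : (comp A (comp B C)).map e ∘ₗ assocInvPre f ∘ₗ
      (TensorProduct.mk F _ _).flip (PiTensorProduct.tprod F z) =
      assocInvPre f' ∘ₗ (TensorProduct.mk F _ _).flip
        (PiTensorProduct.tprod F (push e τ hf z)) ∘ₗ (comp A B).map τ from
    LinearMap.congr_fun H w
  apply comp_hom_ext
  intro l h x y
  simp only [LinearMap.comp_apply, LinearMap.flip_apply, TensorProduct.mk_apply]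
  rw [sym, mk_map τ (Equiv.refl _) (f' := h ∘ τ.symm) (fun k => by simp), assocInvPre_mk,
    assocInvPre_mk]
  exact assocInvSummand_map _ _ _ _ _ _ _ _ _ _ _

/-- The inverse associator `(A ∘ B) ∘ C → A ∘ (B ∘ C)` of the composition product. -/
def assocInv (A B C : SymSeq F) : SymSeq.Hom (comp (comp A B) C) (comp A (comp B C)) :=
  comp.liftHom (fun f => assocInvPre f) (fun e τ f f' h t => assocInvPre_map e τ f f' h t)

theorem assocInv_sym (f : S → K) (h : K → L) (x : A.obj L) (y : ∀ i, B.obj (Fib h i))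
    (z : ∀ k, C.obj (Fib f k)) :
    (assocInv A B C).app S (sym (M := comp A B) f (sym h x y) z) =
      sym (M := A) (N := comp B C) (h ∘ f) x fun i => sym (Fib.res f h i) (y i) fun k =>
        C.map (Fib.resEquiv f h i k) (z k.1) := by
  rw [← assocInvSummand_pure, ← assocInvPre_mk]
  exact comp.liftHom_mk _ _ _ _

end AssocInv

section Assoc

theorem exists_multilift {J : Type} [Finite J] {E : J → Type u} [∀ j, AddCommGroup (E j)]
    [∀ j, Module F (E j)] {G : J → Type u} (γ : ∀ j, G j → E j)
    (hγ : ∀ j, Submodule.span F (Set.range (γ j)) = ⊤) {H : Type u} [AddCommGroup H] [Module F H]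
    (Φ : (∀ j, G j) → H)
    (hΦ : ∀ j g, ∃ L : E j →ₗ[F] H, ∀ x, Φ (Function.update g j x) = L (γ j x)) :
    ∃ Ψ : (⨂[F] j, E j) →ₗ[F] H, ∀ g, Ψ (PiTensorProduct.tprod F fun j => γ j (g j)) = Φ g := by
  have hb : ∀ j, ∃ (ι : Type u) (b : Module.Basis ι F (E j)) (s : ι → G j), ∀ i, b i = γ j (s i) := by
    intro j
    obtain ⟨b, hb1, hb2, hb3⟩ := exists_linearIndependent F (Set.range (γ j))
    have hs : ∀ i : b, ∃ g, γ j g = i.1 := fun i => hb1 i.2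
    choose s hs using hs
    exact ⟨b, Module.Basis.mk hb3 (by rw [Subtype.range_coe, hb2, hγ]), s, fun i => by
      rw [Module.Basis.mk_apply, hs]⟩
  choose ι b s hs using hb
  refine ⟨(Basis.piTensorProduct b).constr F fun p => Φ fun j => s j (p j), ?_⟩
  cases nonempty_fintype J
  have key : ∀ (t : Finset J) (g : ∀ j, G j), (∀ j, j ∉ t → ∃ i, g j = s j i) →
      (Basis.piTensorProduct b).constr F (fun p => Φ fun j => s j (p j))
        (PiTensorProduct.tprod F fun j => γ j (g j)) = Φ g := by
    intro t
    induction t using Finset.induction_on with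
    | empty =>
      intro g hg
      choose i hi using fun j => hg j (Finset.notMem_empty j)
      obtain rfl : g = fun j => s j (i j) := funext hi
      simp only [← hs]
      rw [← Basis.piTensorProduct_apply, Module.Basis.constr_basis]
    | insert a t ha ih =>
      intro g hg
      obtain ⟨L, hL⟩ := hΦ a g
      have h1 : ∀ x : E a, (Basis.piTensorProduct b).constr F (fun p => Φ fun j => s j (p j))
          (PiTensorProduct.tprod F (Function.update (fun j => γ j (g j)) a x)) = L x := by
        intro x
        suffices H : ((Basis.piTensorProduct b).constr F (fun p => Φ fun j => s j (p j))) ∘ₗ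
          ((PiTensorProduct.tprod F).toLinearMap (fun j => γ j (g j)) a) = L from
          LinearMap.congr_fun H x
        apply (b a).ext
        intro i
        rw [hs, ← hL, LinearMap.comp_apply, MultilinearMap.toLinearMap_apply, ← ih]
        · congr 2
          funext j
          exact (Function.apply_update (fun j => γ j) g a (s a i) j).symm
        · intro j hj
          by_cases hja : j = a
          · subst hja; exact ⟨i, by simp⟩
          · rw [Function.update_of_ne hja]
            exact hg j (by simp [hja, hj])
      have := h1 (γ a (g a))
      rw [← hL, Function.update_eq_self, Function.update_eq_self] at this
      exact this
  intro g
  exact key Finset.univ g (fun j hj => absurd (Finset.mem_univ j) hj)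

variable {A B C M N : SymSeq F}
variable {S S' K K' L : Type} [Finite S] [Finite S'] [Finite K] [Finite K'] [Finite L]

/-- The element `(x; (yₖ)ₖ)` as a linear function of `x`. -/
def symL (f : S → K) (y : ∀ k, N.obj (Fib f k)) : M.obj K →ₗ[F] (comp M N).obj S :=
  mk f ∘ₗ (TensorProduct.mk F _ _).flip (PiTensorProduct.tprod F y)

theorem symL_apply (f : S → K) (y : ∀ k, N.obj (Fib f k)) (x : M.obj K) :
    symL f y x = sym f x y := rfl

theorem isLinearMap_sym [DecidableEq K] (f : S → K) (x : M.obj K) (y : ∀ k, N.obj (Fib f k)) (k : K) :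
    IsLinearMap F fun c => sym f x (Function.update y k c) where
  map_add a b := by simp [sym, pureT, TensorProduct.tmul_add]
  map_smul c a := by simp [sym, pureT]

theorem comp_exists_lift {H : Type u} [AddCommGroup H] [Module F H]
    (φ : ∀ (n : ℕ) (f : S → Fin n), M.obj (Fin n) → (∀ i, N.obj (Fib f i)) → H)
    (hx : ∀ n f y, IsLinearMap F fun x => φ n f x y)
    (hy : ∀ n f x y i, IsLinearMap F fun c => φ n f x (Function.update y i c))
    (hτ : ∀ n (τ : Equiv.Perm (Fin n)) (f f' : S → Fin n) (h : ∀ s, f' s = τ (f s)) x y,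
      φ n f' (M.map τ x) (push (Equiv.refl S) τ h y) = φ n f x y) :
    ∃ L : (comp M N).obj S →ₗ[F] H, ∀ n f x y, L (sym f x y) = φ n f x y := by
  let ψ : ∀ (n : ℕ) (f : S → Fin n), Summand M N f →ₗ[F] H := fun n f =>
    TensorProduct.lift
      { toFun := fun x => PiTensorProduct.lift
          { toFun := fun y => φ n f x y
            map_update_add' := fun {dec} y i a b => by
              obtain rfl : dec = instDecidableEqFin n := Subsingleton.elim _ _
              exact (hy n f x y i).map_add a b
            map_update_smul' := fun {dec} y i c a => by
              obtain rfl : dec = instDecidableEqFin n := Subsingleton.elim _ _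
              exact (hy n f x y i).map_smul c a }
        map_add' := fun a b => by
          apply PiTensorProduct.ext; ext y
          simpa using (hx n f y).map_add a b
        map_smul' := fun c a => by
          apply PiTensorProduct.ext; ext y
          simpa using (hx n f y).map_smul c a }
  have hψ : ∀ n f x y, ψ n f (pureT M N f x y) = φ n f x y := fun n f x y => by
    simp [ψ, pureT]
  refine ⟨comp.lift ψ fun n τ f f' h t => ?_, fun n f x y => ?_⟩
  · suffices H : ψ n f' ∘ₗ Summand.act τ h = ψ n f from LinearMap.congr_fun H t
    apply Summand.hom_ext
    intro x y
    exact (congrArg (ψ n f') (Summand.map_pureT (f := f) (f' := f') (Equiv.refl S) τ h x y)).trans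
      ((hψ n f' _ _).trans ((hτ n τ f f' h x y).trans (hψ n f x y).symm))
  · rw [sym, comp.lift_mk, hψ]

/-- The fibres of the projection of a disjoint union. -/
def sigmaFib {n : K → Type} (j : K) : n j ≃ Fib (Sigma.fst : (Σ j, n j) → K) j where
  toFun i := ⟨⟨j, i⟩, rfl⟩
  invFun q := q.2 ▸ q.1.2
  left_inv _ := rfl
  right_inv := by rintro ⟨⟨_, i⟩, rfl⟩; rfl

/-- The map to the disjoint union given by maps on the fibres of `f`. -/
def Fib.glue {n : K → Type} {f : S → K} (p : ∀ j, Fib f j → n j) (s : S) : Σ j, n j :=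
  ⟨f s, p (f s) ⟨s, rfl⟩⟩

/-- The fibres of the glued map. -/
def Fib.glueEquiv {n : K → Type} {f : S → K} (p : ∀ j, Fib f j → n j) (q : Σ j, n j) :
    Fib (p q.1) q.2 ≃ Fib (Fib.glue p) q where
  toFun s := ⟨s.1.1, by
    have h : ∀ (s : S) (j : K) (hj : f s = j) (i : n j), p j ⟨s, hj⟩ = i →
        Fib.glue p s = ⟨j, i⟩ := by
      rintro s _ rfl _ rfl; rfl
    exact h s.1.1 q.1 s.1.2 q.2 s.2⟩
  invFun s := ⟨⟨s.1, congrArg Sigma.fst s.2⟩, by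
    obtain ⟨s, rfl⟩ := s
    rfl⟩
  left_inv _ := rfl
  right_inv _ := rfl

/-- The element `((x; (yⱼ)ⱼ); (zⱼᵢ)ⱼᵢ)` as a linear function of `x`. -/
def assocL {n : K → Type} [∀ j, Finite (n j)] (f : S → K) (p : ∀ j, Fib f j → n j)
    (y : ∀ j, B.obj (n j)) (z : ∀ j i, C.obj (Fib (p j) i)) :
    A.obj K →ₗ[F] (comp (comp A B) C).obj S :=
  symL (M := comp A B) (Fib.glue p) (fun q => C.map (Fib.glueEquiv p q) (z q.1 q.2)) ∘ₗ
    symL (Sigma.fst : (Σ j, n j) → K) (fun j => B.map (sigmaFib j) (y j))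

theorem assocL_map {n : K → Type} [∀ j, Finite (n j)] {n' : K' → Type} [∀ j, Finite (n' j)]
    {f : S → K} {f' : S' → K'} (e : S ≃ S') (τ : K ≃ K') (hf : ∀ s, f' (e s) = τ (f s))
    (ε : ∀ j, n j ≃ n' (τ j))
    {p : ∀ j, Fib f j → n j} {p' : ∀ j, Fib f' j → n' j}
    (hp : ∀ j s, p' (τ j) (Fib.congr e (fun s => by simp [hf]) s) = ε j (p j s))
    {y : ∀ j, B.obj (n j)} {y' : ∀ j, B.obj (n' j)} (hy : ∀ j, y' (τ j) = B.map (ε j) (y j))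
    {z : ∀ j i, C.obj (Fib (p j) i)} {z' : ∀ j i, C.obj (Fib (p' j) i)}
    (hz : ∀ j i, z' (τ j) (ε j i) = C.map (Fib.congr (Fib.congr e (fun s => by simp [hf]))
      (fun s => by rw [hp, EmbeddingLike.apply_eq_iff_eq])) (z j i)) (x : A.obj K) :
    (comp (comp A B) C).map e (assocL f p y z x) = assocL f' p' y' z' (A.map τ x) := by
  rw [assocL, assocL, LinearMap.comp_apply, LinearMap.comp_apply, symL_apply, symL_apply, symL_apply,
    symL_apply]
  have hε : ∀ j i, (Equiv.sigmaCongr τ ε) ⟨j, i⟩ = ⟨τ j, ε j i⟩ := fun _ _ => rfl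
  refine sym_map e (Equiv.sigmaCongr τ ε) ?_ ?_ ?_
  · intro s
    have h1 : ∀ (k : K') (hk : k = τ (f s)) (h2 : f' (e s) = k),
      (⟨k, p' k ⟨e s, h2⟩⟩ : Σ j, n' j) = ⟨τ (f s), ε _ (p (f s) ⟨s, rfl⟩)⟩ := by
      rintro _ rfl h2
      exact congrArg (Sigma.mk _) (hp _ ⟨s, rfl⟩)
    exact h1 _ (hf s) rfl
  · refine ((sym_map (Equiv.sigmaCongr τ ε) τ (fun _ => rfl) rfl ?_)).symm
    intro j
    rw [hy]
    refine (B.map_trans _ _ _).symm.trans (Eq.trans ?_ (B.map_trans _ _ _))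
    exact congrArg (fun e => B.map e (y j)) (Equiv.ext fun i => rfl)
  · rintro ⟨j, i⟩
    change C.map _ (z' (τ j) (ε j i)) = _
    rw [hz]
    refine (C.map_trans _ _ _).symm.trans (Eq.trans ?_ (C.map_trans _ _ _))
    rfl

/-- The data of a generator `(y; z₁, …, zₙ)` of `(B ∘ C)(T)`. -/
abbrev Gen (B C : SymSeq F) (T : Type) [Finite T] : Type u :=
  Σ p : (Σ n : ℕ, T → Fin n), B.obj (Fin p.1) × (∀ i, C.obj (Fib p.2 i))

/-- The generator `(y; z₁, …, zₙ)`. -/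
def Gen.toComp {T : Type} [Finite T] (g : Gen B C T) : (comp B C).obj T := sym g.1.2 g.2.1 g.2.2

theorem span_gen (T : Type) [Finite T] :
    Submodule.span F (Set.range (Gen.toComp (B := B) (C := C) (T := T))) = ⊤ := by
  rw [← Submodule.ker_mkQ (Submodule.span F (Set.range (Gen.toComp (B := B) (C := C) (T := T)))),
    LinearMap.ker_eq_top]
  apply comp_hom_ext
  intro k f x y
  rw [LinearMap.zero_apply, Submodule.mkQ_apply, Submodule.Quotient.mk_eq_zero]
  exact Submodule.subset_span ⟨⟨⟨k, f⟩, x, y⟩, rfl⟩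

/-- The element `((x; y₁, …); z₁₁, …)`, from the data of generators `(yⱼ; zⱼ₁, …)`. -/
def assocGen (f : S → K) (g : ∀ j, Gen B C (Fib f j)) : A.obj K →ₗ[F] (comp (comp A B) C).obj S :=
  assocL f (fun j => (g j).1.2) (fun j => (g j).2.1) (fun j => (g j).2.2)

theorem assocGen_lin_left (f : S → K) (g : ∀ j, Gen B C (Fib f j)) (j : K) :
    IsLinearMap F fun y => assocGen (A := A) f
      (Function.update g j ⟨(g j).1, y, (g j).2.2⟩) := by
  have h1 : ∀ y, Function.update g j ⟨(g j).1, y, (g j).2.2⟩ = fun j' =>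
      ⟨(g j').1, Function.update (fun j' => (g j').2.1) j y j', (g j').2.2⟩ := by
    intro y
    funext j'
    by_cases hj : j' = j
    · subst hj; simp
    · simp [hj]
  have h2 : ∀ y x, assocGen (A := A) f (Function.update g j ⟨(g j).1, y, (g j).2.2⟩) x =
      symL (M := comp A B) (Fib.glue fun j => (g j).1.2)
        (fun q => C.map (Fib.glueEquiv _ q) ((g q.1).2.2 q.2))
        (sym (Sigma.fst : (Σ j, Fin (g j).1.1) → K) x
          (Function.update (fun j => B.map (sigmaFib j) (g j).2.1) j (B.map (sigmaFib j) y))) := by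
    intro y x
    rw [h1]
    refine congrArg (fun w => symL (M := comp A B) (Fib.glue fun j => (g j).1.2)
        (fun q => C.map (Fib.glueEquiv _ q) ((g q.1).2.2 q.2))
        (sym (Sigma.fst : (Σ j, Fin (g j).1.1) → K) x w)) ?_
    funext j'
    exact Function.apply_update (fun j' => B.map (sigmaFib (n := fun j => Fin (g j).1.1) j'))
      (fun j' => (g j').2.1) j y j'
  constructor
  · intro a b
    ext x
    rw [LinearMap.add_apply, h2, h2, h2, map_add, (isLinearMap_sym _ _ _ _).map_add, map_add]
  · intro c a
    ext x
    rw [LinearMap.smul_apply, h2, h2, map_smul, (isLinearMap_sym _ _ _ _).map_smul, map_smul]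

theorem assocGen_lin_right (f : S → K) (g : ∀ j, Gen B C (Fib f j)) (j : K) (i : Fin (g j).1.1) :
    IsLinearMap F fun c => assocGen (A := A) f
      (Function.update g j ⟨(g j).1, (g j).2.1, Function.update (g j).2.2 i c⟩) := by
  have h1 : ∀ c, Function.update g j ⟨(g j).1, (g j).2.1, Function.update (g j).2.2 i c⟩ = fun j' =>
      ⟨(g j').1, (g j').2.1, Function.update (fun j' => (g j').2.2) j
        (Function.update (g j).2.2 i c) j'⟩ := by
    intro y
    funext j'
    by_cases hj : j' = j
    · subst hj; simp
    · simp [hj]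
  have h2 : ∀ c x, assocGen (A := A) f
      (Function.update g j ⟨(g j).1, (g j).2.1, Function.update (g j).2.2 i c⟩) x =
      sym (M := comp A B) (Fib.glue fun j => (g j).1.2)
        (sym (Sigma.fst : (Σ j, Fin (g j).1.1) → K) x (fun j => B.map (sigmaFib j) (g j).2.1))
        (Function.update (fun q => C.map (Fib.glueEquiv (n := fun j => Fin (g j).1.1) (fun j => (g j).1.2) q) ((g q.1).2.2 q.2)) ⟨j, i⟩
          (C.map (Fib.glueEquiv (n := fun j => Fin (g j).1.1) (fun j => (g j).1.2) ⟨j, i⟩) c)) := by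
    intro c x
    rw [h1]
    refine congrArg (fun w => sym (M := comp A B) (Fib.glue fun j => (g j).1.2)
        (sym (Sigma.fst : (Σ j, Fin (g j).1.1) → K) x (fun j => B.map (sigmaFib j) (g j).2.1)) w) ?_
    funext ⟨j', i'⟩
    by_cases hj : j = j'
    · subst hj
      by_cases hi : i = i'
      · subst hi; simp
      · rw [Function.update_of_ne (by simpa using Ne.symm hi)]
        simp [Ne.symm hi]
    · rw [Function.update_of_ne (fun h => hj (Sigma.mk.inj_iff.1 h).1.symm)]
      simp [Ne.symm hj]
  constructor
  · intro a b
    ext x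
    rw [LinearMap.add_apply, h2, h2, h2, map_add, (isLinearMap_sym _ _ _ _).map_add]
  · intro c a
    ext x
    rw [LinearMap.smul_apply, h2, h2, map_smul, (isLinearMap_sym _ _ _ _).map_smul]

theorem assocGen_act (f : S → K) (g : ∀ j, Gen B C (Fib f j)) (j : K) (n : ℕ)
    (τ : Equiv.Perm (Fin n)) (q q' : Fib f j → Fin n) (h : ∀ s, q' s = τ (q s)) (y) (z) :
    assocGen (A := A) f (Function.update g j ⟨⟨n, q'⟩, B.map τ y, push (Equiv.refl _) τ h z⟩) =
      assocGen f (Function.update g j ⟨⟨n, q⟩, y, z⟩) := by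
  have key : ∀ g g' : ∀ j, Gen B C (Fib f j),
      (∀ j, ∃ (σ : Fin (g j).1.1 ≃ Fin (g' j).1.1) (h : ∀ s, (g' j).1.2 s = σ ((g j).1.2 s)),
        (g' j).2.1 = B.map σ (g j).2.1 ∧ ∀ i, (g' j).2.2 (σ i) =
          C.map (Fib.congr (Equiv.refl _) (fun s => by
            exact (EmbeddingLike.apply_eq_iff_eq σ).symm.trans (by rw [← h]; rfl))) ((g j).2.2 i)) →
      assocGen (A := A) f g' = assocGen f g := by
    intro g g' hg
    choose σ h hy hz using hg
    ext x
    have h1 := assocL_map (A := A) (Equiv.refl S) (Equiv.refl K) (f := f) (f' := f) (fun _ => rfl)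
      (n := fun j => Fin (g j).1.1) (n' := fun j => Fin (g' j).1.1) (ε := σ)
      (p := fun j => (g j).1.2) (p' := fun j => (g' j).1.2) (fun j s => h j s)
      (y := fun j => (g j).2.1) (y' := fun j => (g' j).2.1) hy
      (z := fun j => (g j).2.2) (z' := fun j => (g' j).2.2) hz x
    rw [A.map_refl] at h1
    exact h1.symm.trans ((comp (comp A B) C).map_refl _)
  apply key
  intro j'
  by_cases hj : j' = j
  · subst hj
    have h2 : ∀ a b : Gen B C (Fib f j'), a = ⟨⟨n, q⟩, y, z⟩ →
        b = ⟨⟨n, q'⟩, B.map τ y, push (Equiv.refl _) τ h z⟩ →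
        ∃ (σ : Fin a.1.1 ≃ Fin b.1.1) (h : ∀ s, b.1.2 s = σ (a.1.2 s)),
        b.2.1 = B.map σ a.2.1 ∧ ∀ i, b.2.2 (σ i) =
          C.map (Fib.congr (Equiv.refl _) (fun s => by
            exact (EmbeddingLike.apply_eq_iff_eq σ).symm.trans (by rw [← h]; rfl))) (a.2.2 i) := by
      rintro _ _ rfl rfl
      exact ⟨τ, h, rfl, fun i => push_apply (f := q) (f' := q') _ _ h _ _⟩
    exact h2 _ _ (by simp) (by simp)
  · have h2 : ∀ a b : Gen B C (Fib f j'), a = b →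
        ∃ (σ : Fin a.1.1 ≃ Fin b.1.1) (h : ∀ s, b.1.2 s = σ (a.1.2 s)),
        b.2.1 = B.map σ a.2.1 ∧ ∀ i, b.2.2 (σ i) =
          C.map (Fib.congr (Equiv.refl _) (fun s => by
            exact (EmbeddingLike.apply_eq_iff_eq σ).symm.trans (by rw [← h]; rfl))) (a.2.2 i) := by
      rintro a _ rfl
      exact ⟨Equiv.refl _, fun _ => rfl, (B.map_refl _).symm, fun i => (C.map_refl _).symm⟩
    exact h2 _ _ (by simp [hj])

theorem exists_assocPre (f : S → K) :
    ∃ Ψ : (⨂[F] j, (comp B C).obj (Fib f j)) →ₗ[F] A.obj K →ₗ[F] (comp (comp A B) C).obj S,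
      ∀ g : ∀ j, Gen B C (Fib f j),
        Ψ (PiTensorProduct.tprod F fun j => (g j).toComp) = assocGen f g := by
  refine exists_multilift (fun _ => Gen.toComp) (fun _ => span_gen _) (assocGen f) fun j g => ?_
  suffices H : ∃ L : (comp B C).obj (Fib f j) →ₗ[F] A.obj K →ₗ[F] (comp (comp A B) C).obj S,
      ∀ n q y z, L (sym q y z) = assocGen (A := A) f (Function.update g j ⟨⟨n, q⟩, y, z⟩) by
    obtain ⟨L, hL⟩ := H
    exact ⟨L, fun a => (hL a.1.1 a.1.2 a.2.1 a.2.2).symm⟩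
  refine comp_exists_lift (M := B) (N := C) (S := Fib f j)
    (fun n q y z => assocGen (A := A) f (Function.update g j ⟨⟨n, q⟩, y, z⟩))
    (fun n q z => ?_) (fun n q y z i => ?_) (fun n τ q q' h y z => assocGen_act f g j n τ q q' h y z)
  · let g0 := Function.update g j ⟨⟨n, q⟩, 0, z⟩
    have h1 : ∀ a, g0 j = a → IsLinearMap F fun y => assocGen (A := A) f
      (Function.update g0 j ⟨a.1, y, a.2.2⟩) := by
      rintro _ rfl; exact assocGen_lin_left f g0 j
    have := h1 ⟨⟨n, q⟩, 0, z⟩ (by simp [g0])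
    simpa [g0] using this
  · let g0 := Function.update g j ⟨⟨n, q⟩, y, z⟩
    have h1 : ∀ (a) (ha : g0 j = a) (i : Fin a.1.1), IsLinearMap F fun c => assocGen (A := A) f
      (Function.update g0 j ⟨a.1, a.2.1, Function.update a.2.2 i c⟩) := by
      rintro _ rfl i; exact assocGen_lin_right f g0 j i
    have := h1 ⟨⟨n, q⟩, y, z⟩ (by simp [g0]) i
    simpa [g0] using this

/-- The associator, defined on the summands of `A ∘ (B ∘ C)`. -/
def assocPre (f : S → K) : Summand A (comp B C) f →ₗ[F] (comp (comp A B) C).obj S :=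
  TensorProduct.lift (exists_assocPre f).choose.flip

theorem assocPre_pure (f : S → K) (x : A.obj K) (g : ∀ j, Gen B C (Fib f j)) :
    assocPre f (pureT A (comp B C) f x fun j => (g j).toComp) = assocGen f g x := by
  rw [assocPre, pureT, TensorProduct.lift.tmul, LinearMap.flip_apply,
    (exists_assocPre f).choose_spec]

theorem summand_gen_ext {f : S → K} {H : Type u} [AddCommGroup H] [Module F H]
    {φ ψ : Summand A (comp B C) f →ₗ[F] H}
    (h : ∀ x (g : ∀ j, Gen B C (Fib f j)), φ (pureT _ _ f x fun j => (g j).toComp) =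
      ψ (pureT _ _ f x fun j => (g j).toComp)) : φ = ψ := by
  apply TensorProduct.ext
  ext1 x
  refine PiTensorProduct.ext_of_span_eq_top (g := fun j => Gen.toComp) (fun _ => span_gen _) ?_
  intro g
  exact h x g

/-- Relabelling of the data of a generator. -/
def Gen.map {T T' : Type} [Finite T] [Finite T'] (e : T ≃ T') (g : Gen B C T) : Gen B C T' :=
  ⟨⟨g.1.1, fun t => g.1.2 (e.symm t)⟩, g.2.1, fun i =>
    C.map (Fib.congr e (fun s => by
      exact iff_of_eq (congrArg (fun s => g.1.2 s = i) (Equiv.symm_apply_apply e s).symm))) (g.2.2 i)⟩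

theorem Gen.toComp_map {T T' : Type} [Finite T] [Finite T'] (e : T ≃ T') (g : Gen B C T) :
    (g.map e).toComp = (comp B C).map e g.toComp :=
  (sym_map e (Equiv.refl _) (fun s => congrArg g.1.2 (Equiv.symm_apply_apply e s))
    (B.map_refl _).symm (fun _ => rfl)).symm

theorem Gen.exists_equiv {f : S → K} {f' : S' → K'} (e : S ≃ S') (g : ∀ j, Gen B C (Fib f j))
    (k' : K') (k₁ k : K) (hk : k₁ = k) (h1 : ∀ s, f s = k₁ ↔ f' (e s) = k')
    (h2 : ∀ s, f s = k ↔ f' (e s) = k') :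
    ∃ ε : Fin (g k).1.1 ≃ Fin (g k₁).1.1,
      (∀ s, ((g k₁).map (Fib.congr e h1)).1.2 (Fib.congr e h2 s) = ε ((g k).1.2 s)) ∧
      ((g k₁).map (Fib.congr e h1)).2.1 = B.map ε (g k).2.1 ∧
      ∀ i (h3 : ∀ s, (g k).1.2 s = i ↔
        ((g k₁).map (Fib.congr e h1)).1.2 (Fib.congr e h2 s) = ε i),
        ((g k₁).map (Fib.congr e h1)).2.2 (ε i) =
          C.map (Fib.congr (Fib.congr e h2) h3) ((g k).2.2 i) := by
  subst hk
  exact ⟨Equiv.refl _, fun s => congrArg (g k₁).1.2 (Equiv.symm_apply_apply (Fib.congr e h1) s),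
    (B.map_refl _).symm, fun _ _ => rfl⟩

theorem assocPre_map (e : S ≃ S') (τ : K ≃ K') (f : S → K) (f' : S' → K')
    (hf : ∀ s, f' (e s) = τ (f s)) (t : Summand A (comp B C) f) :
    (comp (comp A B) C).map e (assocPre f t) = assocPre f' (Summand.map e τ hf t) := by
  suffices H : (comp (comp A B) C).map e ∘ₗ assocPre f = assocPre f' ∘ₗ Summand.map e τ hf from
    LinearMap.congr_fun H t
  apply summand_gen_ext
  intro x g
  rw [LinearMap.comp_apply, LinearMap.comp_apply, Summand.map_pureT, assocPre_pure]
  let g' : ∀ k', Gen B C (Fib f' k') := fun k' => (g (τ.symm k')).map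
    (Fib.congr e (fun s => by rw [hf, Equiv.eq_symm_apply]))
  have h1 : push e τ hf (fun j => (g j).toComp) = fun k' => (g' k').toComp :=
    funext fun k' => (Gen.toComp_map _ _).symm
  rw [h1, assocPre_pure]
  have hε := fun j => Gen.exists_equiv (f := f) (f' := f') e g (τ j) (τ.symm (τ j)) j
    (τ.symm_apply_apply j) (fun s => by rw [hf, Equiv.eq_symm_apply]) (fun s => by simp [hf])
  choose ε hp hy hz using hε
  exact assocL_map e τ hf (n := fun j => Fin (g j).1.1) (n' := fun k' => Fin (g' k').1.1) (ε := ε)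
    (p := fun j => (g j).1.2) (p' := fun j => (g' j).1.2) hp
    (y := fun j => (g j).2.1) (y' := fun j => (g' j).2.1) hy
    (z := fun j => (g j).2.2) (z' := fun j => (g' j).2.2) (fun j i => hz j i _) x

/-- The associator `A ∘ (B ∘ C) → (A ∘ B) ∘ C` of the composition product, which sends
`(x; (y₁; z₁₁, …), …)` to `((x; y₁, …); z₁₁, …)`. -/
def assoc (A B C : SymSeq F) : SymSeq.Hom (comp A (comp B C)) (comp (comp A B) C) :=
  comp.liftHom (fun f => assocPre f) (fun e τ f f' h t => assocPre_map e τ f f' h t)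

/-- The value of the associator on generators. -/
theorem assoc_sym (f : S → K) (x : A.obj K) (g : ∀ j, Gen B C (Fib f j)) :
    (assoc A B C).app S (sym (M := A) (N := comp B C) f x fun j => sym (g j).1.2 (g j).2.1 (g j).2.2) =
      sym (M := comp A B) (Fib.glue fun j => (g j).1.2)
        (sym (Sigma.fst : (Σ j, Fin (g j).1.1) → K) x (fun j => B.map (sigmaFib j) (g j).2.1))
        (fun q => C.map (Fib.glueEquiv (n := fun j => Fin (g j).1.1) (fun j => (g j).1.2) q)
          ((g q.1).2.2 q.2)) :=
  (comp.liftHom_mk _ _ _ _).trans (assocPre_pure _ _ _)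

end Assoc

section Operads

variable {S : Type} [Finite S]

/-- The bijection of `S` with the unique fibre of the constant map `S → Fin 1`. -/
def constFib (S : Type) (k : Fin 1) : S ≃ Fib (fun _ : S => (0 : Fin 1)) k where
  toFun s := ⟨s, Subsingleton.elim _ _⟩
  invFun s := s.1
  left_inv _ := rfl
  right_inv _ := rfl

/-- The bijection of `Fin 1` with a fibre of the identity map. -/
def idFib (s : S) : Fin 1 ≃ Fib (id : S → S) s where
  toFun _ := ⟨s, rfl⟩
  invFun _ := 0
  left_inv _ := Subsingleton.elim _ _
  right_inv t := Subtype.ext t.2.symm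

/-- The element `(x; y)` of `(M ∘ N)(S)`, for `x` of arity one and `y ∈ N(S)`. -/
def symOuter {M N : SymSeq F} (x : M.obj (Fin 1)) (y : N.obj S) : (comp M N).obj S :=
  sym (fun _ : S => (0 : Fin 1)) x (fun k => N.map (constFib S k) y)

/-- The element `(x; y, …, y)` of `(M ∘ N)(S)`, for `x ∈ M(S)` and `y` of arity one. -/
def symInner {M N : SymSeq F} (x : M.obj S) (y : N.obj (Fin 1)) : (comp M N).obj S :=
  sym (id : S → S) x (fun s => N.map (idFib s) y)

/-- An operad: a monoid for the composition product of symmetric sequences.  The unit morphism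
is given by the unit element `1 ∈ P(1)`. -/
structure Operad (F : Type u) [Field F] extends SymSeq F where
  mul : SymSeq.Hom (comp toSymSeq toSymSeq) toSymSeq
  one : obj (Fin 1)
  mul_assoc : mul.comp (comp.map (SymSeq.Hom.id toSymSeq) mul) =
    (mul.comp (comp.map mul (SymSeq.Hom.id toSymSeq))).comp (assoc toSymSeq toSymSeq toSymSeq)
  one_mul : ∀ (S : Type) [Finite S] (x : obj S), mul.app S (symOuter one x) = x
  mul_one : ∀ (S : Type) [Finite S] (x : obj S), mul.app S (symInner x one) = x

/-- An operadic distributive law `Λ : Q ∘ P → P ∘ Q`. -/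
structure DistributiveLaw (P Q : Operad F) where
  law : SymSeq.Hom (comp Q.toSymSeq P.toSymSeq) (comp P.toSymSeq Q.toSymSeq)
  /-- Compatibility with the multiplication of `P`, on `Q ∘ (P ∘ P)`. -/
  law_mul_left : law.comp (comp.map (SymSeq.Hom.id Q.toSymSeq) P.mul) =
    (comp.map P.mul (SymSeq.Hom.id Q.toSymSeq)).comp
      ((assoc P.toSymSeq P.toSymSeq Q.toSymSeq).comp
        ((comp.map (SymSeq.Hom.id P.toSymSeq) law).comp
          ((assocInv P.toSymSeq Q.toSymSeq P.toSymSeq).comp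
            ((comp.map law (SymSeq.Hom.id P.toSymSeq)).comp
              (assoc Q.toSymSeq P.toSymSeq P.toSymSeq)))))
  /-- Compatibility with the unit of `P`. -/
  law_one_left : ∀ (S : Type) [Finite S] (x : Q.obj S),
    law.app S (symInner x P.one) = symOuter P.one x
  /-- Compatibility with the multiplication of `Q`, on `Q ∘ (Q ∘ P)`. -/
  law_mul_right :
    law.comp ((comp.map Q.mul (SymSeq.Hom.id P.toSymSeq)).comp
      (assoc Q.toSymSeq Q.toSymSeq P.toSymSeq)) =
    (comp.map (SymSeq.Hom.id P.toSymSeq) Q.mul).comp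
      ((assocInv P.toSymSeq Q.toSymSeq Q.toSymSeq).comp
        ((comp.map law (SymSeq.Hom.id Q.toSymSeq)).comp
          ((assoc Q.toSymSeq P.toSymSeq Q.toSymSeq).comp
            (comp.map (SymSeq.Hom.id Q.toSymSeq) law))))
  /-- Compatibility with the unit of `Q`. -/
  law_one_right : ∀ (S : Type) [Finite S] (x : P.obj S),
    law.app S (symOuter Q.one x) = symInner x Q.one

/-- The multiplication `(μ_P ∘ μ_Q)(P ∘ Λ ∘ Q)` of the operad `P ∘ Q` defined by a distributive
law. -/
def DistributiveLaw.mul {P Q : Operad F} (Λ : DistributiveLaw P Q) :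
    SymSeq.Hom (comp (comp P.toSymSeq Q.toSymSeq) (comp P.toSymSeq Q.toSymSeq))
      (comp P.toSymSeq Q.toSymSeq) :=
  (comp.map P.mul Q.mul).comp
    ((assoc P.toSymSeq P.toSymSeq (comp Q.toSymSeq Q.toSymSeq)).comp
      ((comp.map (SymSeq.Hom.id P.toSymSeq)
        ((assocInv P.toSymSeq Q.toSymSeq Q.toSymSeq).comp
          ((comp.map Λ.law (SymSeq.Hom.id Q.toSymSeq)).comp
            (assoc Q.toSymSeq P.toSymSeq Q.toSymSeq)))).comp
        (assocInv P.toSymSeq Q.toSymSeq (comp P.toSymSeq Q.toSymSeq))))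

end Operads

section DividedSchur

variable {M N M' : SymSeq F} {V W U : Type u} [AddCommGroup V] [Module F V]
  [AddCommGroup W] [Module F W] [AddCommGroup U] [Module F U]
variable {S T : Type} [Finite S] [Finite T]

/-- `M(T) ⊗ V^{⊗ T}`. -/
abbrev Tens (M : SymSeq F) (V : Type u) [AddCommGroup V] [Module F V] (T : Type) [Finite T] :
    Type u :=
  M.obj T ⊗[F] (⨂[F] _ : T, V)

/-- The diagonal action of bijections on `M(T) ⊗ V^{⊗ T}`. -/
def Tens.map (e : S ≃ T) : Tens M V S →ₗ[F] Tens M V T :=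
  TensorProduct.map (M.map e) (PiTensorProduct.reindex F (fun _ : S => V) e).toLinearMap

theorem Tens.map_tmul (e : S ≃ T) (x : M.obj S) (a : S → V) :
    Tens.map e (x ⊗ₜ[F] PiTensorProduct.tprod F a) =
      (M.map e x ⊗ₜ PiTensorProduct.tprod F (fun t => a (e.symm t)) : Tens M V T) := by
  rw [Tens.map, TensorProduct.map_tmul]
  exact congrArg _ (PiTensorProduct.reindex_tprod _ _)

theorem Tens.hom_ext {G : Type*} [AddCommGroup G] [Module F G] {φ ψ : Tens M V T →ₗ[F] G}
    (h : ∀ x a, φ (x ⊗ₜ[F] PiTensorProduct.tprod F a) = ψ (x ⊗ₜ[F] PiTensorProduct.tprod F a)) :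
    φ = ψ := by
  apply TensorProduct.ext
  ext x a
  exact h x a

/-- The map `M(T) ⊗ V^{⊗ T} → M'(T) ⊗ W^{⊗ T}` induced by `M → M'` and `V → W`. -/
def Tens.hom (φ : SymSeq.Hom M M') (g : V →ₗ[F] W) (T : Type) [Finite T] :
    Tens M V T →ₗ[F] Tens M' W T :=
  TensorProduct.map (φ.app T) (PiTensorProduct.map fun _ => g)

theorem Tens.hom_map (φ : SymSeq.Hom M M') (g : V →ₗ[F] W) (e : S ≃ T) (t : Tens M V S) :
    Tens.hom φ g T (Tens.map e t) = Tens.map e (Tens.hom φ g S t) := by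
  suffices H : Tens.hom φ g T ∘ₗ Tens.map e = Tens.map e ∘ₗ Tens.hom φ g S from
    LinearMap.congr_fun H t
  apply Tens.hom_ext
  intro x a
  rw [LinearMap.comp_apply, LinearMap.comp_apply, Tens.map_tmul]
  simp only [Tens.hom, TensorProduct.map_tmul, PiTensorProduct.map_tprod]
  rw [Tens.map_tmul, φ.naturality]

/-- The representation of the symmetric group of `T` on `M(T) ⊗ V^{⊗ T}`. -/
def Tens.rep (M : SymSeq F) (V : Type u) [AddCommGroup V] [Module F V] (T : Type) [Finite T] :
    Representation F (Equiv.Perm T) (Tens M V T) where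
  toFun σ := Tens.map σ
  map_one' := by
    apply Tens.hom_ext
    intro x a
    rw [Tens.map_tmul]
    exact congrArg (fun x => x ⊗ₜ[F] PiTensorProduct.tprod F a) (M.map_refl x)
  map_mul' σ τ := by
    apply Tens.hom_ext
    intro x a
    rw [Module.End.mul_apply, Tens.map_tmul, Tens.map_tmul, Tens.map_tmul]
    exact congrArg (fun x => x ⊗ₜ[F] PiTensorProduct.tprod F _) (M.map_trans τ σ x)

/-- The representation of the symmetric group of `T` on `M(T)`. -/
def SymSeq.rep (M : SymSeq F) (T : Type) [Finite T] :
    Representation F (Equiv.Perm T) (M.obj T) where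
  toFun σ := M.map σ
  map_one' := LinearMap.ext M.map_refl
  map_mul' σ τ := LinearMap.ext (M.map_trans τ σ)

variable (M V) in
/-- The families of elements of `M(n) ⊗ V^{⊗ n}` which are fixed by the symmetric groups. -/
def gammaInvariants : Submodule F (⨁ n : ℕ, Tens M V (Fin n)) where
  carrier := {t | ∀ (n : ℕ) (σ : Equiv.Perm (Fin n)), Tens.map σ (t n) = t n}
  add_mem' {a b} ha hb n σ := by
    rw [DirectSum.add_apply, map_add, ha, hb]
  zero_mem' n σ := by rw [DirectSum.zero_apply, map_zero]
  smul_mem' c a ha n σ := by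
    rw [DirectSum.smul_apply, map_smul, ha]

variable (M V) in
/-- The divided Schur functor `Γ(M, V) = M ∘~ V = ⨁ₙ (M(n) ⊗ V^{⊗ n})^{Sₙ}`. -/
def Gamma : Type u := gammaInvariants M V

instance : AddCommGroup (Gamma M V) := inferInstanceAs (AddCommGroup (gammaInvariants M V))

instance : Module F (Gamma M V) := inferInstanceAs (Module F (gammaInvariants M V))

variable (M V) in
/-- The component of an element of `Γ(M, V)` in `M(n) ⊗ V^{⊗ n}`. -/
def Gamma.component (n : ℕ) : Gamma M V →ₗ[F] Tens M V (Fin n) :=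
  DirectSum.component F ℕ (fun n => Tens M V (Fin n)) n ∘ₗ (gammaInvariants M V).subtype

/-- The element of `Γ(M, V)` given by an invariant element of `M(n) ⊗ V^{⊗ n}`. -/
def Gamma.of {n : ℕ} (t : Tens M V (Fin n)) (ht : ∀ σ : Equiv.Perm (Fin n), Tens.map σ t = t) :
    Gamma M V :=
  ⟨DirectSum.lof F ℕ (fun n => Tens M V (Fin n)) n t, by
    intro k σ
    by_cases hk : n = k
    · subst hk
      rw [DirectSum.lof_apply, ht]
    · have h0 : (DirectSum.lof F ℕ (fun n => Tens M V (Fin n)) n t) k = 0 :=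
        DirectSum.of_eq_of_ne _ _ _ (Ne.symm hk)
      rw [h0, map_zero]⟩

/-- Functoriality of `Γ(M, V)` in `M` and `V`. -/
def Gamma.map (φ : SymSeq.Hom M M') (g : V →ₗ[F] W) : Gamma M V →ₗ[F] Gamma M' W :=
  LinearMap.restrict (p := gammaInvariants M V) (q := gammaInvariants M' W)
    (DirectSum.lmap fun n => Tens.hom φ g (Fin n)) (fun t ht n σ => by
      rw [DirectSum.lmap_apply, ← Tens.hom_map, ht])

/-- The component of an element of `Γ(M, V)` in `M(T) ⊗ V^{⊗ T}`, for a finite set `T`.  By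
invariance, it does not depend on the enumeration of `T`. -/
def Gamma.eval (T : Type) [Finite T] : Gamma M V →ₗ[F] Tens M V T :=
  Tens.map (Finite.equivFin T).symm ∘ₗ Gamma.component M V (Nat.card T)

/-- The unit `V → Γ(P, V)` given by the unit of the operad `P`. -/
def Gamma.unit (P : Operad F) (V : Type u) [AddCommGroup V] [Module F V] :
    V →ₗ[F] Gamma P.toSymSeq V where
  toFun v := Gamma.of (n := 1) (P.one ⊗ₜ[F] PiTensorProduct.tprod F (fun _ => v)) (fun σ => by
    obtain rfl : σ = Equiv.refl _ := Subsingleton.elim _ _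
    rw [Tens.map_tmul, P.map_refl])
  map_add' v w := by
    apply Subtype.ext
    refine Eq.trans (congrArg (DirectSum.lof F ℕ (fun n => Tens P.toSymSeq V (Fin n)) 1) ?_)
      (map_add _ _ _)
    rw [← TensorProduct.tmul_add]
    congr 1
    have := (PiTensorProduct.tprod F (s := fun _ : Fin 1 => V)).map_update_add (fun _ => 0) 0 v w
    have h : ∀ v : V, Function.update (fun _ : Fin 1 => (0 : V)) 0 v = fun _ => v := fun v => by
      funext i; rw [Subsingleton.elim i 0, Function.update_self]
    rwa [h, h, h] at this
  map_smul' c v := by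
    apply Subtype.ext
    refine Eq.trans (congrArg (DirectSum.lof F ℕ (fun n => Tens P.toSymSeq V (Fin n)) 1) ?_)
      (map_smul _ _ _)
    rw [RingHom.id_apply, ← TensorProduct.tmul_smul]
    congr 1
    have := (PiTensorProduct.tprod F (s := fun _ : Fin 1 => V)).map_update_smul (fun _ => 0) 0 c v
    have h : ∀ v : V, Function.update (fun _ : Fin 1 => (0 : V)) 0 v = fun _ => v := fun v => by
      funext i; rw [Subsingleton.elim i 0, Function.update_self]
    rwa [h, h] at this

section Associator

variable (M N V)

/-- The product over all maps `f : Fin n → Fin k` of `M(k) ⊗ ⨂ⱼ N(f⁻¹ j) ⊗ V^{⊗ f⁻¹ j}`. -/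
abbrev Ambient : Type u :=
  ∀ (n k : ℕ) (f : Fin n → Fin k), M.obj (Fin k) ⊗[F] (⨂[F] j, Tens N V (Fib f j))

/-- The canonical embedding of `M ∘~ (N ∘~ V)`. -/
def embedRight : Gamma M (Gamma N V) →ₗ[F] Ambient M N V :=
  LinearMap.pi fun _ => LinearMap.pi fun k => LinearMap.pi fun f =>
    (PiTensorProduct.map fun j => Gamma.eval (Fib f j)).lTensor (M.obj (Fin k)) ∘ₗ
      Gamma.component M (Gamma N V) k

/-- The canonical embedding of `(M ∘~ N) ∘~ V`. -/
def embedLeft : Gamma (tcomp M N) V →ₗ[F] Ambient M N V :=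
  LinearMap.pi fun n => LinearMap.pi fun k => LinearMap.pi fun f =>
    distribute f (M.obj (Fin k)) (fun j => N.obj (Fib f j)) (fun _ => V) ∘ₗ
      (cpt f ∘ₗ (invariants M N (Fin n)).subtype).rTensor (⨂[F] _ : Fin n, V) ∘ₗ
      Gamma.component (tcomp M N) V n

/-- The associator `M ∘~ (N ∘~ V) → (M ∘~ N) ∘~ V`.  Over a field, both canonical embeddings
`embedRight` and `embedLeft` are injective and they have the same range (the finitely supported
families which are equivariant under relabelling of `Fin n` and of `Fin k`).  The associator is the
resulting identification: the unique map `a` such that `embedLeft (a u) = embedRight u`. -/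
def assocGamma : Gamma M (Gamma N V) →ₗ[F] Gamma (tcomp M N) V :=
  (LinearMap.leftInverse (K := F) (V := Gamma (tcomp M N) V) (V' := Ambient M N V)
    (embedLeft M N V)) ∘ₗ embedRight M N V

/-- The inverse `(M ∘~ N) ∘~ V → M ∘~ (N ∘~ V)` of the associator: the unique map `b` such that
`embedRight (b w) = embedLeft w`. -/
def assocGammaInv : Gamma (tcomp M N) V →ₗ[F] Gamma M (Gamma N V) :=
  (LinearMap.leftInverse (K := F) (V := Gamma M (Gamma N V)) (V' := Ambient M N V)
    (embedRight M N V)) ∘ₗ embedLeft M N V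

end Associator

end DividedSchur

section MonomialElements

section CosetSum

variable {G : Type} [Group G] [Fintype G] {X : Type u} [AddCommGroup X] [Module F X]

/-- The sum `∑_{c ∈ G/H} c · w` over a set of representatives of the left cosets of `H`. It does
not depend on the representatives when `w` is fixed by `H`. -/
def cosetSum (ρ : Representation F G X) (H : Subgroup G) (w : X) : X :=
  ∑ c : G ⧸ H, ρ c.out w

theorem cosetSum_invariant (ρ : Representation F G X) (H : Subgroup G) (w : X)
    (hw : ∀ h ∈ H, ρ h w = w) (g : G) : ρ g (cosetSum ρ H w) = cosetSum ρ H w := by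
  have key : ∀ a b : G, (a : G ⧸ H) = b → ρ a w = ρ b w := by
    intro a b hab
    have h1 : b = a * (a⁻¹ * b) := by group
    rw [h1, map_mul, Module.End.mul_apply, hw _ (QuotientGroup.eq.1 hab)]
  rw [cosetSum, map_sum]
  refine Fintype.sum_equiv (MulAction.toPerm g) _ _ fun c => ?_
  rw [← Module.End.mul_apply, ← map_mul]
  apply key
  rw [QuotientGroup.out_eq', ← smul_eq_mul, ← MulAction.Quotient.smul_coe, QuotientGroup.out_eq']
  rfl

end CosetSum

/-- The subgroup `S_R` of the permutations which preserve every block of the partition given by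
the map `R`, whose blocks are the fibres of `R`. -/
def partitionGroup {n : ℕ} {J : Type} (R : Fin n → J) : Subgroup (Equiv.Perm (Fin n)) where
  carrier := {σ | ∀ s, R (σ s) = R s}
  mul_mem' {σ τ} hσ hτ s := (hσ (τ s)).trans (hτ s)
  one_mem' _ := rfl
  inv_mem' {σ} hσ s := by
    exact (hσ (σ⁻¹ s)).symm.trans (congrArg R (σ.apply_symm_apply s))

variable {M N : SymSeq F} {V : Type u} [AddCommGroup V] [Module F V]

/-- `x ∈ M(n)` is fixed by the subgroup `K` of the symmetric group. -/
def FixedBy {n : ℕ} (x : M.obj (Fin n)) (K : Subgroup (Equiv.Perm (Fin n))) : Prop :=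
  ∀ σ ∈ K, M.map σ x = x

/-- The element `β_{x,R}(a) = ∑_{σ ∈ Sₙ/S_R} σ · (x ⊗ ⨂ᵢ a_{R i})` of `Γ(M, V)`, for a partition
`R` of `Fin n` with blocks indexed by `J`, an element `x ∈ M(n)` fixed by `S_R` and a family `a` of
vectors indexed by `J`. -/
def beta {n : ℕ} {J : Type} (x : M.obj (Fin n)) (R : Fin n → J) (hx : FixedBy x (partitionGroup R))
    (a : J → V) : Gamma M V :=
  Gamma.of (cosetSum (Tens.rep M V (Fin n)) (partitionGroup R)
    (x ⊗ₜ[F] PiTensorProduct.tprod F fun i => a (R i)))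
    (cosetSum_invariant (Tens.rep M V (Fin n)) _ _ fun σ hσ => by
      refine (Tens.map_tmul σ x _).trans ?_
      rw [hx σ hσ]
      congr 2
      funext i
      exact congrArg a ((partitionGroup R).inv_mem hσ i))

/-- The block of a point for the partition of `{1, …, r₁ + … + r_p}` into successive intervals of
lengths `r₁, …, r_p`. -/
def block {p : ℕ} (r : Fin p → ℕ) (t : Fin (∑ i, r i)) : Fin p := (finSigmaFinEquiv.symm t).1

/-- The position of a point in its block. -/
def pos {p : ℕ} (r : Fin p → ℕ) (t : Fin (∑ i, r i)) : Fin (r (block r t)) :=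
  (finSigmaFinEquiv.symm t).2

/-- The increasing bijection of `Fin (r i)` with the `i`-th block. -/
def blockEquiv {p : ℕ} (r : Fin p → ℕ) (i : Fin p) : Fin (r i) ≃ Fib (block r) i where
  toFun b := ⟨finSigmaFinEquiv ⟨i, b⟩, by rw [block, Equiv.symm_apply_apply]⟩
  invFun t := t.2 ▸ pos r t.1
  left_inv b := by
    have h : ∀ (q : Σ i, Fin (r i)) (hq : finSigmaFinEquiv.symm (finSigmaFinEquiv q) = q)
        (h : (finSigmaFinEquiv.symm (finSigmaFinEquiv q)).1 = q.1),
        h ▸ (finSigmaFinEquiv.symm (finSigmaFinEquiv q)).2 = q.2 := by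
      intro q hq h
      generalize finSigmaFinEquiv.symm (finSigmaFinEquiv q) = q' at hq h
      subst hq; rfl
    exact h ⟨i, b⟩ (Equiv.symm_apply_apply _ _) _
  right_inv := by
    rintro ⟨t, rfl⟩
    exact Subtype.ext (finSigmaFinEquiv.apply_symm_apply t)

/-- The element `(x; z₁, …, zₙ)` of `(M ∘ N)(m₁ + … + mₙ)`. -/
def compElement {n : ℕ} (x : M.obj (Fin n)) (m : Fin n → ℕ) (z : ∀ j, N.obj (Fin (m j))) :
    (comp M N).obj (Fin (∑ j, m j)) :=
  sym (block m) x fun j => N.map (blockEquiv m j) (z j)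

variable {p : ℕ}

/-- The partition `r ◇ (Q₁, …, Q_p)`: the set `{1, …, r₁ m₁ + … + r_p m_p}` is cut into successive
intervals, `r₁` intervals of length `m₁`, …, `r_p` intervals of length `m_p`, and the block
`(i, l)` is the union of the blocks `(Qᵢ)_l` in the `rᵢ` intervals of length `mᵢ`. -/
def diamond (r : Fin p → ℕ) {m : Fin p → ℕ} {s : Fin p → ℕ} (Q : ∀ i, Fin (m i) → Fin (s i))
    (t : Fin (∑ j, m (block r j))) : Σ i, Fin (s i) :=
  ⟨block r (block (fun j => m (block r j)) t),
    Q (block r (block (fun j => m (block r j)) t)) (pos (fun j => m (block r j)) t)⟩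

/-- The image of `∏ᵢ S_{rᵢ} ≀ S_{Qᵢ}` in the symmetric group of `{1, …, r₁ m₁ + … + r_p m_p}`: the
permutations which permute among themselves the `rᵢ` intervals of length `mᵢ`, for all `i`, and
which preserve the partitions `Qᵢ` of these intervals. -/
def wreathGroup (r : Fin p → ℕ) {m : Fin p → ℕ} {s : Fin p → ℕ} (Q : ∀ i, Fin (m i) → Fin (s i)) :
    Subgroup (Equiv.Perm (Fin (∑ j, m (block r j)))) where
  carrier := {σ | (∃ τ ∈ partitionGroup (block r), ∀ t,
      block (fun j => m (block r j)) (σ t) = τ (block (fun j => m (block r j)) t)) ∧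
    σ ∈ partitionGroup (diamond r Q)}
  mul_mem' := by
    rintro σ σ' ⟨⟨τ, hτ, h⟩, hσ⟩ ⟨⟨τ', hτ', h'⟩, hσ'⟩
    refine ⟨⟨τ * τ', mul_mem hτ hτ', fun t => ?_⟩, mul_mem hσ hσ'⟩
    rw [Equiv.Perm.mul_apply, h, h', Equiv.Perm.mul_apply]
  one_mem' := ⟨⟨1, one_mem _, fun _ => rfl⟩, one_mem _⟩
  inv_mem' := by
    rintro σ ⟨⟨τ, hτ, h⟩, hσ⟩
    refine ⟨⟨τ⁻¹, inv_mem hτ, fun t => ?_⟩, inv_mem hσ⟩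
    rw [Equiv.Perm.eq_inv_iff_eq, ← h]
    exact congrArg _ (σ.apply_symm_apply t)

/-- The sum `∑_σ σ · w` over the representatives `σ` of the cosets of `∏ᵢ S_{rᵢ} ≀ S_{Qᵢ}` in
`S_{r ◇ (Q₁, …, Q_p)}`. -/
def diamondSum (r : Fin p → ℕ) {m : Fin p → ℕ} {s : Fin p → ℕ} (Q : ∀ i, Fin (m i) → Fin (s i))
    (w : M.obj (Fin (∑ j, m (block r j)))) : M.obj (Fin (∑ j, m (block r j))) :=
  cosetSum ((M.rep _).comp (partitionGroup (diamond r Q)).subtype)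
    ((wreathGroup r Q).subgroupOf (partitionGroup (diamond r Q))) w

end MonomialElements

section TildeLambda

variable (P Q : Operad F) (V : Type u) [AddCommGroup V] [Module F V]

/-- The map `η_P ∘~ (Q ∘~ (P ∘~ (η_Q ∘~ V)))`. -/
def tildeUnits : Gamma Q.toSymSeq (Gamma P.toSymSeq V) →ₗ[F]
    Gamma P.toSymSeq (Gamma Q.toSymSeq (Gamma P.toSymSeq (Gamma Q.toSymSeq V))) :=
  Gamma.unit P (Gamma Q.toSymSeq (Gamma P.toSymSeq (Gamma Q.toSymSeq V))) ∘ₗ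
    Gamma.map (SymSeq.Hom.id Q.toSymSeq)
      (Gamma.map (SymSeq.Hom.id P.toSymSeq) (Gamma.unit Q V))

/-- The composite of three associators, for symmetric sequences `A`, `B`. -/
def tildeAssoc (A B : SymSeq F) : Gamma A (Gamma B (Gamma A (Gamma B V))) →ₗ[F]
    Gamma (tcomp (tcomp A B) (tcomp A B)) V :=
  assocGamma (tcomp A B) (tcomp A B) V ∘ₗ
    Gamma.map (SymSeq.Hom.id (tcomp A B)) (assocGamma A B V) ∘ₗ
    assocGamma A B (Gamma A (Gamma B V))

variable {P Q}

/-- The map `((P ∘~ Q) ∘~ (P ∘~ Q)) ∘~ V → (P ∘ Q) ∘~ V` given by the inverses of the trace maps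
and the multiplication of the operad `P ∘ Q`. -/
def tildeMul (Λ : DistributiveLaw P Q) (hP : P.Reduced) (hQ : Q.Reduced) :
    Gamma (tcomp (tcomp P.toSymSeq Q.toSymSeq) (tcomp P.toSymSeq Q.toSymSeq)) V →ₗ[F]
      Gamma (comp P.toSymSeq Q.toSymSeq) V :=
  Gamma.map Λ.mul LinearMap.id ∘ₗ
    Gamma.map (traceInv (comp P.toSymSeq Q.toSymSeq) (comp_reduced hP hQ)) LinearMap.id ∘ₗ
    Gamma.map (tcomp.map (traceInv P.toSymSeq hQ) (traceInv P.toSymSeq hQ)) LinearMap.id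

/-- The distributive law `Λ̃ : Q ∘~ (P ∘~ V) → P ∘~ (Q ∘~ V)` induced by an operadic distributive
law `Λ : Q ∘ P → P ∘ Q` between reduced operads. It is the composite of the units, of three
associators, of the inverses of the trace maps, of the multiplication of `P ∘ Q`, of the trace map
and of the inverse of the associator. -/
def tildeLambda (Λ : DistributiveLaw P Q) (hP : P.Reduced) (hQ : Q.Reduced) :
    Gamma Q.toSymSeq (Gamma P.toSymSeq V) →ₗ[F] Gamma P.toSymSeq (Gamma Q.toSymSeq V) :=
  assocGammaInv P.toSymSeq Q.toSymSeq V ∘ₗ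
    Gamma.map (trace P.toSymSeq Q.toSymSeq) LinearMap.id ∘ₗ
    tildeMul V Λ hP hQ ∘ₗ tildeAssoc V P.toSymSeq Q.toSymSeq ∘ₗ tildeUnits P Q V

end TildeLambda

end

end DivPow

/-!
The map `Λ̃` and the right-hand side of the formula end with the same two maps, so the point is
to compute the element of `(P ∘ Q) ∘~ V` that precedes them. This splits into a formal part, valid
for every argument of `Λ̃`, and a combinatorial part about monomials.

*Formal part.* Both embeddings that define the associators are natural in the symmetric sequences,
and `embedLeft` is injective (`embedLeft_injective`), so an associator is computed by exhibiting an
element with the right image (`assocGamma_eq`). In this way the two units in `Λ̃` become the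
morphisms `x ↦ (1; x)` and `y ↦ (y; 1, …, 1)` (`assocGamma_unit`, `assocGamma_map_unit`). The traces
are natural and cancel against their inverses, and the multiplication of `P ∘ Q` sends
`((1; x); (y₁; 1, …), …)` to `Λ(x; y₁, …)` by the unit axioms (`mul_outer_inner`). Thus, if `u` in
`(Q ∘ P) ∘~ V` corresponds to `t` under the trace and the associator, the element to be computed
is `(Λ ∘~ V)(u)` (`tildeMul_tildeAssoc_tildeUnits`).

*Combinatorial part.* The element `β_{x,R}(a)` is a sum over all maps `g : [n] → J`, the
coefficient of `⨂ a_{g(t)}` being the value `spread x R g` at `g` of the equivariant family generated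
by `x` (`Gamma.eval_beta`). With this description, the associator of an iterated monomial
`β_{x,r}(β_{y₁,q₁}(a₁), …)` is compared term by term with the trace of the monomial of
`W₀ = ∑ σ · (x; y₁, …, y₁, …, y_p, …, y_p)` and the partition `r ◇ (q₁, …, q_p)`
(`embedLeft_beta_diamond`). The comparison is the formula `tcpt_trace_spread_diamondSum`
for the components of the trace: a decomposition `f` of the inputs labelled by `G` receives
a contribution from at most one coset of the wreath product, because these cosets correspond to
the decompositions compatible with the labels. Since `P` is reduced, the parts of a decomposition
are nonempty, so that the labels of the inputs determine those of the parts.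

The formula follows, as `Λ` is equivariant and thus sends `W₀` to `W`.
-/

namespace DivPow

noncomputable section

open scoped TensorProduct Classical DirectSum

variable {F : Type u} [Field F]

/-! ### Injectivity of the left embedding -/

section Injectivity

theorem injective_of_basis_apply {ι κ A B : Type*} [AddCommGroup A] [Module F A] [AddCommGroup B]
    [Module F B] (b : Module.Basis ι F A) (c : Module.Basis κ F B) (φ : A →ₗ[F] B) (θ : ι → κ)
    (hθ : Function.Injective θ) (h : ∀ i, φ (b i) = c (θ i)) : Function.Injective φ := by
  have : φ = c.repr.symm.toLinearMap ∘ₗ Finsupp.lmapDomain F F θ ∘ₗ b.repr.toLinearMap :=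
    b.ext fun i => by simp [h]
  rw [this]
  exact c.repr.symm.injective.comp ((Finsupp.mapDomain_injective hθ).comp b.repr.injective)

/-- The canonical map `distribute` permutes the factors of a tensor product: it sends a basis made
of pure tensors into such a basis. -/
theorem distribute_injective {S K : Type} [Finite S] [Finite K] (f : S → K) (X : Type u)
    [AddCommGroup X] [Module F X] (Y : K → Type u) [∀ k, AddCommGroup (Y k)] [∀ k, Module F (Y k)]
    (W : S → Type u) [∀ s, AddCommGroup (W s)] [∀ s, Module F (W s)] :
    Function.Injective (distribute (F := F) f X Y W) := by
  let bX := Module.Basis.ofVectorSpace F X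
  let bY := fun k => Module.Basis.ofVectorSpace F (Y k)
  let bW := fun s => Module.Basis.ofVectorSpace F (W s)
  refine injective_of_basis_apply
    ((bX.tensorProduct (Basis.piTensorProduct bY)).tensorProduct (Basis.piTensorProduct bW))
    (bX.tensorProduct (Basis.piTensorProduct fun k =>
      (bY k).tensorProduct (Basis.piTensorProduct fun s : Fib f k => bW s.1)))
    _ (fun i => (i.1.1, fun k => (i.1.2 k, fun s => i.2 s.1))) ?_ ?_
  · rintro ⟨⟨i, j⟩, l⟩ ⟨⟨i', j'⟩, l'⟩ h
    simp only [Prod.mk.injEq] at h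
    obtain ⟨rfl, h⟩ := h
    obtain rfl : j = j' := funext fun k => congrArg Prod.fst (congrFun h k)
    obtain rfl : l = l' := funext fun s =>
      congrFun (congrArg Prod.snd (congrFun h (f s))) ⟨s, rfl⟩
    rfl
  · rintro ⟨⟨i, j⟩, l⟩
    simp only [Module.Basis.tensorProduct_apply, Basis.piTensorProduct_apply]
    exact distribute_tmul f X Y W _ _ _

variable {M N : SymSeq F} {V : Type u} [AddCommGroup V] [Module F V]

/-- Tensoring commutes with the direct sum `Raw`, so an element is detected by its components. -/
theorem rTensor_cpt_eq_zero {S : Type} [Finite S] {X : Type u} [AddCommGroup X] [Module F X]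
    (t : Raw M N S ⊗[F] X)
    (h : ∀ (k : ℕ) (f : S → Fin k), (cpt f).rTensor X t = 0) : t = 0 := by
  apply (TensorProduct.directSumLeft F F
    (fun p : (Σ k : ℕ, S → Fin k) => Summand M N p.2) X).injective
  rw [map_zero]
  refine DFinsupp.ext fun ⟨k, f⟩ => ?_
  let Φ : Raw M N S ⊗[F] X →ₗ[F] Summand M N f ⊗[F] X :=
    DirectSum.component F (Σ k : ℕ, S → Fin k) (fun p => Summand M N p.2 ⊗[F] X) ⟨k, f⟩ ∘ₗ
      (TensorProduct.directSumLeft F F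
        (fun p : (Σ k : ℕ, S → Fin k) => Summand M N p.2) X).toLinearMap
  suffices H : Φ = (cpt f).rTensor X from (LinearMap.congr_fun H t).trans (h k f)
  refine TensorProduct.ext' fun t y => LinearMap.congr_fun (raw_hom_ext
    (φ := Φ ∘ₗ (TensorProduct.mk F (Raw M N S) X).flip y)
    (ψ := (cpt f).rTensor X ∘ₗ (TensorProduct.mk F (Raw M N S) X).flip y) fun k' f' t' => ?_) t
  have h1 : Φ (inc f' t' ⊗ₜ y) = DirectSum.component F (Σ k : ℕ, S → Fin k)
      (fun p => Summand M N p.2 ⊗[F] X) ⟨k, f⟩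
      (DirectSum.lof F (Σ k : ℕ, S → Fin k) (fun p => Summand M N p.2 ⊗[F] X)
        (⟨k', f'⟩ : Σ k : ℕ, S → Fin k) (t' ⊗ₜ[F] y)) :=
    congrArg (DirectSum.component F (Σ k : ℕ, S → Fin k) (fun p => Summand M N p.2 ⊗[F] X) ⟨k, f⟩)
      (TensorProduct.directSumLeft_tmul_lof (M₁ := fun p : (Σ k : ℕ, S → Fin k) => Summand M N p.2)
        (M₂' := X) F F ⟨k', f'⟩ t' y)
  refine h1.trans (Eq.trans ?_ (LinearMap.rTensor_tmul X (cpt f) y (inc f' t')).symm)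
  by_cases hk : (⟨k', f'⟩ : Σ k : ℕ, S → Fin k) = ⟨k, f⟩
  · cases hk
    rw [cpt_inc_same]
    exact DirectSum.of_eq_same _ _
  · rw [cpt_inc_ne _ _ _ hk, TensorProduct.zero_tmul]
    exact DirectSum.of_eq_of_ne _ _ _ (Ne.symm hk)

theorem Gamma.ext_component {t t' : Gamma M V}
    (h : ∀ n, Gamma.component M V n t = Gamma.component M V n t') : t = t' :=
  Subtype.ext (DFinsupp.ext h)

/-- The component of an element of `(M ∘~ N)(S)` in the summand of `f`. -/
def tcpt {S : Type} [Finite S] {k : ℕ} (f : S → Fin k) : (tcomp M N).obj S →ₗ[F] Summand M N f :=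
  cpt f ∘ₗ (invariants M N S).subtype

/-- Over a field, `M ∘~ N ⊗ X` embeds in `Raw M N S ⊗ X`, so its elements are detected by their
components. -/
theorem rTensor_tcpt_eq_zero {S : Type} [Finite S] {X : Type u} [AddCommGroup X] [Module F X]
    (t : (tcomp M N).obj S ⊗[F] X)
    (h : ∀ (k : ℕ) (f : S → Fin k), (tcpt f).rTensor X t = 0) : t = 0 := by
  have hflat : Function.Injective ((invariants M N S).subtype.rTensor X) :=
    Module.Flat.rTensor_preserves_injective_linearMap _ (Submodule.injective_subtype _)
  refine hflat (Eq.trans (rTensor_cpt_eq_zero _ fun k f => ?_) (map_zero _).symm)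
  exact (LinearMap.rTensor_comp_apply X (cpt f) (invariants M N S).subtype t).symm.trans (h k f)

theorem embedLeft_injective : Function.Injective (embedLeft M N V) := by
  rw [injective_iff_map_eq_zero]
  intro u hu
  apply Gamma.ext_component
  intro n
  rw [map_zero]
  apply rTensor_tcpt_eq_zero
  intro k f
  apply distribute_injective f (M.obj (Fin k)) (fun j => N.obj (Fib f j)) (fun _ => V)
  rw [map_zero]
  exact congrFun (congrFun (congrFun hu n) k) f

/-- The associator is determined by the two embeddings in the ambient product. -/
theorem assocGamma_eq {t : Gamma M (Gamma N V)} {u : Gamma (tcomp M N) V}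
    (h : embedLeft M N V u = embedRight M N V t) : assocGamma M N V t = u := by
  rw [assocGamma, LinearMap.comp_apply, ← h]
  exact LinearMap.leftInverse_apply_of_inj (LinearMap.ker_eq_bot.2 embedLeft_injective) u

end Injectivity

/-! ### Components of elements of divided Schur functors -/

section Evaluation

variable {M M' : SymSeq F} {V W : Type u} [AddCommGroup V] [Module F V] [AddCommGroup W] [Module F W]
variable {S T U : Type} [Finite S] [Finite T] [Finite U]

theorem Tens.map_refl (t : Tens M V S) : Tens.map (Equiv.refl S) t = t := by
  suffices H : Tens.map (M := M) (V := V) (Equiv.refl S) = LinearMap.id from LinearMap.congr_fun H t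
  apply Tens.hom_ext
  intro x a
  rw [Tens.map_tmul, M.map_refl]; rfl

theorem Tens.map_trans (e : S ≃ T) (e' : T ≃ U) (t : Tens M V S) :
    Tens.map (e.trans e') t = Tens.map e' (Tens.map e t) := by
  suffices H : Tens.map (M := M) (V := V) (e.trans e') = Tens.map e' ∘ₗ Tens.map e from
    LinearMap.congr_fun H t
  apply Tens.hom_ext
  intro x a
  rw [LinearMap.comp_apply, Tens.map_tmul, Tens.map_tmul, Tens.map_tmul, M.map_trans]; rfl

theorem Tens.hom_tmul (φ : SymSeq.Hom M M') (g : V →ₗ[F] W) (x : M.obj T) (a : T → V) :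
    Tens.hom φ g T (x ⊗ₜ[F] PiTensorProduct.tprod F a) =
      (φ.app T x ⊗ₜ PiTensorProduct.tprod F (fun t => g (a t)) : Tens M' W T) := by
  rw [Tens.hom, TensorProduct.map_tmul, PiTensorProduct.map_tprod]

theorem Gamma.component_of {n : ℕ} (t : Tens M V (Fin n)) (ht) :
    Gamma.component M V n (Gamma.of t ht) = t :=
  DirectSum.of_eq_same _ _

theorem Gamma.component_of_ne {n k : ℕ} (t : Tens M V (Fin n)) (ht) (h : k ≠ n) :
    Gamma.component M V k (Gamma.of t ht) = 0 :=
  DirectSum.of_eq_of_ne _ _ _ h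

theorem Gamma.component_map (φ : SymSeq.Hom M M') (g : V →ₗ[F] W) (t : Gamma M V) (n : ℕ) :
    Gamma.component M' W n (Gamma.map φ g t) = Tens.hom φ g (Fin n) (Gamma.component M V n t) :=
  DirectSum.lmap_apply (fun n => Tens.hom φ g (Fin n)) t.1 n

theorem Gamma.map_comp {M'' : SymSeq F} {W' : Type u} [AddCommGroup W'] [Module F W']
    (φ : SymSeq.Hom M M') (ψ : SymSeq.Hom M' M'') (g : V →ₗ[F] W) (g' : W →ₗ[F] W')
    (t : Gamma M V) :
    Gamma.map ψ g' (Gamma.map φ g t) = Gamma.map (ψ.comp φ) (g' ∘ₗ g) t := by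
  apply Gamma.ext_component
  intro n
  rw [Gamma.component_map, Gamma.component_map, Gamma.component_map]
  suffices H : Tens.hom ψ g' (Fin n) ∘ₗ Tens.hom φ g (Fin n) = Tens.hom (ψ.comp φ) (g' ∘ₗ g) (Fin n)
    from LinearMap.congr_fun H _
  apply Tens.hom_ext
  intro x a
  rw [LinearMap.comp_apply, Tens.hom_tmul, Tens.hom_tmul, Tens.hom_tmul]
  rfl

/-- The component in `M(T) ⊗ V^{⊗ T}` may be computed with any enumeration of `T`. -/
theorem Gamma.eval_eq {n : ℕ} (e : Fin n ≃ T) (t : Gamma M V) :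
    Gamma.eval T t = Tens.map e (Gamma.component M V n t) := by
  obtain rfl : Nat.card T = n := by
    rw [← Nat.card_congr e, Nat.card_eq_fintype_card, Fintype.card_fin]
  have h := t.2 (Nat.card T) (e.trans (Finite.equivFin T))
  have h' : Tens.map (e.trans (Finite.equivFin T)) (Gamma.component M V (Nat.card T) t) =
    Gamma.component M V (Nat.card T) t := h
  rw [Gamma.eval, LinearMap.comp_apply]
  conv_lhs => rw [← h']
  rw [← Tens.map_trans]
  congr 2
  ext; simp

theorem Gamma.eval_fin (n : ℕ) (t : Gamma M V) :
    Gamma.eval (Fin n) t = Gamma.component M V n t := by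
  rw [Gamma.eval_eq (Equiv.refl _), Tens.map_refl]

theorem Gamma.eval_map (φ : SymSeq.Hom M M') (g : V →ₗ[F] W) (t : Gamma M V) :
    Gamma.eval T (Gamma.map φ g t) = Tens.hom φ g T (Gamma.eval T t) := by
  rw [Gamma.eval, LinearMap.comp_apply, Gamma.component_map, ← Tens.hom_map]; rfl

end Evaluation

/-! ### Monomial elements as sums over labellings -/

section Colored

variable {M M' : SymSeq F} {V : Type u} [AddCommGroup V] [Module F V] {n : ℕ} {J : Type}

/-- The value at a partition `g : T → J` of the equivariant family generated by an element
`x ∈ M(n)` fixed by `S_R`: it is the image of `x` under any bijection `Fin n ≃ T` carrying `R`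
to `g`, and `0` if there is none. Since `x` is fixed by `S_R`, the chosen bijection does not matter
(`spread_eq`). With the value `0`, sums over the cosets of `S_R` become sums over all maps `g`. -/
def spread (x : M.obj (Fin n)) (R : Fin n → J) {T : Type} [Finite T] (g : T → J) : M.obj T :=
  if h : ∃ e : Fin n ≃ T, ∀ s, g (e s) = R s then M.map h.choose x else 0

variable {x : M.obj (Fin n)} {R : Fin n → J} {S T : Type} [Finite S] [Finite T]

theorem spread_eq_zero {g : T → J} (h : ∀ e : Fin n ≃ T, ¬ ∀ s, g (e s) = R s) :
    spread x R g = 0 :=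
  dif_neg fun ⟨e, he⟩ => h e he

theorem spread_eq (hx : FixedBy x (partitionGroup R)) {g : T → J} (e : Fin n ≃ T)
    (he : ∀ s, g (e s) = R s) : spread x R g = M.map e x := by
  have h : ∃ e : Fin n ≃ T, ∀ s, g (e s) = R s := ⟨e, he⟩
  rw [spread, dif_pos h]
  have h1 := hx (h.choose.trans e.symm) fun s => by
    rw [← he]
    exact (congrArg g (e.apply_symm_apply _)).trans (h.choose_spec s)
  conv_rhs => rw [← h1]
  rw [← M.map_trans]
  exact congrArg (fun e => M.map e x) (Equiv.ext fun s => (e.apply_symm_apply _).symm)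

/-- The family generated by `x` is equivariant. -/
theorem map_spread (hx : FixedBy x (partitionGroup R)) (e : S ≃ T) (g : T → J) :
    M.map e (spread x R (g ∘ e)) = spread x R g := by
  by_cases h : ∃ e' : Fin n ≃ T, ∀ s, g (e' s) = R s
  · obtain ⟨e', he'⟩ := h
    rw [spread_eq hx e' he', spread_eq hx (e'.trans e.symm) (fun s => by simp [he']),
      ← M.map_trans]
    exact congrArg (fun e => M.map e x) (Equiv.ext fun s => e.apply_symm_apply _)
  · rw [spread_eq_zero (fun e' he' => h ⟨e', he'⟩),
      spread_eq_zero (fun e' he' => h ⟨e'.trans e, he'⟩), map_zero]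

theorem component_beta (hx : FixedBy x (partitionGroup R)) (a : J → V) :
    Gamma.component M V n (beta x R hx a) = cosetSum (Tens.rep M V (Fin n)) (partitionGroup R)
      (x ⊗ₜ[F] PiTensorProduct.tprod F fun i => a (R i)) :=
  Gamma.component_of _ _

theorem component_beta_ne (hx : FixedBy x (partitionGroup R)) (a : J → V) {k : ℕ} (h : k ≠ n) :
    Gamma.component M V k (beta x R hx a) = 0 :=
  Gamma.component_of_ne _ _ h

/-- A coset `σ S_R` corresponds to the map `R ∘ σ⁻¹`, which takes the sum that defines `β_{x,R}(a)`
to a sum over all labellings of the inputs. -/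
theorem Gamma.eval_beta [Fintype (T → J)] (hx : FixedBy x (partitionGroup R)) (a : J → V) :
    Gamma.eval T (beta x R hx a) =
      ∑ g : T → J, (spread x R g ⊗ₜ[F] PiTensorProduct.tprod F (fun t => a (g t)) : Tens M V T) := by
  by_cases hT : ∃ e : Fin n ≃ T, True
  · obtain ⟨e, -⟩ := hT
    rw [Gamma.eval_eq e, component_beta, cosetSum, map_sum]
    have hterm : ∀ σ : Equiv.Perm (Fin n), Tens.map e (Tens.rep M V (Fin n) σ
        (x ⊗ₜ[F] PiTensorProduct.tprod F fun i => a (R i))) =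
        M.map (σ.trans e) x ⊗ₜ[F] PiTensorProduct.tprod F fun t => a (R ((σ.trans e).symm t)) := by
      intro σ
      exact (Tens.map_trans σ e _).symm.trans (Tens.map_tmul (σ.trans e) x _)
    refine Finset.sum_of_injOn (fun c t => R ((c.out.trans e).symm t)) ?_ (by simp) ?_ ?_
    · intro c _ c' _ h
      rw [← QuotientGroup.out_eq' c, ← QuotientGroup.out_eq' c']
      refine QuotientGroup.eq.2 fun s => ?_
      have := congrFun h (e (c'.out s))
      simpa using this
    · intro g _ hg
      rw [spread_eq_zero, TensorProduct.zero_tmul]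
      intro e' he'
      apply hg
      let σ : Equiv.Perm (Fin n) := e'.trans e.symm
      refine ⟨(σ : Equiv.Perm (Fin n) ⧸ partitionGroup R), by simp, ?_⟩
      have h1 : (σ : Equiv.Perm (Fin n) ⧸ partitionGroup R).out⁻¹ * σ ∈ partitionGroup R :=
        QuotientGroup.eq.1 (QuotientGroup.out_eq' _)
      funext t
      have h2 := h1 (e'.symm t)
      simp only [Equiv.Perm.mul_apply] at h2
      rw [← e'.apply_symm_apply t, he', ← h2]
      simp [σ]
    · intro c _
      rw [hterm, spread_eq hx (c.out.trans e) (fun s => by rw [Equiv.symm_apply_apply])]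
  · have hT' : ∀ e : Fin n ≃ T, False := fun e => hT ⟨e, trivial⟩
    rw [Finset.sum_eq_zero fun g _ => by
      rw [spread_eq_zero (fun e => (hT' e).elim), TensorProduct.zero_tmul]]
    rw [Gamma.eval, LinearMap.comp_apply, component_beta_ne, map_zero]
    rintro rfl
    exact hT' (Finite.equivFin T).symm

end Colored

/-! ### Components and naturality of the trace map -/

section Trace

variable {M N M' N' : SymSeq F} {S K : Type} [Finite S] [Finite K]

/-- The component of the trace at a decomposition `f` isomorphic to `f₀`. The condition on `f₀` says
that only one term of the trace contributes; it holds if `f₀` is surjective. -/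
theorem tcpt_trace_mk {f₀ : S → K} (hf₀ : ∀ τ : Equiv.Perm K, (∀ s, τ (f₀ s) = f₀ s) → τ = 1)
    {k : ℕ} (f : S → Fin k) (e : K ≃ Fin k) (h : ∀ s, f s = e (f₀ s)) (t : Summand M N f₀) :
    tcpt f ((trace M N).app S (mk f₀ t)) = Summand.map (Equiv.refl S) e h t := by
  rw [mk_eq f₀ e f h]
  change cpt f (rawTrace M N S (inc f _)) = _
  rw [rawTrace_inc, map_sum, Finset.sum_eq_single 1]
  · exact (cpt_inc_same f _).trans (Summand.map_refl _ _)
  · intro τ _ hτ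
    refine cpt_inc_ne' _ _ _ fun h' => hτ ?_
    have h1 : (e.trans τ).trans e.symm = 1 := hf₀ _ fun s => by
      have := congrFun h' s
      rw [Function.comp_apply, h] at this
      simp [this]
    ext j
    have := Equiv.congr_fun h1 (e.symm j)
    simp only [Equiv.trans_apply, Equiv.apply_symm_apply, Equiv.Perm.one_apply,
      EmbeddingLike.apply_eq_iff_eq] at this
    rw [this]; rfl
  · simp

theorem tcpt_trace_mk_eq_zero {f₀ : S → K} {k : ℕ} {f : S → Fin k}
    (h : ∀ e : K ≃ Fin k, ¬ ∀ s, f s = e (f₀ s)) (t : Summand M N f₀) :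
    tcpt f ((trace M N).app S (mk f₀ t)) = 0 := by
  change cpt f (rawTrace M N S (inc (Finite.equivFin K ∘ f₀) _)) = 0
  rw [rawTrace_inc, map_sum]
  refine Finset.sum_eq_zero fun τ _ => cpt_inc_ne _ _ _ fun h' => ?_
  obtain ⟨rfl, h'⟩ := Sigma.mk.inj_iff.1 h'
  exact h ((Finite.equivFin K).trans τ) fun s => (congrFun (eq_of_heq h') s).symm

theorem tcpt_map (φ : SymSeq.Hom M M') (ψ : SymSeq.Hom N N') {k : ℕ} (f : S → Fin k)
    (w : (tcomp M N).obj S) :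
    tcpt f ((tcomp.map φ ψ).app S w) = Summand.hom φ ψ f (tcpt f w) :=
  cpt_rawHom φ ψ f w.1

/-- The trace map is natural. -/
theorem trace_map (φ : SymSeq.Hom M M') (ψ : SymSeq.Hom N N') (w : (comp M N).obj S) :
    (trace M' N').app S ((comp.map φ ψ).app S w) =
      (tcomp.map φ ψ).app S ((trace M N).app S w) := by
  obtain ⟨t, rfl⟩ := Submodule.mkQ_surjective _ w
  refine Subtype.ext ?_
  change rawTrace M' N' S (rawHom φ ψ S t) = rawHom φ ψ S (rawTrace M N S t)
  refine raw_ext fun k f => ?_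
  rw [cpt_rawTrace, cpt_rawHom, cpt_rawTrace, map_sum]
  refine Finset.sum_congr rfl fun τ _ => ?_
  rw [cpt_rawHom, Summand.hom_act]

theorem traceInv_trace (hN : N.Reduced) (w : (comp M N).obj S) :
    (traceInv M hN).app S ((trace M N).app S w) = w :=
  LinearEquiv.ofBijective_symm_apply_apply ((trace M N).app S) w

end Trace

/-! ### Naturality of the associator -/

section AssociatorNaturality

variable {M N M' N' : SymSeq F} {V : Type u} [AddCommGroup V] [Module F V]

/-- The map on the components of the ambient product induced by `M → M'` and `N → N'`. -/
def ambientHom {S K : Type} [Finite S] [Finite K] (φ : SymSeq.Hom M M')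
    (ψ : SymSeq.Hom N N') (f : S → K) :
    M.obj K ⊗[F] (⨂[F] j, Tens N V (Fib f j)) →ₗ[F]
      M'.obj K ⊗[F] (⨂[F] j, Tens N' V (Fib f j)) :=
  TensorProduct.map (φ.app K) (PiTensorProduct.map fun j => Tens.hom ψ LinearMap.id (Fib f j))

theorem ambientHom_tmul {S K : Type} [Finite S] [Finite K] (φ : SymSeq.Hom M M')
    (ψ : SymSeq.Hom N N') (f : S → K) (x : M.obj K) (y : ∀ j, Tens N V (Fib f j)) :
    ambientHom φ ψ f (x ⊗ₜ PiTensorProduct.tprod F y) =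
      φ.app K x ⊗ₜ PiTensorProduct.tprod F fun j => Tens.hom ψ LinearMap.id (Fib f j) (y j) := by
  rw [ambientHom, TensorProduct.map_tmul, PiTensorProduct.map_tprod]

/-- The map `distribute` with fixed vectors `aₛ`, attached to the inputs. -/
def decorate {S K : Type} [Finite S] [Finite K] (f : S → K) (a : S → V) :
    Summand M N f →ₗ[F] M.obj K ⊗[F] (⨂[F] j, Tens N V (Fib f j)) :=
  distribute f (M.obj K) (fun j => N.obj (Fib f j)) (fun _ => V) ∘ₗ
    (TensorProduct.mk F (Summand M N f) (⨂[F] _ : S, V)).flip (PiTensorProduct.tprod F a)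

theorem decorate_pureT {S K : Type} [Finite S] [Finite K] (f : S → K) (a : S → V) (x : M.obj K)
    (y : ∀ j, N.obj (Fib f j)) :
    decorate f a (pureT M N f x y) = x ⊗ₜ PiTensorProduct.tprod F fun j =>
      (y j ⊗ₜ PiTensorProduct.tprod F fun s : Fib f j => a s.1 : Tens N V (Fib f j)) := by
  have h : decorate f a (pureT M N f x y) = distribute (F := F) f (M.obj K)
      (fun j => N.obj (Fib f j)) (fun _ => V) (pureT M N f x y ⊗ₜ PiTensorProduct.tprod F a) := rfl
  have h' := distribute_tmul (F := F) f (M.obj K) (fun j => N.obj (Fib f j)) (fun _ => V) x y a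
  rw [h, pureT]
  exact h'

theorem decorate_hom {S K : Type} [Finite S] [Finite K] (φ : SymSeq.Hom M M')
    (ψ : SymSeq.Hom N N') (f : S → K) (a : S → V) (c : Summand M N f) :
    decorate f a (Summand.hom φ ψ f c) = ambientHom φ ψ f (decorate f a c) := by
  suffices H : decorate f a ∘ₗ Summand.hom φ ψ f = ambientHom φ ψ f ∘ₗ decorate f a from
    LinearMap.congr_fun H c
  apply Summand.hom_ext
  intro x y
  rw [LinearMap.comp_apply, LinearMap.comp_apply, Summand.hom_pureT, decorate_pureT,
    decorate_pureT, ambientHom_tmul]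
  congr 2
  funext j
  exact (Tens.hom_tmul ψ LinearMap.id (y j) _).symm

variable (M N V) in
/-- The component of `embedLeft` at `f`, as a map defined on `(M ∘~ N)(n) ⊗ V^{⊗ n}`. -/
def splitAt {n k : ℕ} (f : Fin n → Fin k) : Tens (tcomp M N) V (Fin n) →ₗ[F]
    M.obj (Fin k) ⊗[F] (⨂[F] j, Tens N V (Fib f j)) :=
  distribute f (M.obj (Fin k)) (fun j => N.obj (Fib f j)) (fun _ => V) ∘ₗ
    (tcpt f).rTensor (⨂[F] _ : Fin n, V)

theorem splitAt_tmul {n k : ℕ} (f : Fin n → Fin k) (w : (tcomp M N).obj (Fin n)) (a : Fin n → V) :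
    splitAt M N V f (w ⊗ₜ PiTensorProduct.tprod F a) = decorate f a (tcpt f w) := rfl

theorem embedLeft_eq_splitAt (u : Gamma (tcomp M N) V) {n k : ℕ} (f : Fin n → Fin k) :
    embedLeft M N V u n k f = splitAt M N V f (Gamma.component (tcomp M N) V n u) := rfl

variable (M N V) in
/-- The component of `embedRight` at `f`, as a map defined on `M(k) ⊗ (N ∘~ V)^{⊗ k}`. -/
def evalAt {n k : ℕ} (f : Fin n → Fin k) : Tens M (Gamma N V) (Fin k) →ₗ[F]
    M.obj (Fin k) ⊗[F] (⨂[F] j, Tens N V (Fib f j)) :=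
  (PiTensorProduct.map fun j => Gamma.eval (Fib f j)).lTensor (M.obj (Fin k))

theorem evalAt_tmul {n k : ℕ} (f : Fin n → Fin k) (x : M.obj (Fin k)) (b : Fin k → Gamma N V) :
    evalAt M N V f (x ⊗ₜ PiTensorProduct.tprod F b) =
      x ⊗ₜ PiTensorProduct.tprod F fun j => Gamma.eval (Fib f j) (b j) := by
  rw [evalAt, LinearMap.lTensor_tmul, PiTensorProduct.map_tprod]

theorem embedRight_eq_evalAt (t : Gamma M (Gamma N V)) {n k : ℕ} (f : Fin n → Fin k) :
    embedRight M N V t n k f = evalAt M N V f (Gamma.component M (Gamma N V) k t) := rfl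

theorem embedLeft_map (φ : SymSeq.Hom M M') (ψ : SymSeq.Hom N N') (u : Gamma (tcomp M N) V)
    {n k : ℕ} (f : Fin n → Fin k) :
    embedLeft M' N' V (Gamma.map (tcomp.map φ ψ) LinearMap.id u) n k f =
      ambientHom φ ψ f (embedLeft M N V u n k f) := by
  rw [embedLeft_eq_splitAt, embedLeft_eq_splitAt, Gamma.component_map]
  generalize Gamma.component (tcomp M N) V n u = t
  suffices H : splitAt M' N' V f ∘ₗ Tens.hom (tcomp.map φ ψ) LinearMap.id (Fin n) =
      ambientHom φ ψ f ∘ₗ splitAt M N V f from LinearMap.congr_fun H t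
  apply Tens.hom_ext
  intro w a
  rw [LinearMap.comp_apply, LinearMap.comp_apply, Tens.hom_tmul, splitAt_tmul, splitAt_tmul,
    tcpt_map]
  exact decorate_hom φ ψ f a _

theorem embedRight_map (φ : SymSeq.Hom M M') (ψ : SymSeq.Hom N N') (t : Gamma M (Gamma N V))
    {n k : ℕ} (f : Fin n → Fin k) :
    embedRight M' N' V (Gamma.map φ (Gamma.map ψ LinearMap.id) t) n k f =
      ambientHom φ ψ f (embedRight M N V t n k f) := by
  rw [embedRight_eq_evalAt, embedRight_eq_evalAt, Gamma.component_map]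
  generalize Gamma.component M (Gamma N V) k t = t
  suffices H : evalAt M' N' V f ∘ₗ Tens.hom φ (Gamma.map ψ LinearMap.id) (Fin k) =
      ambientHom φ ψ f ∘ₗ evalAt M N V f from LinearMap.congr_fun H t
  apply Tens.hom_ext
  intro x b
  rw [LinearMap.comp_apply, LinearMap.comp_apply, Tens.hom_tmul, evalAt_tmul, evalAt_tmul,
    ambientHom_tmul]
  simp only [Gamma.eval_map]

/-- The associator is natural at every element where the images of the two embeddings are known
to match. -/
theorem assocGamma_map (φ : SymSeq.Hom M M') (ψ : SymSeq.Hom N N') {t : Gamma M (Gamma N V)}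
    {u : Gamma (tcomp M N) V} (h : embedLeft M N V u = embedRight M N V t) :
    assocGamma M' N' V (Gamma.map φ (Gamma.map ψ LinearMap.id) t) =
      Gamma.map (tcomp.map φ ψ) LinearMap.id u := by
  apply assocGamma_eq
  funext n k f
  rw [embedLeft_map, embedRight_map, h]

end AssociatorNaturality

/-! ### The morphisms given by elements of arity one -/

section UnitMorphisms

variable {M N : SymSeq F}

theorem symOuter_eq {S : Type} [Finite S] (u : M.obj (Fin 1)) (y : N.obj S) :
    symOuter u y = sym (fun _ : S => (0 : Fin 1)) u
      (Function.update 0 0 (N.map (constFib S 0) y)) := by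
  rw [symOuter]
  congr 1
  funext k
  obtain rfl : k = 0 := Subsingleton.elim _ _
  rw [Function.update_self]

/-- The morphism `N → M ∘ N`, `y ↦ (u; y)`, given by an element `u ∈ M(1)`. -/
def outerHom (u : M.obj (Fin 1)) (N : SymSeq F) : SymSeq.Hom N (comp M N) where
  app S _ :=
    { toFun := fun y => symOuter u y
      map_add' := fun y y' => by
        simp only [symOuter_eq, map_add]
        exact (isLinearMap_sym _ _ _ _).map_add _ _
      map_smul' := fun c y => by
        simp only [symOuter_eq, map_smul]
        exact (isLinearMap_sym _ _ _ _).map_smul _ _ }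
  naturality {S T} _ _ e y := by
    refine (sym_map (M := M) (N := N) (f := fun _ => 0) (f' := fun _ => 0) e (Equiv.refl (Fin 1))
      (fun _ => rfl) (M.map_refl u).symm fun k => ?_).symm
    refine (N.map_trans _ _ _).symm.trans (Eq.trans ?_ (N.map_trans _ _ _))
    rfl

/-- The morphism `M → M ∘ N`, `x ↦ (x; u, …, u)`, given by an element `u ∈ N(1)`. -/
def innerHom (M : SymSeq F) (u : N.obj (Fin 1)) : SymSeq.Hom M (comp M N) where
  app S _ := symL (id : S → S) (fun s => N.map (idFib s) u)
  naturality {S T} _ _ e x := by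
    refine (sym_map e e (fun _ => rfl) rfl fun k => ?_).symm
    refine Eq.trans ?_ (N.map_trans _ _ _)
    exact congrArg (fun e => N.map e u) (Equiv.ext fun _ => rfl)

theorem outerHom_app {S : Type} [Finite S] (u : M.obj (Fin 1)) (y : N.obj S) :
    (outerHom u N).app S y = symOuter u y := rfl

theorem innerHom_app {S : Type} [Finite S] (u : N.obj (Fin 1)) (x : M.obj S) :
    (innerHom M u).app S x = symInner x u := rfl

end UnitMorphisms

/-! ### The associator on units -/

section UnitAssociators

variable {M N : SymSeq F} {P : Operad F} {V : Type u} [AddCommGroup V] [Module F V]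

theorem Gamma.component_unit (v : V) :
    Gamma.component P.toSymSeq V 1 (Gamma.unit P V v) =
      P.one ⊗ₜ[F] PiTensorProduct.tprod F (fun _ => v) :=
  DirectSum.of_eq_same (β := fun n => Tens P.toSymSeq V (Fin n)) 1 _

theorem Gamma.component_unit_ne (v : V) {k : ℕ} (h : k ≠ 1) :
    Gamma.component P.toSymSeq V k (Gamma.unit P V v) = 0 :=
  DirectSum.of_eq_of_ne (β := fun n => Tens P.toSymSeq V (Fin n)) _ _ _ h

theorem Gamma.eval_unit {T : Type} [Finite T] (e : Fin 1 ≃ T) (v : V) :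
    Gamma.eval T (Gamma.unit P V v) =
      (P.map e P.one ⊗ₜ[F] PiTensorProduct.tprod F (fun _ => v) : Tens P.toSymSeq V T) := by
  rw [Gamma.eval_eq e, Gamma.component_unit, Tens.map_tmul]

theorem Gamma.eval_unit_eq_zero {T : Type} [Finite T] (h : IsEmpty (Fin 1 ≃ T)) (v : V) :
    Gamma.eval T (Gamma.unit P V v) = 0 := by
  rw [Gamma.eval, LinearMap.comp_apply, Gamma.component_unit_ne, map_zero]
  intro h1
  exact h.false ((finCongr h1.symm).trans (Finite.equivFin T).symm)

/-- The associator identifies `η ∘~ Z` with the map `N ∘~ V → (P ∘~ N) ∘~ V` given by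
`y ↦ (1; y)`. -/
theorem assocGamma_unit (z : Gamma N V) :
    assocGamma P.toSymSeq N V (Gamma.unit P (Gamma N V) z) =
      Gamma.map ((trace P.toSymSeq N).comp (outerHom P.one N)) LinearMap.id z := by
  apply assocGamma_eq
  funext n k f
  rw [embedLeft_eq_splitAt, embedRight_eq_evalAt, Gamma.component_map]
  by_cases hk : k = 1
  · subst hk
    obtain rfl : f = fun _ => 0 := funext fun _ => Subsingleton.elim _ _
    rw [Gamma.component_unit, evalAt_tmul]
    have h0 : (fun j => Gamma.eval (Fib (fun _ : Fin n => (0 : Fin 1)) j) z) =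
        Function.update (fun _ => 0) 0 (Tens.map (constFib (Fin n) 0) (Gamma.component N V n z)) := by
      funext j
      obtain rfl : j = 0 := Subsingleton.elim _ _
      rw [Function.update_self, Gamma.eval_eq (constFib (Fin n) 0)]
    rw [h0]
    generalize Gamma.component N V n z = t
    suffices H : splitAt P.toSymSeq N V (fun _ => 0) ∘ₗ
        Tens.hom ((trace P.toSymSeq N).comp (outerHom P.one N)) LinearMap.id (Fin n) =
        TensorProduct.mk F (P.obj (Fin 1)) _ P.one ∘ₗ
        (PiTensorProduct.tprod F (s := fun j : Fin 1 =>
          Tens N V (Fib (fun _ : Fin n => (0 : Fin 1)) j))).toLinearMap (fun _ => 0) 0 ∘ₗ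
        Tens.map (constFib (Fin n) 0) from
      LinearMap.congr_fun H t
    apply Tens.hom_ext
    intro x a
    rw [LinearMap.comp_apply, LinearMap.comp_apply, LinearMap.comp_apply, Tens.hom_tmul,
      splitAt_tmul, Tens.map_tmul]
    have h1 : tcpt (fun _ => 0) (((trace P.toSymSeq N).comp (outerHom P.one N)).app (Fin n) x) =
        pureT P.toSymSeq N (fun _ => 0) P.one (fun k => N.map (constFib (Fin n) k) x) := by
      refine (tcpt_trace_mk (fun τ _ => Subsingleton.elim _ _) (fun _ => 0) (Equiv.refl _)
        (fun _ => rfl) _).trans (Summand.map_refl _ _)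
    rw [h1, decorate_pureT]
    refine congrArg (fun y => P.one ⊗ₜ PiTensorProduct.tprod F y) (funext fun j => ?_)
    obtain rfl : j = 0 := Subsingleton.elim _ _
    rw [Function.update_self]
    rfl
  · rw [Gamma.component_unit_ne _ hk, map_zero]
    generalize Gamma.component N V n z = t
    suffices H : splitAt P.toSymSeq N V f ∘ₗ
        Tens.hom ((trace P.toSymSeq N).comp (outerHom P.one N)) LinearMap.id (Fin n) = 0 from
      LinearMap.congr_fun H t
    apply Tens.hom_ext
    intro x a
    rw [LinearMap.comp_apply, Tens.hom_tmul, splitAt_tmul]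
    have h1 : tcpt f (((trace P.toSymSeq N).comp (outerHom P.one N)).app (Fin n) x) = 0 :=
      tcpt_trace_mk_eq_zero (fun e _ => hk (by simpa using (Fintype.card_congr e).symm)) _
    rw [h1, map_zero]; rfl

/-- The associator identifies `M ∘~ η` with the map `M ∘~ V → (M ∘~ P) ∘~ V` given by
`x ↦ (x; 1, …, 1)`. -/
theorem assocGamma_map_unit (z : Gamma M V) :
    assocGamma M P.toSymSeq V (Gamma.map (SymSeq.Hom.id M) (Gamma.unit P V) z) =
      Gamma.map ((trace M P.toSymSeq).comp (innerHom M P.one)) LinearMap.id z := by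
  apply assocGamma_eq
  funext n k f
  rw [embedLeft_eq_splitAt, embedRight_eq_evalAt, Gamma.component_map, Gamma.component_map]
  by_cases hf : Function.Bijective f
  · let e : Fin n ≃ Fin k := Equiv.ofBijective f hf
    rw [← Gamma.eval_fin k, Gamma.eval_eq e]
    generalize Gamma.component M V n z = t
    suffices H : splitAt M P.toSymSeq V f ∘ₗ
        Tens.hom ((trace M P.toSymSeq).comp (innerHom M P.one)) LinearMap.id (Fin n) =
        evalAt M P.toSymSeq V f ∘ₗ Tens.hom (SymSeq.Hom.id M) (Gamma.unit P V) (Fin k) ∘ₗ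
        Tens.map e from LinearMap.congr_fun H t
    apply Tens.hom_ext
    intro x a
    rw [LinearMap.comp_apply, LinearMap.comp_apply, LinearMap.comp_apply, Tens.hom_tmul,
      splitAt_tmul, Tens.map_tmul, Tens.hom_tmul, evalAt_tmul]
    have he : ∀ s, f (Equiv.refl (Fin n) s) = e (id s) := fun _ => rfl
    have h1 : tcpt f (((trace M P.toSymSeq).comp (innerHom M P.one)).app (Fin n) x) =
        pureT M P.toSymSeq f (M.map e x)
          (push (Equiv.refl _) e he fun s => P.map (idFib s) P.one) :=
      (tcpt_trace_mk (fun τ h => Equiv.ext h) f e he _).trans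
        (Summand.map_pureT _ _ he _ _)
    rw [h1, decorate_pureT]
    refine congrArg (fun y => M.map e x ⊗ₜ PiTensorProduct.tprod F y) (funext fun j => ?_)
    obtain ⟨i, rfl⟩ := e.surjective j
    rw [push_apply, ← P.map_trans, Equiv.symm_apply_apply]
    refine Eq.trans ?_ (Gamma.eval_unit ((idFib (id i)).trans
      (Fib.congr (Equiv.refl _) fun _ => hf.1.eq_iff.symm)) (a i)).symm
    refine congrArg (fun b => (P.map _ P.one ⊗ₜ PiTensorProduct.tprod F b :
      Tens P.toSymSeq V (Fib f (e i)))) (funext fun s => ?_)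
    exact congrArg a (hf.1 s.2)
  · generalize Gamma.component M V n z = t
    generalize Gamma.component M V k z = t'
    have h1 : splitAt M P.toSymSeq V f ∘ₗ
        Tens.hom ((trace M P.toSymSeq).comp (innerHom M P.one)) LinearMap.id (Fin n) = 0 := by
      apply Tens.hom_ext
      intro x a
      rw [LinearMap.comp_apply, Tens.hom_tmul, splitAt_tmul]
      have h1 : tcpt f (((trace M P.toSymSeq).comp (innerHom M P.one)).app (Fin n) x) = 0 :=
        tcpt_trace_mk_eq_zero (fun e he => hf (by
          rw [show f = e from funext he]; exact e.bijective)) _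
      rw [h1, map_zero]; rfl
    have h2 : evalAt M P.toSymSeq V f ∘ₗ
        Tens.hom (SymSeq.Hom.id M) (Gamma.unit P V) (Fin k) = 0 := by
      apply Tens.hom_ext
      intro x a
      rw [LinearMap.comp_apply, Tens.hom_tmul, evalAt_tmul]
      -- A map all of whose fibres have one element is bijective.
      have h3 : ∃ j, IsEmpty (Fin 1 ≃ Fib f j) := by
        by_contra! h
        refine hf ⟨fun s s' hs => ?_, fun j => ?_⟩
        · obtain ⟨e⟩ := h (f s)
          have := e.symm.injective.subsingleton
          exact congrArg Subtype.val (Subsingleton.elim (⟨s, rfl⟩ : Fib f (f s)) ⟨s', hs.symm⟩)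
        · obtain ⟨e⟩ := h j
          exact ⟨(e 0).1, (e 0).2⟩
      obtain ⟨j, hj⟩ := h3
      have h4 := MultilinearMap.map_coord_zero (m := fun j => Gamma.eval (Fib f j)
        (Gamma.unit P V (a j))) (PiTensorProduct.tprod F) j (Gamma.eval_unit_eq_zero hj _)
      rw [h4, TensorProduct.tmul_zero]; rfl
    exact (LinearMap.congr_fun h1 t).trans (LinearMap.congr_fun h2 t').symm

end UnitAssociators

/-! ### The multiplication of `P ∘ Q` on units -/

section DistributiveLawOnUnits

variable {A B C M N M' N' : SymSeq F} {S K : Type} [Finite S] [Finite K]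

/-- The value of the associator on generators, with arbitrary finite index sets. -/
theorem assoc_sym_finite {n : K → Type} [∀ j, Finite (n j)] (f : S → K) (p : ∀ j, Fib f j → n j)
    (x : A.obj K) (y : ∀ j, B.obj (n j)) (z : ∀ j i, C.obj (Fib (p j) i)) :
    (assoc A B C).app S (sym (M := A) (N := comp B C) f x fun j => sym (p j) (y j) (z j)) =
      assocL f p y z x := by
  let ε := fun j => Finite.equivFin (n j)
  have hp : ∀ j s, (ε j ∘ p j) s = ε j (p j s) := fun _ _ => rfl
  let g : ∀ j, Gen B C (Fib f j) := fun j =>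
    ⟨⟨_, ε j ∘ p j⟩, B.map (ε j) (y j), push (Equiv.refl _) (ε j) (hp j) (z j)⟩
  have hg : (fun j => sym (p j) (y j) (z j)) = fun j => (g j).toComp := funext fun j =>
    sym_perm (ε j) (hp j) rfl fun i => push_apply _ _ (hp j) _ _
  rw [hg]
  refine (assoc_sym f x g).trans ?_
  have h := assocL_map (A := A) (Equiv.refl S) (Equiv.refl K) (f := f) (f' := f) (fun _ => rfl)
    (n := n) (n' := fun j => Fin (g j).1.1) (ε := ε) (p := p) (p' := fun j => (g j).1.2)
    (fun j s => rfl) (y := y) (y' := fun j => (g j).2.1) (fun j => rfl)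
    (z := z) (z' := fun j => (g j).2.2) (fun j i => push_apply _ _ (hp j) _ _) x
  rw [A.map_refl] at h
  exact h.symm.trans ((comp (comp A B) C).map_refl _)

theorem comp.map_symOuter (φ : SymSeq.Hom M M') (ψ : SymSeq.Hom N N') (u : M.obj (Fin 1))
    (y : N.obj S) : (comp.map φ ψ).app S (symOuter u y) = symOuter (φ.app _ u) (ψ.app S y) := by
  rw [symOuter, comp.map_sym, symOuter]
  simp only [ψ.naturality]

theorem comp.map_symInner (φ : SymSeq.Hom M M') (ψ : SymSeq.Hom N N') (x : M.obj S)
    (u : N.obj (Fin 1)) :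
    (comp.map φ ψ).app S (symInner x u) = symInner (φ.app S x) (ψ.app _ u) := by
  rw [symInner, comp.map_sym, symInner]
  simp only [ψ.naturality]

theorem assocInv_symOuter (f : S → K) (u : A.obj (Fin 1)) (x : B.obj K)
    (z : ∀ k, C.obj (Fib f k)) :
    (assocInv A B C).app S (sym (M := comp A B) f (symOuter u x) z) =
      symOuter (N := comp B C) u (sym f x z) := by
  rw [symOuter, assocInv_sym, symOuter]
  congr 1
  funext i
  refine (sym_map (constFib S i) (constFib K i) (fun _ => rfl) rfl fun k => ?_).symm
  exact congrArg (fun e => C.map e (z k)) (Equiv.ext fun _ => rfl)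

theorem assocInv_symInner (g : S → K) (x : A.obj K) (y : ∀ k, B.obj (Fib g k))
    (u : C.obj (Fin 1)) :
    (assocInv A B C).app S (symInner (M := comp A B) (sym g x y) u) =
      sym (N := comp B C) g x fun k => symInner (y k) u := by
  rw [symInner, assocInv_sym]
  congr 1
  funext k
  refine sym_eq (f' := id) rfl fun s => ?_
  rw [← C.map_trans]
  refine Eq.trans ?_ (C.map_trans _ _ u)
  exact congrArg (fun e => C.map e u) (Equiv.ext fun _ => rfl)

theorem assoc_symInner (f : S → K) (x : A.obj K) (y : ∀ k, B.obj (Fib f k)) (u : C.obj (Fin 1)) :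
    (assoc A B C).app S (sym (N := comp B C) f x fun k => symInner (y k) u) =
      symInner (M := comp A B) (sym f x y) u := by
  refine (assoc_sym_finite f (fun _ => id) x y _).trans ?_
  refine sym_perm (Equiv.sigmaFiberEquiv f) (fun _ => rfl) ?_ ?_
  · refine (sym_map (Equiv.sigmaFiberEquiv f) (Equiv.refl K) ?_ (A.map_refl x).symm ?_).symm
    · rintro ⟨k, s⟩; exact s.2
    · intro k
      rw [← B.map_trans]
      exact (B.map_refl _).symm.trans (congrArg (fun e => B.map e (y k)) (Equiv.ext fun _ => rfl))
  · rintro ⟨k, s⟩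
    rw [← C.map_trans, ← C.map_trans]
    exact congrArg (fun e => C.map e u) (Equiv.ext fun _ => Subtype.ext rfl)

theorem assoc_symOuter (g : S → K) (u : A.obj (Fin 1)) (x : B.obj K)
    (z : ∀ k, C.obj (Fib g k)) :
    (assoc A B C).app S (symOuter (N := comp B C) u (sym g x z)) =
      sym (M := comp A B) g (symOuter u x) z := by
  have h : ∀ j, (comp B C).map (constFib S j) (sym g x z) =
      sym (fun s : Fib (fun _ : S => (0 : Fin 1)) j => g s.1) x fun k =>
        C.map (Fib.congr (constFib S j) fun _ => Iff.rfl) (z k) := fun j =>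
    sym_map (constFib S j) (Equiv.refl K) (fun _ => rfl) (B.map_refl x).symm fun k => rfl
  rw [symOuter]
  simp only [h]
  refine (assoc_sym_finite (fun _ => 0) (fun j s => g s.1) u (fun _ => x) _).trans ?_
  refine sym_perm (Equiv.uniqueProd K (Fin 1) |> (Equiv.sigmaEquivProd (Fin 1) K).trans)
    (fun _ => rfl) ?_ ?_
  · refine (sym_map _ (Equiv.refl (Fin 1)) (fun _ => Subsingleton.elim _ _) (A.map_refl u).symm
      fun k => ?_).symm
    rw [← B.map_trans]
    exact congrArg (fun e => B.map e x) (Equiv.ext fun _ => Subtype.ext rfl)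
  · rintro ⟨j, k⟩
    rw [← C.map_trans]
    refine Eq.trans ?_ (C.map_trans _ _ (z k))
    exact (C.map_refl _).symm.trans (congrArg (fun e => C.map e (z k)) (Equiv.ext fun _ => rfl))

variable {P Q : Operad F}

/-- The multiplication of `P ∘ Q` sends `((1; x); (y₁; 1, …), …)` to `Λ(x; y₁, …)`. -/
theorem mul_outer_inner (Λ : DistributiveLaw P Q) :
    Λ.mul.comp (comp.map (outerHom P.one Q.toSymSeq) (innerHom P.toSymSeq Q.one)) = Λ.law := by
  -- After `Λ` has been applied to `(x; y₁, …)`, what remains is the identity, by the unit axioms.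
  have key : ∀ {S : Type} [Finite S] (w : (comp P.toSymSeq Q.toSymSeq).obj S),
      (comp.map P.mul Q.mul).app S ((assoc P.toSymSeq P.toSymSeq (comp Q.toSymSeq Q.toSymSeq)).app S
        (symOuter P.one ((assocInv P.toSymSeq Q.toSymSeq Q.toSymSeq).app S (symInner w Q.one)))) =
      w := by
    intro S _ w
    suffices H : (comp.map P.mul Q.mul).app S ∘ₗ
        (assoc P.toSymSeq P.toSymSeq (comp Q.toSymSeq Q.toSymSeq)).app S ∘ₗ
        (outerHom P.one _).app S ∘ₗ (assocInv P.toSymSeq Q.toSymSeq Q.toSymSeq).app S ∘ₗ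
        (innerHom _ Q.one).app S = LinearMap.id from LinearMap.congr_fun H w
    apply comp_hom_ext
    intro k g x y
    simp only [LinearMap.comp_apply, outerHom_app, innerHom_app, LinearMap.id_apply]
    rw [assocInv_symInner, assoc_symOuter, comp.map_sym, P.one_mul]
    simp only [Q.mul_one]
  refine SymSeq.Hom.ext (funext fun S => funext fun _ => ?_)
  apply comp_hom_ext
  intro k f x y
  refine Eq.trans ?_ (key (Λ.law.app S (sym f x y)))
  change Λ.mul.app S ((comp.map _ _).app S (sym f x y)) = _
  rw [comp.map_sym]
  simp only [outerHom_app, innerHom_app]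
  change (comp.map P.mul Q.mul).app S ((assoc P.toSymSeq P.toSymSeq _).app S
    ((comp.map _ _).app S ((assocInv P.toSymSeq Q.toSymSeq _).app S _))) = _
  rw [assocInv_symOuter, comp.map_symOuter]
  change (comp.map P.mul Q.mul).app S ((assoc P.toSymSeq P.toSymSeq _).app S
    (symOuter P.one ((assocInv P.toSymSeq Q.toSymSeq Q.toSymSeq).app S ((comp.map Λ.law _).app S
      ((assoc Q.toSymSeq P.toSymSeq Q.toSymSeq).app S _))))) = _
  rw [assoc_symInner, comp.map_symInner]
  rfl

end DistributiveLawOnUnits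

/-! ### The distributive law as a map induced by `Λ` -/

section Reduction

variable {P Q : Operad F} {V : Type u} [AddCommGroup V] [Module F V]

/-- The units and the three associators together amount to inserting `x ↦ (1; x)` and
`y ↦ (y; 1, …, 1)` in the element `u` which corresponds to `t` under one associator. -/
theorem tildeAssoc_tildeUnits {t : Gamma Q.toSymSeq (Gamma P.toSymSeq V)}
    {u : Gamma (tcomp Q.toSymSeq P.toSymSeq) V} (h : embedLeft _ _ V u = embedRight _ _ V t) :
    tildeAssoc V P.toSymSeq Q.toSymSeq (tildeUnits P Q V t) =
      Gamma.map (tcomp.map ((trace P.toSymSeq Q.toSymSeq).comp (outerHom P.one Q.toSymSeq))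
        ((trace P.toSymSeq Q.toSymSeq).comp (innerHom P.toSymSeq Q.one))) LinearMap.id u := by
  rw [← assocGamma_map _ _ h, tildeAssoc, tildeUnits, LinearMap.comp_apply, LinearMap.comp_apply,
    LinearMap.comp_apply, assocGamma_unit, Gamma.map_comp, Gamma.map_comp]
  have hlin : (assocGamma P.toSymSeq Q.toSymSeq V ∘ₗ LinearMap.id) ∘ₗ
      Gamma.map (SymSeq.Hom.id P.toSymSeq) (Gamma.unit Q V) =
      Gamma.map ((trace P.toSymSeq Q.toSymSeq).comp (innerHom P.toSymSeq Q.one)) LinearMap.id :=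
    LinearMap.ext assocGamma_map_unit
  rw [hlin]
  rfl

/-- The composite of the first maps in the definition of `Λ̃`, up to the multiplication of `P ∘ Q`,
is induced by `Λ`, if `u` in `(Q ∘ P) ∘~ V` corresponds to `t` under the trace and the associator. -/
theorem tildeMul_tildeAssoc_tildeUnits (Λ : DistributiveLaw P Q) (hP : P.Reduced) (hQ : Q.Reduced)
    {t : Gamma Q.toSymSeq (Gamma P.toSymSeq V)} {u : Gamma (comp Q.toSymSeq P.toSymSeq) V}
    (h : embedLeft _ _ V (Gamma.map (trace Q.toSymSeq P.toSymSeq) LinearMap.id u) =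
      embedRight _ _ V t) :
    tildeMul V Λ hP hQ (tildeAssoc V P.toSymSeq Q.toSymSeq (tildeUnits P Q V t)) =
      Gamma.map Λ.law LinearMap.id u := by
  rw [tildeAssoc_tildeUnits h, tildeMul, LinearMap.comp_apply, LinearMap.comp_apply,
    Gamma.map_comp, Gamma.map_comp, Gamma.map_comp, Gamma.map_comp]
  refine congrArg (fun φ => Gamma.map φ LinearMap.id u) ?_
  refine SymSeq.Hom.ext (funext fun S => funext fun _ => LinearMap.ext fun w => ?_)
  change Λ.mul.app S ((traceInv _ _).app S ((tcomp.map _ _).app S ((tcomp.map _ _).app S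
    ((trace _ _).app S w)))) = _
  -- The outer trace cancels by naturality, then the inner ones cancel on generators.
  rw [← trace_map, ← trace_map, traceInv_trace, ← mul_outer_inner Λ]
  refine congrArg (Λ.mul.app S) ?_
  suffices H : (comp.map (traceInv P.toSymSeq hQ) (traceInv P.toSymSeq hQ)).app S ∘ₗ
      (comp.map ((trace P.toSymSeq Q.toSymSeq).comp (outerHom P.one Q.toSymSeq))
        ((trace P.toSymSeq Q.toSymSeq).comp (innerHom P.toSymSeq Q.one))).app S =
      (comp.map (outerHom P.one Q.toSymSeq) (innerHom P.toSymSeq Q.one)).app S from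
    LinearMap.congr_fun H w
  apply comp_hom_ext
  intro k f x y
  rw [LinearMap.comp_apply, comp.map_sym, comp.map_sym, comp.map_sym]
  simp only [SymSeq.Hom.comp, LinearMap.comp_apply, traceInv_trace]

end Reduction

/-! ### Labelled decompositions and the wreath product -/

section ColoredComposites

variable {M N : SymSeq F} {p : ℕ} {r : Fin p → ℕ} {m s : Fin p → ℕ}

/-- The partition `Qᵢ`, with its blocks labelled by the pairs `(i, l)`. -/
def labelled (Q : ∀ i, Fin (m i) → Fin (s i)) (i : Fin p) (t : Fin (m i)) : Σ i, Fin (s i) :=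
  ⟨i, Q i t⟩

theorem partitionGroup_labelled (Q : ∀ i, Fin (m i) → Fin (s i)) (i : Fin p) :
    partitionGroup (labelled Q i) = partitionGroup (Q i) := by
  ext σ
  exact forall_congr' fun t => by simp [labelled]

/-- The inner monomials may all be written with the blocks `(i, l)` as index set, which does not
depend on `i`. -/
theorem beta_labelled {V : Type u} [AddCommGroup V] [Module F V] (Q : ∀ i, Fin (m i) → Fin (s i))
    (i : Fin p) (y : N.obj (Fin (m i))) (hy : FixedBy y (partitionGroup (Q i)))
    (hy' : FixedBy y (partitionGroup (labelled Q i))) (a : ∀ i, Fin (s i) → V) :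
    beta y (Q i) hy (a i) = beta y (labelled Q i) hy' (fun il => a il.1 il.2) := by
  apply Gamma.ext_component
  intro k
  by_cases hk : k = m i
  · subst hk
    rw [component_beta, component_beta, partitionGroup_labelled]; rfl
  · rw [component_beta_ne _ _ hk, component_beta_ne _ _ hk]

variable (Q : ∀ i, Fin (m i) → Fin (s i)) (x : M.obj (Fin (∑ i, r i))) (y : ∀ i, N.obj (Fin (m i)))

theorem diamond_blockEquiv (j : Fin (∑ i, r i)) (t : Fin (m (block r j))) :
    diamond r Q (blockEquiv (fun j => m (block r j)) j t).1 = labelled Q (block r j) t := by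
  change (fun z : (Σ j : Fin (∑ i, r i), Fin (m (block r j))) => labelled Q (block r z.1) z.2)
    (finSigmaFinEquiv.symm (finSigmaFinEquiv ⟨j, t⟩)) = _
  rw [Equiv.symm_apply_apply]

/-- Given a decomposition `f : S → K`, a labelling `h` of `K` by the blocks of `r` and a labelling
`G` of `S` by the pairs `(i, l)`, the pure tensor with factors the value at `h` of the equivariant
family generated by `x` and, for each part `f⁻¹ j`, the value at the restriction of `G` of the family
generated by `y_{h j}`. -/
def coloredTensor {S K : Type} [Finite S] [Finite K] (f : S → K) (h : K → Fin p)
    (G : S → Σ i, Fin (s i)) : Summand M N f :=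
  pureT M N f (spread x (block r) h) fun j =>
    spread (y (h j)) (labelled Q (h j)) fun t : Fib f j => G t.1

variable {Q x y}

theorem map_coloredTensor (hx : FixedBy x (partitionGroup (block r)))
    (hy : ∀ i, FixedBy (y i) (partitionGroup (labelled Q i)))
    {S K S' K' : Type} [Finite S] [Finite K] [Finite S'] [Finite K'] {f : S → K} {f' : S' → K'}
    {h : K → Fin p} {h' : K' → Fin p} {G : S → Σ i, Fin (s i)} {G' : S' → Σ i, Fin (s i)}
    (e : S ≃ S') (τ : K ≃ K') (hf : ∀ t, f' (e t) = τ (f t)) (hh : ∀ k, h' (τ k) = h k)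
    (hG : ∀ t, G' (e t) = G t) :
    Summand.map e τ hf (coloredTensor Q x y f h G) = coloredTensor Q x y f' h' G' := by
  obtain rfl : (fun k => h' (τ k)) = h := funext hh
  obtain rfl : (fun t => G' (e t)) = G := funext hG
  rw [coloredTensor, Summand.map_pureT, coloredTensor]
  congr 1
  · exact map_spread hx τ h'
  · funext k
    obtain ⟨k, rfl⟩ := τ.surjective k
    rw [push_apply]
    exact map_spread (hy _) (Fib.congr e _) (fun t : Fib f' (τ k) => G' t.1)

/-- The element `(x; y₁, …, y₁, …, y_p, …, y_p)`, expressed in an equivariant way. -/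
theorem compElement_eq (hx : FixedBy x (partitionGroup (block r)))
    (hy : ∀ i, FixedBy (y i) (partitionGroup (labelled Q i))) :
    compElement x (fun j => m (block r j)) (fun j => y (block r j)) =
      mk (block fun j => m (block r j)) (coloredTensor Q x y _ (block r) (diamond r Q)) := by
  rw [compElement, sym, coloredTensor]
  congr 2
  · rw [spread_eq hx (Equiv.refl _) fun _ => rfl, M.map_refl]
  · funext j
    exact (spread_eq (hy (block r j)) (g := fun t => diamond r Q t.1)
      (blockEquiv (fun j => m (block r j)) j) (diamond_blockEquiv Q j)).symm

/-- The element `(x; y₁, …, y₁, …, y_p, …, y_p)` is fixed by the wreath product. -/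
theorem compElement_fixedBy (hx : FixedBy x (partitionGroup (block r)))
    (hy : ∀ i, FixedBy (y i) (partitionGroup (labelled Q i))) :
    FixedBy (M := comp M N) (compElement x (fun j => m (block r j)) (fun j => y (block r j)))
      (wreathGroup r Q) := by
  rintro σ ⟨⟨τ, hτ, h⟩, hσ⟩
  rw [compElement_eq hx hy, mk_map σ τ h, map_coloredTensor hx hy σ τ h hτ hσ]

theorem diamondSum_fixedBy {w : M.obj (Fin (∑ j, m (block r j)))}
    (hw : FixedBy w (wreathGroup r Q)) :
    FixedBy (diamondSum r Q w) (partitionGroup (diamond r Q)) := fun σ hσ =>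
  cosetSum_invariant ((M.rep _).comp (partitionGroup (diamond r Q)).subtype) _ w
    (fun h hh => hw h.1 hh) ⟨σ, hσ⟩

theorem coloredTensor_eq_zero {S K : Type} [Finite S] [Finite K] {f : S → K} {h : K → Fin p}
    {G : S → Σ i, Fin (s i)} (j : K)
    (hj : ∀ e : Fin (m (h j)) ≃ Fib f j, ¬ ∀ t, G (e t).1 = labelled Q (h j) t) :
    coloredTensor Q x y f h G = 0 := by
  have h0 := MultilinearMap.map_coord_zero (PiTensorProduct.tprod F) (m := fun j =>
    spread (y (h j)) (labelled Q (h j)) fun t : Fib f j => G t.1) j (spread_eq_zero hj)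
  rw [coloredTensor, pureT, h0, TensorProduct.tmul_zero]

end ColoredComposites

/-! ### The trace of the symmetrized composite -/

section TraceOfDiamondSum

variable {M N : SymSeq F} {p : ℕ} {r : Fin p → ℕ} {m s : Fin p → ℕ}
  {Q : ∀ i, Fin (m i) → Fin (s i)} {x : M.obj (Fin (∑ i, r i))} {y : ∀ i, N.obj (Fin (m i))}

/-- If `coloredTensor` does not vanish, then `f` and `G` are obtained by relabelling from the
intervals underlying `r ◇ (Q₁, …, Q_p)` and from this partition. -/
theorem exists_equiv_of_coloredTensor_ne_zero {n k : ℕ} {f : Fin n → Fin k} {h : Fin k → Fin p}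
    {G : Fin n → Σ i, Fin (s i)} (h0 : coloredTensor Q x y f h G ≠ 0) :
    ∃ (e : Fin (∑ j, m (block r j)) ≃ Fin n) (ε : Fin (∑ i, r i) ≃ Fin k),
      (∀ t, f (e t) = ε (block (fun j => m (block r j)) t)) ∧ ∀ t, G (e t) = diamond r Q t := by
  have hx : ∃ ε : Fin (∑ i, r i) ≃ Fin k, ∀ j, h (ε j) = block r j := by
    by_contra! hx
    apply h0
    rw [coloredTensor, spread_eq_zero fun e he => by
      obtain ⟨j, hj⟩ := hx e
      exact hj (he j)]
    exact TensorProduct.zero_tmul _ _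
  obtain ⟨ε, hε⟩ := hx
  have hy : ∀ j, ∃ e : Fin (m (h j)) ≃ Fib f j, ∀ t, G (e t).1 = labelled Q (h j) t := by
    by_contra! hy
    obtain ⟨j, hj⟩ := hy
    exact h0 (coloredTensor_eq_zero j fun e he => by
      obtain ⟨t, ht⟩ := hj e
      exact ht (he t))
  have hy' : ∀ j, ∃ e : Fin (m (block r j)) ≃ Fib f (ε j),
      ∀ t, G (e t).1 = labelled Q (block r j) t := fun j => by
    have := hy (ε j)
    rwa [hε] at this
  choose θ hθ using hy'
  refine ⟨finSigmaFinEquiv.symm.trans ((Equiv.sigmaCongr ε θ).trans (Equiv.sigmaFiberEquiv f)), ε,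
    fun t => ?_, fun t => ?_⟩
  · exact (θ _ _).2
  · exact hθ _ _

theorem map_diamondSum {w : M.obj (Fin (∑ j, m (block r j)))} {T : Type} [Finite T]
    (e : Fin (∑ j, m (block r j)) ≃ T) :
    M.map e (diamondSum r Q w) =
      ∑ c : partitionGroup (diamond r Q) ⧸
        (wreathGroup r Q).subgroupOf (partitionGroup (diamond r Q)),
        M.map ((c.out : Equiv.Perm _).trans e) w := by
  rw [diamondSum, cosetSum, map_sum]
  exact Finset.sum_congr rfl fun c _ => (M.map_trans _ _ _).symm

theorem map_compElement (hx : FixedBy x (partitionGroup (block r)))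
    (hy : ∀ i, FixedBy (y i) (partitionGroup (labelled Q i))) {T : Type} [Finite T]
    {G : T → Σ i, Fin (s i)} (e : Fin (∑ j, m (block r j)) ≃ T)
    (he : ∀ t, G (e t) = diamond r Q t) :
    (comp M N).map e (compElement x (fun j => m (block r j)) (fun j => y (block r j))) =
      mk (fun t => block (fun j => m (block r j)) (e.symm t))
        (coloredTensor Q x y _ (block r) G) := by
  have hB : ∀ t, block (fun j => m (block r j)) (e.symm (e t)) =
      Equiv.refl _ (block (fun j => m (block r j)) t) := fun t => by
    rw [Equiv.symm_apply_apply, Equiv.refl_apply]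
  rw [compElement_eq hx hy]
  exact (mk_map e (Equiv.refl _) hB _).trans
    (congrArg _ (map_coloredTensor hx hy _ _ hB (fun _ => rfl) he))

theorem fst_diamond (t : Fin (∑ j, m (block r j))) :
    (diamond r Q t).1 = block r (block (fun j => m (block r j)) t) := rfl

/-- If `f` is surjective, the labels `G` of the inputs determine the only labelling of the parts
which may contribute. -/
theorem coloredTensor_eq_zero_of_ne {S K : Type} [Finite S] [Finite K] {f : S → K}
    {h h' : K → Fin p} {G : S → Σ i, Fin (s i)} (hf : Function.Surjective f) (hG : ∀ t, (G t).1 = h' (f t))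
    (hh : h ≠ h') : coloredTensor Q x y f h G = 0 := by
  obtain ⟨j, hj⟩ := Function.ne_iff.1 hh
  refine coloredTensor_eq_zero j fun e he => hj ?_
  obtain ⟨t, rfl⟩ := hf j
  have h1 := he (e.symm ⟨t, rfl⟩)
  rw [Equiv.apply_symm_apply] at h1
  rw [← hG, h1]; rfl

/-- The components of the trace of the equivariant family generated by the symmetrization of
`(x; y₁, …, y₁, …, y_p, …, y_p)` over `S_{r ◇ Q}`. At most one coset contributes to a given
component: the cosets correspond to the decompositions of the inputs which are compatible with the
labels. -/
theorem tcpt_trace_spread_diamondSum (hN : N.Reduced) (hx : FixedBy x (partitionGroup (block r)))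
    (hy : ∀ i, FixedBy (y i) (partitionGroup (labelled Q i))) {n k : ℕ} (f : Fin n → Fin k)
    (G : Fin n → Σ i, Fin (s i)) :
    tcpt f ((trace M N).app (Fin n) (spread
      (diamondSum (M := comp M N) r Q
        (compElement x (fun j => m (block r j)) fun j => y (block r j))) (diamond r Q) G)) =
      ∑ h : Fin k → Fin p, coloredTensor Q x y f h G := by
  by_cases hf : Function.Surjective f
  swap
  · rw [Finset.sum_eq_zero fun h _ => Summand.eq_zero hN f hf _]
    exact Summand.eq_zero hN f hf _
  have hW := diamondSum_fixedBy (compElement_fixedBy hx hy)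
  -- The contribution of a coset, when `e` carries `r ◇ Q` to `G`.
  have hterm : ∀ (e : Fin (∑ j, m (block r j)) ≃ Fin n) (σ : partitionGroup (diamond r Q)),
      (∀ t, G (e t) = diamond r Q t) → (comp M N).map (Equiv.trans (σ : Equiv.Perm _) e)
        (compElement x (fun j => m (block r j)) fun j => y (block r j)) =
        mk (fun t => block (fun j => m (block r j)) ((Equiv.trans (σ : Equiv.Perm _) e).symm t))
          (coloredTensor Q x y _ (block r) G) := fun e σ he =>
    map_compElement hx hy _ fun t => (he _).trans (σ.2 t)
  by_cases hgood : ∃ (e : Fin (∑ j, m (block r j)) ≃ Fin n) (ε : Fin (∑ i, r i) ≃ Fin k),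
      (∀ t, f (e t) = ε (block (fun j => m (block r j)) t)) ∧ ∀ t, G (e t) = diamond r Q t
  · obtain ⟨e, ε, hfe, he⟩ := hgood
    -- The intervals are nonempty, so a permutation of the inputs determines the permutation of the
    -- intervals that it induces.
    have hsurj : Function.Surjective (block fun j => m (block r j)) := fun j => by
      obtain ⟨t, ht⟩ := hf (ε j)
      refine ⟨e.symm t, ε.injective ?_⟩
      rw [← hfe, e.apply_symm_apply, ht]
    rw [spread_eq hW e he, map_diamondSum, map_sum, map_sum]
    -- By the choice of `e`, only the trivial coset contributes.
    let c₀ : partitionGroup (diamond r Q) ⧸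
        (wreathGroup r Q).subgroupOf (partitionGroup (diamond r Q)) :=
      QuotientGroup.mk 1
    rw [Finset.sum_eq_single c₀, Finset.sum_eq_single (fun j => block r (ε.symm j))]
    · have hc₀ : c₀.out ∈ (wreathGroup r Q).subgroupOf (partitionGroup (diamond r Q)) := by
        have : (1 : partitionGroup (diamond r Q))⁻¹ * c₀.out ∈ _ :=
          QuotientGroup.eq.1 (QuotientGroup.out_eq' c₀).symm
        simpa using this
      obtain ⟨⟨τ, hτ, hτ'⟩, -⟩ := hc₀
      rw [hterm e c₀.out he]
      refine (tcpt_trace_mk ?_ f (τ.trans ε) ?_ _).trans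
        (map_coloredTensor hx hy _ _ _ ?_ fun _ => rfl)
      · intro ρ hρ
        ext j
        obtain ⟨t, rfl⟩ := hsurj j
        have := hρ (Equiv.trans (c₀.out : Equiv.Perm _) e t)
        rw [Equiv.symm_apply_apply] at this
        rw [this]; rfl
      · intro t
        obtain ⟨t, rfl⟩ := (Equiv.trans (c₀.out : Equiv.Perm _) e).surjective t
        rw [Equiv.symm_apply_apply, Equiv.trans_apply, Equiv.trans_apply, hfe, ← hτ']
        rfl
      · intro j
        simpa using hτ j
    · intro h _ hh
      refine coloredTensor_eq_zero_of_ne hf (fun t => ?_) hh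
      obtain ⟨t, rfl⟩ := e.surjective t
      rw [he, hfe, Equiv.symm_apply_apply, fst_diamond]
    · simp
    · intro c _ hc
      rw [hterm e c.out he]
      refine tcpt_trace_mk_eq_zero (fun ε' hε' => hc ?_) _
      have h1 : ∀ t, ε (block (fun j => m (block r j)) ((c.out : Equiv.Perm _) t)) =
          ε' (block (fun j => m (block r j)) t) := fun t => by
        have := hε' (Equiv.trans (c.out : Equiv.Perm _) e t)
        rw [Equiv.symm_apply_apply] at this
        rw [← this, ← hfe]; rfl
      have h2 : c.out ∈ (wreathGroup r Q).subgroupOf (partitionGroup (diamond r Q)) := by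
        refine ⟨⟨ε'.trans ε.symm, fun j => ?_, fun t => ?_⟩, c.out.2⟩
        · obtain ⟨t, rfl⟩ := hsurj j
          rw [Equiv.trans_apply, ← h1, Equiv.symm_apply_apply]
          rw [← fst_diamond, ← fst_diamond, c.out.2 t]
        · rw [Equiv.trans_apply, ← h1, Equiv.symm_apply_apply]
          rfl
      rw [← QuotientGroup.out_eq' c]
      exact QuotientGroup.eq.2 (by simpa using h2)
    · simp
  · rw [Finset.sum_eq_zero fun h _ => by_contra fun h0 =>
      hgood (exists_equiv_of_coloredTensor_ne_zero h0)]
    by_cases hG : ∃ e : Fin (∑ j, m (block r j)) ≃ Fin n, ∀ t, G (e t) = diamond r Q t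
    · obtain ⟨e, he⟩ := hG
      rw [spread_eq hW e he, map_diamondSum, map_sum, map_sum]
      refine Finset.sum_eq_zero fun c _ => ?_
      rw [hterm e c.out he]
      refine tcpt_trace_mk_eq_zero (fun ε hε => hgood ⟨Equiv.trans (c.out : Equiv.Perm _) e, ε,
        fun t => ?_, fun t => (he _).trans (c.out.2 t)⟩) _
      rw [hε, Equiv.symm_apply_apply]
    · rw [spread_eq_zero fun e he => hG ⟨e, he⟩, map_zero, map_zero]

end TraceOfDiamondSum

/-! ### The associator on iterated monomials -/

section AssociatorOfMonomials

variable {M N : SymSeq F} {p : ℕ} {r : Fin p → ℕ} {m s : Fin p → ℕ}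
  {Q : ∀ i, Fin (m i) → Fin (s i)} {x : M.obj (Fin (∑ i, r i))} {y : ∀ i, N.obj (Fin (m i))}
  {V : Type u} [AddCommGroup V] [Module F V]

/-- A labelling of `S` amounts to labellings of all the fibres of `f`. -/
def fibLabels {S K J : Type} (f : S → K) : (S → J) ≃ (∀ k, Fib f k → J) where
  toFun G k t := G t.1
  invFun g t := g (f t) ⟨t, rfl⟩
  left_inv _ := rfl
  right_inv g := by
    funext k t
    obtain ⟨t, rfl⟩ := t
    rfl

/-- The associator and the trace identify the iterated monomial
`β_{x,r}(β_{y₁,Q₁}(a₁), …, β_{y_p,Q_p}(a_p))` with a monomial for the partition `r ◇ Q`. -/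
theorem embedLeft_beta_diamond (hN : N.Reduced) (hx : FixedBy x (partitionGroup (block r)))
    (hy : ∀ i, FixedBy (y i) (partitionGroup (Q i))) (a : ∀ i, Fin (s i) → V)
    (hW : FixedBy (diamondSum (M := comp M N) r Q
      (compElement x (fun j => m (block r j)) fun j => y (block r j)))
      (partitionGroup (diamond r Q))) :
    embedLeft M N V (Gamma.map (trace M N) LinearMap.id
      (beta _ (diamond r Q) hW fun il => a il.1 il.2)) =
    embedRight M N V (beta x (block r) hx fun i => beta (y i) (Q i) (hy i) (a i)) := by
  have hy' : ∀ i, FixedBy (y i) (partitionGroup (labelled Q i)) := fun i => by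
    rw [partitionGroup_labelled]; exact hy i
  funext n k f
  rw [embedLeft_eq_splitAt, embedRight_eq_evalAt, Gamma.component_map, ← Gamma.eval_fin,
    ← Gamma.eval_fin, Gamma.eval_beta, Gamma.eval_beta, map_sum, map_sum, map_sum]
  simp only [Tens.hom_tmul, splitAt_tmul, evalAt_tmul,
    tcpt_trace_spread_diamondSum hN hx hy', map_sum, beta_labelled Q _ _ (hy _) (hy' _) a,
    Gamma.eval_beta]
  -- Both sides are sums over the labels `h` of the parts and the labels `G` of the inputs.
  rw [Finset.sum_comm]
  refine Finset.sum_congr rfl fun h _ => ?_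
  rw [MultilinearMap.map_sum, TensorProduct.tmul_sum]
  refine Fintype.sum_equiv (fibLabels f) _ _ fun G => ?_
  rw [coloredTensor, decorate_pureT]
  rfl

end AssociatorOfMonomials

/-! ### Naturality of monomial elements -/

section NaturalityOfMonomials

variable {M M' : SymSeq F} {V : Type u} [AddCommGroup V] [Module F V] {n : ℕ}

theorem FixedBy.app {x : M.obj (Fin n)} {K : Subgroup (Equiv.Perm (Fin n))} (hx : FixedBy x K)
    (φ : SymSeq.Hom M M') : FixedBy (φ.app _ x) K := fun σ hσ => by
  rw [← φ.naturality, hx σ hσ]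

theorem app_diamondSum (φ : SymSeq.Hom M M') {p : ℕ} (r : Fin p → ℕ) {m s : Fin p → ℕ}
    (Q : ∀ i, Fin (m i) → Fin (s i)) (w : M.obj (Fin (∑ j, m (block r j)))) :
    φ.app _ (diamondSum r Q w) = diamondSum r Q (φ.app _ w) := by
  rw [diamondSum, diamondSum, cosetSum, cosetSum, map_sum]
  exact Finset.sum_congr rfl fun c _ => φ.naturality _ w

theorem Gamma.map_beta {J : Type} (φ : SymSeq.Hom M M') (x : M.obj (Fin n)) (R : Fin n → J)
    (hx : FixedBy x (partitionGroup R)) (x' : M'.obj (Fin n)) (hx' : FixedBy x' (partitionGroup R))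
    (h : φ.app _ x = x') (a : J → V) :
    Gamma.map φ LinearMap.id (beta x R hx a) = beta x' R hx' a := by
  subst h
  apply Gamma.ext_component
  intro k
  rw [Gamma.component_map]
  by_cases hk : k = n
  · subst hk
    rw [component_beta, component_beta, cosetSum, cosetSum, map_sum]
    refine Finset.sum_congr rfl fun c _ => ?_
    exact (Tens.hom_map φ LinearMap.id c.out _).trans
      (congrArg (Tens.map c.out) (Tens.hom_tmul φ LinearMap.id x _))
  · rw [component_beta_ne _ _ hk, component_beta_ne _ _ hk, map_zero]

end NaturalityOfMonomials

end

end DivPow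

theorem lemma6p2 {F : Type u} [Field F] (P Q : DivPow.Operad F)
    (hP : P.Reduced) (hQ : Q.Reduced) (Λ : DivPow.DistributiveLaw P Q)
    (V : Type u) [AddCommGroup V] [Module F V]
    {p : ℕ} (r : Fin p → ℕ) (x : Q.obj (Fin (∑ i, r i)))
    (hx : DivPow.FixedBy x (DivPow.partitionGroup (DivPow.block r)))
    (s : Fin p → ℕ) (q : ∀ i, Fin (s i) → ℕ)
    (y : ∀ i, P.obj (Fin (∑ l, q i l)))
    (hy : ∀ i, DivPow.FixedBy (y i) (DivPow.partitionGroup (DivPow.block (q i))))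
    (a : ∀ i, Fin (s i) → V) :
    let w := Λ.law.app _ (DivPow.compElement x (fun j => ∑ l, q (DivPow.block r j) l)
      fun j => y (DivPow.block r j))
    DivPow.FixedBy w (DivPow.wreathGroup r fun i => DivPow.block (q i)) ∧
    ∃ h : DivPow.FixedBy (DivPow.diamondSum r (fun i => DivPow.block (q i)) w)
        (DivPow.partitionGroup (DivPow.diamond r fun i => DivPow.block (q i))),
      DivPow.tildeLambda V Λ hP hQ
          (DivPow.beta x (DivPow.block r) hx
            fun i => DivPow.beta (y i) (DivPow.block (q i)) (hy i) (a i)) =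
        DivPow.assocGammaInv P.toSymSeq Q.toSymSeq V
          (DivPow.Gamma.map (DivPow.trace P.toSymSeq Q.toSymSeq) LinearMap.id
            (DivPow.beta (DivPow.diamondSum r (fun i => DivPow.block (q i)) w)
              (DivPow.diamond r fun i => DivPow.block (q i)) h fun il => a il.1 il.2)) := by
  intro w
  have hy' : ∀ i, DivPow.FixedBy (y i) (DivPow.partitionGroup
      (DivPow.labelled (fun i => DivPow.block (q i)) i)) := fun i => by
    rw [DivPow.partitionGroup_labelled]; exact hy i
  have hw₀ := DivPow.compElement_fixedBy (Q := fun i => DivPow.block (q i)) hx hy'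
  have hw := hw₀.app Λ.law
  refine ⟨hw, DivPow.diamondSum_fixedBy hw, ?_⟩
  rw [DivPow.tildeLambda, LinearMap.comp_apply, LinearMap.comp_apply, LinearMap.comp_apply,
    LinearMap.comp_apply, DivPow.tildeMul_tildeAssoc_tildeUnits Λ hP hQ
      (DivPow.embedLeft_beta_diamond (Q := fun i => DivPow.block (q i)) hP hx hy a
        (DivPow.diamondSum_fixedBy hw₀))]
  rw [DivPow.Gamma.map_beta Λ.law _ _ _ _ _ (DivPow.app_diamondSum Λ.law r _ _)]
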